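/- Let $G=SL_2(\mathbb Z)$. A congruence subgroup is a subgroup $\Gamma\le G$ that contains $\ker(SL_2(\mathbb Z)\to SL_2(\mathbb Z/N))$ for some $N\ge 1$. For $n\ge 1$ put $g=\mathrm{diag}(1,1/n)\in GL_2(\mathbb Q)$ and $\Gamma'=\Gamma\cap g\Gamma g^{-1}$. The Hecke operator $T_n\colon H^m(\Gamma,\mathbb Z)\to H^m(\Gamma,\mathbb Z)$ (trivial coefficients) is the composite of the map $H^m(\Gamma,\mathbb Z)\to H^m(\Gamma',\mathbb Z)$ induced by the homomorphism $\Gamma'\to\Gamma$, $\gamma\mapsto g^{-1}\gamma g$, with the transfer $H^m(\Gamma',\mathbb Z)\to H^m(\Gamma,\mathbb Z)$. The Hecke operators on $H^m(\Gamma,\mathbb Z)$ can be implemented on a computer, uniformly in $m$, in $n$ and in the congruence subgroup $\Gamma$ given by a membership test. Precisely, there are four algorithms (partial recursive functions) such that for every congruence subgroup $\Gamma\le G$, every program $c$ that decides for $A\in G$ whether $A\in\Gamma$, and every $m\ge 0$ the following holds. 1. The first algorithm, on input $(c,m)$, halts with a list $d_1,\dots,d_r$ of non-negative integers, and there is an isomorphism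 $e\colon\bigoplus_{i=1}^r\mathbb Z/d_i\mathbb Z\to H^m(\Gamma,\mathbb Z)$ (where $\mathbb Z/0\mathbb Z=\mathbb Z$) that satisfies 2, 3 and 4. 2. For every $v\in\mathbb Z^r$ there is an inhomogeneous cocycle $z\colon\Gamma^m\to\mathbb Z$ with class $e(v)$ such that the second algorithm, on input $(c,m,v,x)$ with $x\in\Gamma^m$, halts with the value $z(x)$. 3. For every inhomogeneous cocycle $z\colon\Gamma^m\to\mathbb Z$ and every program $f$ that computes $z$ on $\Gamma^m$, the third algorithm, on input $(c,m,f)$, halts with a vector $v\in\mathbb Z^r$ such that $e(v)$ is the class of $z$. 4. For every $n\ge 1$ the fourth algorithm, on input $(c,m,n)$, halts with an integer $r\times r$ matrix $M$ such that $T_n(e(v))=e(Mv)$ for all $v\in\mathbb Z^r$. -/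

import Mathlib

open scoped MatrixGroups

section Transfer

open CategoryTheory groupCohomology

variable {G : Type} [Group G]

/-- The group cohomology `H^m(G, ℤ)` of `G` with coefficients in the trivial module `ℤ`. -/
noncomputable abbrev integralCohomology (G : Type) [Group G] (m : ℕ) : ModuleCat ℤ :=
  groupCohomology (Rep.trivial ℤ G ℤ) m

/-- The class in `H^m(G, ℤ)` of an inhomogeneous cocycle `G^m → ℤ`. -/
noncomputable abbrev cohomologyClass {m : ℕ} (z : cocycles (Rep.trivial ℤ G ℤ) m) :
    integralCohomology G m :=
  (π (Rep.trivial ℤ G ℤ) m).hom z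

/-- The value of an inhomogeneous cocycle `G^m → ℤ` at a tuple. -/
noncomputable abbrev cocycleValue {m : ℕ} (z : cocycles (Rep.trivial ℤ G ℤ) m) (x : Fin m → G) :
    ℤ :=
  (show (Fin m → G) → ℤ from (iCocycles (Rep.trivial ℤ G ℤ) m).hom z) x

noncomputable instance fintypeRightCosets (S : Subgroup G) [S.FiniteIndex] :
    Fintype (Quotient (QuotientGroup.rightRel S)) :=
  have : Finite (Quotient (QuotientGroup.rightRel S)) := Finite.of_equiv _ (QuotientGroup.quotientRightRelEquivQuotientLeftRel S).symm
  Fintype.ofFinite _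

/-- The chosen representative of the right coset `S x`. -/
noncomputable def cosetRep (S : Subgroup G) (x : G) : G :=
  (Quotient.mk (QuotientGroup.rightRel S) x).out

theorem cosetRep_mul_inv_mem (S : Subgroup G) (x : G) : x * (cosetRep S x)⁻¹ ∈ S :=
  QuotientGroup.rightRel_apply.1 (Quotient.exact (Quotient.out_eq (Quotient.mk
    (QuotientGroup.rightRel S) x)))

theorem cosetRep_congr (S : Subgroup G) {x y : G} (h : y * x⁻¹ ∈ S) :
    cosetRep S x = cosetRep S y := by
  unfold cosetRep
  rw [Quotient.sound (s := QuotientGroup.rightRel S) (QuotientGroup.rightRel_apply.2 h)]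

theorem cosetRep_cosetRep_mul (S : Subgroup G) (x y : G) :
    cosetRep S (cosetRep S x * y) = cosetRep S (x * y) := by
  apply cosetRep_congr
  have := cosetRep_mul_inv_mem S x
  simpa [mul_assoc] using this

theorem cosetRep_out (S : Subgroup G) (q : Quotient (QuotientGroup.rightRel S)) :
    cosetRep S q.out = q.out := by
  unfold cosetRep
  rw [Quotient.out_eq]

/-- With `r` the chosen representatives of right cosets, `x ↦ x r(x)⁻¹` is an `S`-equivariant map
`G → S`.  It sends the homogeneous tuple `(x, x g₀, x g₀ g₁, …)` of elements of `G` to a homogeneous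
tuple of elements of `S`, whose inhomogeneous form has the entries
`r(x g₀ ⋯ gᵢ₋₁) gᵢ r(x g₀ ⋯ gᵢ)⁻¹`. -/
noncomputable def cosetTuple (S : Subgroup G) (x : G) {m : ℕ} (g : Fin m → G) (i : Fin m) : S :=
  ⟨cosetRep S (x * Fin.partialProd g i.castSucc) * g i *
      (cosetRep S (x * Fin.partialProd g i.succ))⁻¹, by
    rw [Fin.partialProd_succ, ← mul_assoc, ← cosetRep_cosetRep_mul S (x * _)]
    exact cosetRep_mul_inv_mem S _⟩

theorem cosetTuple_tail (S : Subgroup G) (x : G) {m : ℕ} (g : Fin (m + 1) → G) :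
    (fun i : Fin m => cosetTuple S x g i.succ) =
      cosetTuple S (cosetRep S (x * g 0)) (fun i => g i.succ) := by
  funext i
  apply Subtype.ext
  simp only [cosetTuple, Fin.partialProd_succ', Fin.castSucc_succ]
  simp only [cosetRep_cosetRep_mul, mul_assoc]
  rfl

theorem cosetTuple_contractNth (S : Subgroup G) (x : G) {m : ℕ} (g : Fin (m + 1) → G)
    (j : Fin (m + 1)) :
    cosetTuple S x (Fin.contractNth j (· * ·) g) =
      Fin.contractNth j (· * ·) (cosetTuple S x g) := by
  funext k
  apply Subtype.ext
  simp only [cosetTuple, Fin.partialProd_contractNth, Function.comp_apply]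
  rcases lt_trichotomy (k : ℕ) j with h | h | h
  · rw [Fin.contractNth_apply_of_lt _ _ _ _ h, Fin.contractNth_apply_of_lt _ _ _ _ h]
    have h1 : j.succ.succAbove k.castSucc = k.castSucc.castSucc :=
      Fin.succAbove_of_castSucc_lt _ _ (by simp [Fin.lt_def]; omega)
    have h2 : j.succ.succAbove k.succ = k.succ.castSucc :=
      Fin.succAbove_of_castSucc_lt _ _ (by simp [Fin.lt_def]; omega)
    simp [h1, h2, cosetTuple]
  · rw [Fin.contractNth_apply_of_eq _ _ _ _ h, Fin.contractNth_apply_of_eq _ _ _ _ h]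
    have h1 : j.succ.succAbove k.castSucc = k.castSucc.castSucc :=
      Fin.succAbove_of_castSucc_lt _ _ (by simp [Fin.lt_def]; omega)
    have h2 : j.succ.succAbove k.succ = k.succ.succ :=
      Fin.succAbove_of_le_castSucc _ _ (by simp [Fin.le_def]; omega)
    simp [h1, h2, cosetTuple, mul_assoc]
  · rw [Fin.contractNth_apply_of_gt _ _ _ _ h, Fin.contractNth_apply_of_gt _ _ _ _ h]
    have h1 : j.succ.succAbove k.castSucc = k.succ.castSucc :=
      (Fin.succAbove_of_le_castSucc _ _ (by simp [Fin.le_def]; omega)).trans (by simp)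
    have h2 : j.succ.succAbove k.succ = k.succ.succ :=
      Fin.succAbove_of_le_castSucc _ _ (by simp [Fin.le_def]; omega)
    simp [h1, h2, cosetTuple]

/-- Right translation by `y` on the right cosets of `S`. -/
noncomputable def rightCosetsTranslate (S : Subgroup G) (y : G) :
    Quotient (QuotientGroup.rightRel S) ≃ Quotient (QuotientGroup.rightRel S) where
  toFun q := Quotient.mk _ (q.out * y)
  invFun q := Quotient.mk _ (q.out * y⁻¹)
  left_inv q := by
    have := cosetRep_cosetRep_mul S (q.out * y) y⁻¹
    have h2 := congrArg (Quotient.mk (QuotientGroup.rightRel S)) this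
    simpa [cosetRep] using h2
  right_inv q := by
    have := cosetRep_cosetRep_mul S (q.out * y⁻¹) y
    have h2 := congrArg (Quotient.mk (QuotientGroup.rightRel S)) this
    simpa [cosetRep] using h2

/-- The transfer on cochains, for a subgroup `S` of finite index in `G`: a homogeneous cochain on
`S`, viewed as an `S`-invariant cochain on `G` by means of the equivariant map `G → S` above, is
summed over its translates by representatives of the right cosets of `S`. -/
noncomputable def transferCochain (S : Subgroup G) [S.FiniteIndex] (m : ℕ) :
    ((Fin m → S) → ℤ) →ₗ[ℤ] ((Fin m → G) → ℤ) where
  toFun f g := ∑ q : Quotient (QuotientGroup.rightRel S), f (cosetTuple S q.out g)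
  map_add' f f' := by
    funext g
    simp [Finset.sum_add_distrib]
  map_smul' a f := by
    funext g
    simp [Finset.mul_sum]

/-- The transfer as a morphism of cochain complexes. -/
noncomputable def transferCochainMap (S : Subgroup G) [S.FiniteIndex] :
    inhomogeneousCochains (Rep.trivial ℤ S ℤ) ⟶ inhomogeneousCochains (Rep.trivial ℤ G ℤ) where
  f m := ModuleCat.ofHom (transferCochain S m)
  comm' i j (hij : _ = _) := by
    subst hij
    rw [inhomogeneousCochains.d_def, inhomogeneousCochains.d_def]
    apply ModuleCat.hom_ext
    apply LinearMap.ext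
    intro f
    funext g
    simp only [ModuleCat.hom_comp, LinearMap.comp_apply, ModuleCat.hom_ofHom]
    simp only [inhomogeneousCochains.d_hom_apply, transferCochain, LinearMap.coe_mk, AddHom.coe_mk,
      smul_eq_mul, Finset.sum_add_distrib]
    congr 1
    · refine (Fintype.sum_equiv (rightCosetsTranslate S (g 0)) _ _ fun q => ?_).symm
      rw [cosetTuple_tail]
      rfl
    · rw [Finset.sum_comm]
      refine Finset.sum_congr rfl fun j _ => ?_
      rw [Finset.mul_sum]
      refine Finset.sum_congr rfl fun q _ => ?_
      rw [cosetTuple_contractNth]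

/-- The transfer `H^m(S, ℤ) → H^m(G, ℤ)` for a subgroup `S` of finite index in `G`. -/
noncomputable def transfer (S : Subgroup G) [S.FiniteIndex] (m : ℕ) :
    integralCohomology S m ⟶ integralCohomology G m :=
  HomologicalComplex.homologyMap (transferCochainMap S) m

end Transfer

section Hecke

open CategoryTheory Matrix.SpecialLinearGroup

/-- `γ ↦ g⁻¹ γ g`, as a homomorphism from `Γ` to `GL₂(ℚ)`. -/
noncomputable def conjToGL (Γ : Subgroup SL(2, ℤ)) (g : GL (Fin 2) ℚ) : Γ →* GL (Fin 2) ℚ :=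
  (MulAut.conj g⁻¹).toMonoidHom.comp ((mapGL ℚ).comp Γ.subtype)

/-- The subgroup `Γ ∩ g Γ g⁻¹` of `Γ`. -/
noncomputable def heckeSubgroup (Γ : Subgroup SL(2, ℤ)) (g : GL (Fin 2) ℚ) : Subgroup Γ :=
  (Γ.map (mapGL ℚ)).comap (conjToGL Γ g)

/-- The homomorphism `γ ↦ g⁻¹ γ g` from `Γ ∩ g Γ g⁻¹` to `Γ`. -/
noncomputable def heckeConj (Γ : Subgroup SL(2, ℤ)) (g : GL (Fin 2) ℚ) : heckeSubgroup Γ g →* Γ :=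
  (Γ.equivMapOfInjective (mapGL ℚ) mapGL_injective).symm.toMonoidHom.comp
    ((conjToGL Γ g).subgroupComap (Γ.map (mapGL ℚ)))

theorem mapGL_heckeConj (Γ : Subgroup SL(2, ℤ)) (g : GL (Fin 2) ℚ) (γ : heckeSubgroup Γ g) :
    mapGL ℚ (heckeConj Γ g γ : SL(2, ℤ)) = g⁻¹ * mapGL ℚ ((γ : Γ) : SL(2, ℤ)) * g := by
  have h := (Γ.equivMapOfInjective (mapGL ℚ) mapGL_injective).apply_symm_apply
    ((conjToGL Γ g).subgroupComap (Γ.map (mapGL ℚ)) γ)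
  have h2 := congrArg Subtype.val h
  rw [Subgroup.coe_equivMapOfInjective_apply] at h2
  refine Eq.trans h2 ?_
  change g⁻¹ * mapGL ℚ ((γ : Γ) : SL(2, ℤ)) * g⁻¹⁻¹ = _
  rw [inv_inv]

instance heckeSubgroup_finiteIndex (Γ : Subgroup SL(2, ℤ)) [Γ.FiniteIndex] (g : GL (Fin 2) ℚ) :
    (heckeSubgroup Γ g).FiniteIndex := by
  have h1 : (CongruenceSubgroup.conjGL Γ (g⁻¹.map (Rat.castHom ℝ))).FiniteIndex := by
    unfold CongruenceSubgroup.conjGL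
    have h0 := Subgroup.IsArithmetic.conj (Γ.map (mapGL ℝ)) g
    rw [← map_inv, inv_inv]
    infer_instance
  have h2 : (CongruenceSubgroup.conjGL Γ (g⁻¹.map (Rat.castHom ℝ))).subgroupOf Γ ≤
      heckeSubgroup Γ g := by
    intro γ hγ
    rw [Subgroup.mem_subgroupOf, CongruenceSubgroup.mem_conjGL] at hγ
    obtain ⟨y, hy, h⟩ := hγ
    refine ⟨y, hy, ?_⟩
    have hinj : Function.Injective (Matrix.GeneralLinearGroup.map (n := Fin 2) (Rat.castHom ℝ)) :=
      Units.map_injective (Matrix.map_injective (Rat.castHom ℝ).injective)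
    have hmap : ∀ a : SL(2, ℤ), Matrix.GeneralLinearGroup.map (Rat.castHom ℝ) (mapGL ℚ a) =
        mapGL ℝ a := by
      intro a
      ext i j
      simp [mapGL]
    apply hinj
    change _ = Matrix.GeneralLinearGroup.map (Rat.castHom ℝ)
      (g⁻¹ * mapGL ℚ (γ : SL(2, ℤ)) * g⁻¹⁻¹)
    rw [map_mul, map_mul, hmap, hmap, map_inv _ g⁻¹]
    exact h
  exact Subgroup.finiteIndex_of_le h2

/-- The Hecke operator `T_g = tr ∘ α ∘ β` on `H^m(Γ, ℤ)`, where `α ∘ β` is induced by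
the homomorphism `γ ↦ g⁻¹ γ g` from `Γ ∩ g Γ g⁻¹` to `Γ` and `tr` is the transfer from
`Γ ∩ g Γ g⁻¹` to `Γ`. -/
noncomputable def heckeOperator (Γ : Subgroup SL(2, ℤ)) [Γ.FiniteIndex] (g : GL (Fin 2) ℚ)
    (m : ℕ) : integralCohomology Γ m ⟶ integralCohomology Γ m :=
  groupCohomology.map (A := Rep.trivial ℤ Γ ℤ) (B := Rep.trivial ℤ (heckeSubgroup Γ g) ℤ)
      (heckeConj Γ g) (𝟙 _) m ≫
    transfer (heckeSubgroup Γ g) m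

/-- The matrix `diag(1, 1/n)`. -/
noncomputable def heckeMatrix (n : ℕ+) : GL (Fin 2) ℚ :=
  Matrix.GeneralLinearGroup.mkOfDetNeZero !![1, 0; 0, 1 / (n : ℚ)] (by simp)

/-- The Hecke operator `T_n` on `H^m(Γ, ℤ)`, for a congruence subgroup `Γ`. -/
noncomputable def heckeT (Γ : Subgroup SL(2, ℤ)) (hΓ : CongruenceSubgroup.IsCongruenceSubgroup Γ)
    (n : ℕ+) (m : ℕ) : integralCohomology Γ m ⟶ integralCohomology Γ m :=
  haveI : Γ.FiniteIndex := hΓ.finiteIndex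
  heckeOperator Γ (heckeMatrix n) m

end Hecke

section Algorithms

/-- The entries of a matrix, as input for an algorithm. -/
def matrixEntries (A : SL(2, ℤ)) : ℤ × ℤ × ℤ × ℤ := (A 0 0, A 0 1, A 1 0, A 1 1)

/-- The program `c` is a membership test for `Γ`: run on any matrix in `SL₂(ℤ)` it halts, with
output `1` if the matrix lies in `Γ` and output `0` otherwise. -/
def IsMembershipTest (c : Nat.Partrec.Code) (Γ : Subgroup SL(2, ℤ)) : Prop :=
  ∀ A : SL(2, ℤ), (A ∈ Γ → c.eval (Encodable.encode (matrixEntries A)) = Part.some 1) ∧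
    (A ∉ Γ → c.eval (Encodable.encode (matrixEntries A)) = Part.some 0)

/-- An `m`-tuple of elements of `Γ`, as input for an algorithm. -/
def tupleEntries {Γ : Subgroup SL(2, ℤ)} {m : ℕ} (x : Fin m → Γ) : List (ℤ × ℤ × ℤ × ℤ) :=
  List.ofFn fun i => matrixEntries (x i)

/-- The program `f` evaluates the inhomogeneous cocycle `z` at every `m`-tuple of elements
of `Γ`. -/
def ComputesCocycle {Γ : Subgroup SL(2, ℤ)} {m : ℕ} (f : Nat.Partrec.Code)
    (z : groupCohomology.cocycles (Rep.trivial ℤ Γ ℤ) m) : Prop :=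
  ∀ x : Fin m → Γ,
    f.eval (Encodable.encode (tupleEntries x)) = Part.some (Encodable.encode (cocycleValue z x))

end Algorithms

/-! ### Primitive recursive arithmetic of integers. -/

section IntegerArithmetic

/-! The group `SL₂(ℤ)` is the amalgam of cyclic groups of orders four and six over `±1`. Call a
tuple of matrices a clique if its entries lie in a common left coset of one of the two cyclic
groups. Cliques span a subcomplex of the augmented complex of all tuples, and this subcomplex is
exact because the cosets form a tree (`modular_isTreeLike`, `IsTreeLike.exact`). A subgroup `Γ` of
finite index has only finitely many orbits on cliques of a given positive length, and the action is
free. The `Γ`-invariant cochains on cliques are therefore finite free `ℤ`-modules with explicit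
coboundary matrices, and their cohomology is that of `Γ`.

The comparison with inhomogeneous cocycles has to be computable in both directions. Exactness gives
an equivariant chain map that projects all tuples onto cliques. It is built by recursion on the
length of the tuple, and each cycle that occurs is filled by unbounded search
(`exists_computable_projection`). Composing with it turns a cochain on cliques into a cocycle.
Conversely, a system of right coset representatives gives an equivariant retraction `g ↦ g r(g)⁻¹`
onto `Γ`, which turns a cocycle on `Γ` into a cochain that can be evaluated on cliques. An explicit
cone homotopy between a chain map and the map induced by a map of vertices (`chainHomotopy_spec`)
shows that these constructions are mutually inverse on cohomology
(`exists_cohomology_presentation`).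

Everything else that is needed is found by a search for an object that can be verified by a finite
computation: coset representatives (`IsCosetSystem.of_tests`) and integer matrices whose identities
certify a presentation of the homology of a complex (`exists_homology_presentation`,
`IsHomologyPresentation.of_certificate`). Only the finiteness of the index makes these searches
halt; the level of `Γ` never has to be known.

For the Hecke operators, the transfer may be computed with any equivariant map from the group to the
subgroup (`exists_transfer_cocycle`). So `T_n` of a cocycle is represented by an explicit finite sum
of its values (`exists_hecke_cocycle`), and there is a program for this sum. Membership in `Γ ∩ g Γ
g⁻¹` amounts to a divisibility and two tests for `Γ`. Feeding the program for the image of a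
generator into the algorithm for coordinates gives a column of the matrix of `T_n`. -/

theorem Primrec.int_natCast : Primrec (fun n : ℕ => (n : ℤ)) :=
  Primrec.encode_iff.1 ((Primrec.nat_mul.comp (Primrec.const 2) Primrec.id).of_eq fun _ => rfl)

theorem Primrec.int_negSucc : Primrec Int.negSucc :=
  Primrec.encode_iff.1 ((Primrec.succ.comp
    (Primrec.nat_mul.comp (Primrec.const 2) Primrec.id)).of_eq fun _ => rfl)

/-- The code of a natural number `n` is `2 * n` and that of `Int.negSucc n` is `2 * n + 1`, so the
sign of an integer is the parity of its code. -/
theorem Primrec.int_toNat : Primrec Int.toNat :=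
  (Primrec.cond (Primrec.nat_bodd.comp Primrec.encode) (Primrec.const 0)
    (Primrec.nat_div2.comp Primrec.encode)).of_eq fun z => by
    cases z with
    | ofNat n =>
      have : Encodable.encode (n : ℤ) = 2 * n := rfl
      simp [this]
    | negSucc n =>
      have : Encodable.encode (Int.negSucc n) = 2 * n + 1 := rfl
      simp [this]

theorem Primrec.int_natSub : Primrec₂ (fun m n : ℕ => (m : ℤ) - n) :=
  (Primrec.ite (Primrec.nat_le.comp Primrec.snd Primrec.fst)
    (Primrec.int_natCast.comp (Primrec.nat_sub.comp Primrec.fst Primrec.snd))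
    (Primrec.int_negSucc.comp (Primrec.pred.comp
      (Primrec.nat_sub.comp Primrec.snd Primrec.fst)))).of_eq fun p => by
    obtain ⟨m, n⟩ := p
    dsimp only
    split_ifs with h
    · omega
    · rw [Int.negSucc_eq]
      simp only [Nat.pred_eq_sub_one]
      omega

theorem Primrec.int_neg : Primrec (fun z : ℤ => -z) := by
  have hn : Primrec (fun z : ℤ => (-z).toNat) :=
    (Primrec.cond (Primrec.nat_bodd.comp Primrec.encode)
      (Primrec.succ.comp (Primrec.nat_div2.comp Primrec.encode)) (Primrec.const 0)).of_eq
      fun z => by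
        cases z with
        | ofNat n =>
          have : Encodable.encode (n : ℤ) = 2 * n := rfl
          simp [this]
        | negSucc n =>
          have : Encodable.encode (Int.negSucc n) = 2 * n + 1 := rfl
          simp [this, Nat.div2_val]
  exact (Primrec.int_natSub.comp hn Primrec.int_toNat).of_eq fun z => by omega

/-- An integer is the difference of the truncations of itself and of its negative. This reduces
addition, and multiplication below, to natural numbers. -/
theorem Primrec.int_add : Primrec₂ (fun x y : ℤ => x + y) :=
  (Primrec.int_natSub.comp
    (Primrec.nat_add.comp (Primrec.int_toNat.comp Primrec.fst) (Primrec.int_toNat.comp Primrec.snd))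
    (Primrec.nat_add.comp (Primrec.int_toNat.comp (Primrec.int_neg.comp Primrec.fst))
      (Primrec.int_toNat.comp (Primrec.int_neg.comp Primrec.snd)))).of_eq fun p => by
    obtain ⟨x, y⟩ := p
    dsimp only
    omega

theorem Primrec.int_sub : Primrec₂ (fun x y : ℤ => x - y) :=
  (Primrec.int_add.comp Primrec.fst (Primrec.int_neg.comp Primrec.snd)).of_eq fun p =>
    (sub_eq_add_neg p.1 p.2).symm

theorem Primrec.int_mul : Primrec₂ (fun x y : ℤ => x * y) := by
  have p1 : Primrec (fun p : ℤ × ℤ => p.1.toNat) := Primrec.int_toNat.comp Primrec.fst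
  have p2 : Primrec (fun p : ℤ × ℤ => p.2.toNat) := Primrec.int_toNat.comp Primrec.snd
  have n1 : Primrec (fun p : ℤ × ℤ => (-p.1).toNat) :=
    Primrec.int_toNat.comp (Primrec.int_neg.comp Primrec.fst)
  have n2 : Primrec (fun p : ℤ × ℤ => (-p.2).toNat) :=
    Primrec.int_toNat.comp (Primrec.int_neg.comp Primrec.snd)
  refine (Primrec.int_natSub.comp
    (Primrec.nat_add.comp (Primrec.nat_mul.comp p1 p2) (Primrec.nat_mul.comp n1 n2))
    (Primrec.nat_add.comp (Primrec.nat_mul.comp p1 n2) (Primrec.nat_mul.comp n1 p2))).of_eq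
    fun p => ?_
  obtain ⟨x, y⟩ := p
  dsimp only
  have hx : x = (x.toNat : ℤ) - ((-x).toNat : ℤ) := by omega
  have hy : y = (y.toNat : ℤ) - ((-y).toNat : ℤ) := by omega
  conv_rhs => rw [hx, hy]
  push_cast
  ring

/-- The quotient of an integer by a natural number, rounded towards zero. -/
def intDivNat (x : ℤ) (n : ℕ) : ℤ := (x.toNat / n : ℕ) - ((-x).toNat / n : ℕ)

/-- The direction of rounding is immaterial: quotients matter only when they are exact, and `n *
intDivNat x n = x` serves as the test for divisibility. -/
theorem intDivNat_mul (x : ℤ) {n : ℕ} (hn : 0 < n) : intDivNat (n * x) n = x := by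
  unfold intDivNat
  rcases le_total 0 x with h | h
  · lift x to ℕ using h
    have h1 : ((n : ℤ) * x).toNat = n * x := by rw [← Nat.cast_mul, Int.toNat_natCast]
    have h2 : (-((n : ℤ) * x)).toNat = 0 := by rw [← Nat.cast_mul]; omega
    rw [h1, h2, Nat.mul_div_cancel_left _ hn]
    simp
  · obtain ⟨y, rfl⟩ : ∃ y : ℕ, x = -y := ⟨(-x).toNat, by omega⟩
    have h1 : (-((n : ℤ) * -y)).toNat = n * y := by
      rw [mul_neg, neg_neg, ← Nat.cast_mul, Int.toNat_natCast]
    have h2 : ((n : ℤ) * -y).toNat = 0 := by rw [mul_neg, ← Nat.cast_mul]; omega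
    rw [h1, h2, Nat.mul_div_cancel_left _ hn]
    simp

theorem Primrec.intDivNat : Primrec₂ intDivNat :=
  Primrec.int_natSub.comp
    (Primrec.nat_div.comp (Primrec.int_toNat.comp Primrec.fst) Primrec.snd)
    (Primrec.nat_div.comp (Primrec.int_toNat.comp (Primrec.int_neg.comp Primrec.fst)) Primrec.snd)

theorem Primrec.list_sum_int : Primrec (fun l : List ℤ => l.sum) :=
  Primrec.list_foldr (h := fun (_ : List ℤ) (p : ℤ × ℤ) => p.1 + p.2) Primrec.id (Primrec.const 0)
    (Primrec.int_add.comp (Primrec.fst.comp Primrec.snd) (Primrec.snd.comp Primrec.snd))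

variable {α β σ : Type*} [Primcodable α] [Primcodable β] [Primcodable σ]

theorem Primrec.sum_range {n : α → ℕ} {f : α → ℕ → ℤ} (hn : Primrec n) (hf : Primrec₂ f) :
    Primrec fun a => ∑ i ∈ Finset.range (n a), f a i :=
  (Primrec.list_sum_int.comp (Primrec.list_map (Primrec.list_range.comp hn) hf)).of_eq fun a => by
    rw [Finset.sum_eq_multiset_sum, Finset.range_val, Multiset.range, Multiset.map_coe,
      Multiset.sum_coe]

theorem PrimrecPred.forall_mem {l : α → List β} {p : α → β → Prop} (hl : Primrec l)
    (hp : PrimrecRel p) : PrimrecPred fun a => ∀ b ∈ l a, p a b :=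
  PrimrecRel.comp (PrimrecRel.forall_mem_list (R := fun b a => p a b) hp.swap) hl Primrec.id

theorem PrimrecPred.forall_range {n : α → ℕ} {p : α → ℕ → Prop} (hn : Primrec n)
    (hp : PrimrecRel p) : PrimrecPred fun a => ∀ i < n a, p a i :=
  (PrimrecPred.forall_mem (Primrec.list_range.comp hn) hp).of_eq fun a => by simp

end IntegerArithmetic

/-! ### Loops and unbounded searches with partial recursive functions. -/

section PartialLoops

variable {α β σ : Type*}

/-- The partial function `f`, applied to the entries of a list. -/
def partMap (f : β → Part σ) (l : List β) : Part (List σ) :=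
  Nat.rec (Part.some []) (fun i ih => ih.bind fun acc =>
    ((l[i]? : Part β).bind f).map fun x => acc ++ [x]) l.length

/-- Convergence is required at the entries of the list only. The recursion for the projection onto
cliques depends on this, since there the values are known for shorter tuples only. -/
theorem partMap_eq {f : β → Part σ} {g : β → σ} {l : List β} (h : ∀ b ∈ l, f b = Part.some (g b)) :
    partMap f l = Part.some (l.map g) := by
  have key : ∀ n ≤ l.length, (Nat.rec (Part.some []) (fun i ih => ih.bind fun acc =>
      ((l[i]? : Part β).bind f).map fun x => acc ++ [x]) n : Part (List σ)) =
        Part.some ((l.take n).map g) := by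
    intro n
    induction n with
    | zero => intro _; simp
    | succ n ih =>
      intro hn
      have hn' : n < l.length := hn
      have h1 : ((l[n]? : Part β).bind f) = Part.some (g l[n]) := by
        rw [List.getElem?_eq_getElem hn']
        exact (Part.bind_some _ _).trans (h _ (List.getElem_mem hn'))
      have ih' := ih hn'.le
      dsimp only at ih' ⊢
      rw [ih', Part.bind_some, h1, Part.map_some, List.take_succ_eq_append_getElem hn',
        List.map_append]
      rfl
  have := key l.length le_rfl
  rw [List.take_length] at this
  exact this

variable [Primcodable α] [Primcodable β] [Primcodable σ]

theorem Partrec.partMap {f : α → β → Part σ} {l : α → List β} (hf : Partrec₂ f)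
    (hl : Computable l) : Partrec fun a => partMap (f a) (l a) := by
  unfold _root_.partMap
  refine Partrec.nat_rec (f := fun a => (l a).length) (g := fun _ => Part.some [])
    (h := fun a p => (((l a)[p.1]? : Part β).bind (f a)).map fun x => p.2 ++ [x])
    (Computable.list_length.comp hl) (Computable.const ([] : List σ)) ?_
  refine Partrec.map (f := fun q : α × ℕ × List σ => (((l q.1)[q.2.1]? : Part β).bind (f q.1)))
    (g := fun q x => q.2.2 ++ [x]) ?_ ?_
  · refine Partrec.bind ?_ ?_
    · exact Computable.ofOption (Computable.list_getElem?.comp (hl.comp Computable.fst)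
        (Computable.fst.comp Computable.snd))
    · exact hf.comp (Computable.fst.comp Computable.fst) Computable.snd
  · exact Computable.list_concat.comp (Computable.snd.comp (Computable.snd.comp Computable.fst))
      Computable.snd

/-- Unbounded search for a value that passes a partial recursive test. -/
theorem exists_partrec_search [Inhabited β] {p : α → β → Part Bool} (hp : Partrec₂ p) :
    ∃ F : α → Part β, Partrec F ∧ ∀ a, ∀ q : β → Bool, (∀ b, p a b = Part.some (q b)) →
      (∃ b, q b = true) → ∃ b, F a = Part.some b ∧ q b = true := by
  -- Numbers that are not codes stand for the default value, so the search can run through all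
  -- natural numbers.
  have hd : Computable fun n : ℕ => (Encodable.decode (α := β) n).getD default :=
    Computable.option_getD Computable.decode (Computable.const default)
  refine ⟨fun a => (Nat.rfind fun n => p a ((Encodable.decode (α := β) n).getD default)).map
    fun n => (Encodable.decode (α := β) n).getD default, ?_, ?_⟩
  · exact Partrec.map (Partrec.rfind (p := fun a n => p a ((Encodable.decode (α := β) n).getD
      default)) (hp.comp Computable.fst (hd.comp Computable.snd))) (hd.comp Computable.snd)
  · intro a q hq hb
    obtain ⟨b, hb⟩ := hb
    have hdom : (Nat.rfind fun n => p a ((Encodable.decode (α := β) n).getD default)).Dom := by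
      refine Nat.rfind_dom.2 ⟨Encodable.encode b, ?_, fun _ => ?_⟩
      · simp [hq, hb]
      · simp [hq]
    obtain ⟨n, hn⟩ := Part.dom_iff_mem.1 hdom
    refine ⟨(Encodable.decode (α := β) n).getD default, ?_, ?_⟩
    · dsimp only
      rw [Part.eq_some_iff.2 hn, Part.map_some]
    · have this : true ∈ p a _ := Nat.rfind_spec hn
      rw [hq] at this
      exact (Part.mem_some_iff.1 this).symm

theorem exists_primrec_search [Inhabited β] {p : α → β → Prop} (hp : PrimrecRel p) :
    ∃ F : α → Part β, Partrec F ∧ ∀ a, (∃ b, p a b) → ∃ b, F a = Part.some b ∧ p a b := by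
  classical
  obtain ⟨F, hF, h⟩ := exists_partrec_search (p := fun a b => Part.some (decide (p a b)))
    (Computable₂.partrec₂ (Primrec₂.to_comp hp.decide))
  refine ⟨F, hF, fun a hb => ?_⟩
  obtain ⟨b, hb, h2⟩ := h a (fun b => decide (p a b)) (fun _ => rfl) (by simpa using hb)
  exact ⟨b, hb, by simpa using h2⟩

end PartialLoops

/-! ### Matrices in `SL₂(ℤ)` as data for algorithms. -/

section MatrixPrimrec

/-- The matrices in `SL₂(ℤ)` as quadruples of integers. -/
def slEquivQuadruple :
    SL(2, ℤ) ≃ {q : ℤ × ℤ × ℤ × ℤ // q.1 * q.2.2.2 - q.2.1 * q.2.2.1 = 1} where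
  toFun A := ⟨matrixEntries A, by
    have := A.det_coe
    rw [Matrix.det_fin_two] at this
    exact this⟩
  invFun q := ⟨!![q.1.1, q.1.2.1; q.1.2.2.1, q.1.2.2.2], by
    rw [Matrix.det_fin_two]
    exact q.2⟩
  left_inv A := by
    ext i j
    fin_cases i <;> fin_cases j <;> rfl
  right_inv q := rfl

theorem primrecPred_quadruple_det :
    PrimrecPred fun q : ℤ × ℤ × ℤ × ℤ => q.1 * q.2.2.2 - q.2.1 * q.2.2.1 = 1 := by
  have a : Primrec fun q : ℤ × ℤ × ℤ × ℤ => q.1 := Primrec.fst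
  have b : Primrec fun q : ℤ × ℤ × ℤ × ℤ => q.2.1 := Primrec.fst.comp Primrec.snd
  have c : Primrec fun q : ℤ × ℤ × ℤ × ℤ => q.2.2.1 :=
    Primrec.fst.comp (Primrec.snd.comp Primrec.snd)
  have d : Primrec fun q : ℤ × ℤ × ℤ × ℤ => q.2.2.2 :=
    Primrec.snd.comp (Primrec.snd.comp Primrec.snd)
  exact Primrec.eq.comp (Primrec.int_sub.comp (Primrec.int_mul.comp a d) (Primrec.int_mul.comp b c))
    (Primrec.const 1)

/-- With this choice a matrix and its quadruple of entries have the same code, so programs that are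
specified in terms of entries can be run on matrices directly. -/
instance : Primcodable SL(2, ℤ) :=
  letI := Primcodable.subtype primrecPred_quadruple_det
  Primcodable.ofEquiv _ slEquivQuadruple

theorem encode_matrixEntries (A : SL(2, ℤ)) :
    Encodable.encode (matrixEntries A) = Encodable.encode A := rfl

theorem primrec_matrixEntries : Primrec matrixEntries :=
  Primrec.encode_iff.1 (Primrec.encode.of_eq fun A => (encode_matrixEntries A).symm)

theorem matrixEntries_injective : Function.Injective matrixEntries := fun _ _ h =>
  slEquivQuadruple.injective (Subtype.ext h)

/-- The matrix with the given entries; the identity matrix if these do not have determinant `1`. -/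
def ofEntries (q : ℤ × ℤ × ℤ × ℤ) : SL(2, ℤ) :=
  (Encodable.decode (α := SL(2, ℤ)) (Encodable.encode q)).getD 1

theorem ofEntries_matrixEntries (A : SL(2, ℤ)) : ofEntries (matrixEntries A) = A := by
  rw [ofEntries, encode_matrixEntries, Encodable.encodek]
  rfl

theorem primrec_ofEntries : Primrec ofEntries :=
  Primrec.option_getD.comp (Primrec.decode.comp Primrec.encode) (Primrec.const 1)

theorem matrixEntries_ofEntries {q : ℤ × ℤ × ℤ × ℤ} (h : q.1 * q.2.2.2 - q.2.1 * q.2.2.1 = 1) :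
    matrixEntries (ofEntries q) = q := by
  have : q = matrixEntries (slEquivQuadruple.symm ⟨q, h⟩) :=
    (congrArg Subtype.val (slEquivQuadruple.apply_symm_apply ⟨q, h⟩)).symm
  rw [this, ofEntries_matrixEntries]

theorem primrec_of_matrixEntries {α : Type*} [Primcodable α] {f : α → SL(2, ℤ)}
    (h : Primrec fun a => matrixEntries (f a)) : Primrec f :=
  (primrec_ofEntries.comp h).of_eq fun a => ofEntries_matrixEntries (f a)

theorem Primrec.sl_mul : Primrec₂ fun A B : SL(2, ℤ) => A * B := by
  have m1 : Primrec fun p : SL(2, ℤ) × SL(2, ℤ) => matrixEntries p.1 :=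
    primrec_matrixEntries.comp Primrec.fst
  have m2 : Primrec fun p : SL(2, ℤ) × SL(2, ℤ) => matrixEntries p.2 :=
    primrec_matrixEntries.comp Primrec.snd
  have a1 := Primrec.fst.comp m1
  have b1 := Primrec.fst.comp (Primrec.snd.comp m1)
  have c1 := Primrec.fst.comp (Primrec.snd.comp (Primrec.snd.comp m1))
  have d1 := Primrec.snd.comp (Primrec.snd.comp (Primrec.snd.comp m1))
  have a2 := Primrec.fst.comp m2
  have b2 := Primrec.fst.comp (Primrec.snd.comp m2)
  have c2 := Primrec.fst.comp (Primrec.snd.comp (Primrec.snd.comp m2))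
  have d2 := Primrec.snd.comp (Primrec.snd.comp (Primrec.snd.comp m2))
  have dot : ∀ {x y z w : SL(2, ℤ) × SL(2, ℤ) → ℤ}, Primrec x → Primrec y → Primrec z →
      Primrec w → Primrec fun p => x p * y p + z p * w p := fun hx hy hz hw =>
    Primrec.int_add.comp (Primrec.int_mul.comp hx hy) (Primrec.int_mul.comp hz hw)
  refine primrec_of_matrixEntries (((dot a1 a2 b1 c2).pair ((dot a1 b2 b1 d2).pair
    ((dot c1 a2 d1 c2).pair (dot c1 b2 d1 d2)))).of_eq fun p => ?_)
  simp [matrixEntries, Matrix.mul_apply, Fin.sum_univ_two]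

theorem Primrec.sl_inv : Primrec fun A : SL(2, ℤ) => A⁻¹ := by
  have m := primrec_matrixEntries
  have a := Primrec.fst.comp m
  have b := Primrec.fst.comp (Primrec.snd.comp m)
  have c := Primrec.fst.comp (Primrec.snd.comp (Primrec.snd.comp m))
  have d := Primrec.snd.comp (Primrec.snd.comp (Primrec.snd.comp m))
  refine primrec_of_matrixEntries ((d.pair ((Primrec.int_neg.comp b).pair
    ((Primrec.int_neg.comp c).pair a))).of_eq fun A => ?_)
  simp [matrixEntries, Matrix.SpecialLinearGroup.coe_inv, Matrix.adjugate_fin_two]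

end MatrixPrimrec

/-! ### The augmented complex of tuples and its cone homotopies. -/

section ListComplex

variable {X X' X'' : Type*}

/-- Prepending a vertex to the tuples in a chain. -/
noncomputable def chainCons (x : X) : (List X →₀ ℤ) →ₗ[ℤ] (List X →₀ ℤ) :=
  Finsupp.lmapDomain ℤ ℤ (List.cons x)

theorem chainCons_single (x : X) (t : List X) (a : ℤ) :
    chainCons x (Finsupp.single t a) = Finsupp.single (x :: t) a := by
  simp [chainCons]

/-- The alternating sum of the faces of a tuple. -/
noncomputable def faces : List X → (List X →₀ ℤ)
  | [] => 0
  | x :: t => Finsupp.single t 1 - chainCons x (faces t)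

/-- The boundary of the augmented chain complex of tuples in `X` (of all lengths). -/
noncomputable def chainBoundary : (List X →₀ ℤ) →ₗ[ℤ] (List X →₀ ℤ) :=
  Finsupp.linearCombination ℤ faces

theorem chainBoundary_single (t : List X) (a : ℤ) :
    chainBoundary (Finsupp.single t a) = a • faces t := by
  simp [chainBoundary]

theorem chain_hom_ext {M : Type*} [AddCommGroup M] {f g : (List X →₀ ℤ) →ₗ[ℤ] M}
    (h : ∀ t, f (Finsupp.single t 1) = g (Finsupp.single t 1)) : f = g :=
  Finsupp.lhom_ext' fun t => LinearMap.ext_ring (h t)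

/-- This is the cone formula: prepending a fixed vertex is a contracting homotopy. The exactness and
homotopy arguments for tuples all rest on it. -/
theorem chainBoundary_chainCons (x : X) (c : List X →₀ ℤ) :
    chainBoundary (chainCons x c) = c - chainCons x (chainBoundary c) := by
  have : chainBoundary ∘ₗ chainCons x = LinearMap.id - chainCons x ∘ₗ chainBoundary :=
    chain_hom_ext fun t => by
      simp [chainCons_single, chainBoundary_single, faces]
  exact LinearMap.congr_fun this c

theorem chainBoundary_faces (t : List X) : chainBoundary (faces t) = 0 := by
  induction t with
  | nil => simp [faces]
  | cons x t ih =>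
    rw [faces, map_sub, chainBoundary_chainCons, ih, chainBoundary_single]
    simp

theorem chainBoundary_chainBoundary (c : List X →₀ ℤ) : chainBoundary (chainBoundary c) = 0 := by
  have : chainBoundary ∘ₗ chainBoundary = (0 : (List X →₀ ℤ) →ₗ[ℤ] (List X →₀ ℤ)) :=
    chain_hom_ext fun t => by simp [chainBoundary_single, chainBoundary_faces]
  exact LinearMap.congr_fun this c

/-- The map of chains induced by a map of vertices. -/
noncomputable def chainMap (f : X → X') : (List X →₀ ℤ) →ₗ[ℤ] (List X' →₀ ℤ) :=
  Finsupp.lmapDomain ℤ ℤ (List.map f)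

theorem chainMap_single (f : X → X') (t : List X) (a : ℤ) :
    chainMap f (Finsupp.single t a) = Finsupp.single (t.map f) a := by
  simp [chainMap]

theorem chainMap_chainCons (f : X → X') (x : X) (c : List X →₀ ℤ) :
    chainMap f (chainCons x c) = chainCons (f x) (chainMap f c) := by
  have : chainMap f ∘ₗ chainCons x = chainCons (f x) ∘ₗ chainMap f :=
    chain_hom_ext fun t => by simp [chainCons_single, chainMap_single]
  exact LinearMap.congr_fun this c

theorem chainMap_faces (f : X → X') (t : List X) : chainMap f (faces t) = faces (t.map f) := by
  induction t with
  | nil => simp [faces]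
  | cons x t ih => simp [faces, chainMap_chainCons, ih, chainMap_single]

theorem chainMap_chainBoundary (f : X → X') (c : List X →₀ ℤ) :
    chainMap f (chainBoundary c) = chainBoundary (chainMap f c) := by
  have : chainMap f ∘ₗ chainBoundary = chainBoundary ∘ₗ chainMap f :=
    chain_hom_ext fun t => by simp [chainBoundary_single, chainMap_single, chainMap_faces]
  exact LinearMap.congr_fun this c

theorem chainMap_chainMap (f : X → X') (g : X' → X'') (c : List X →₀ ℤ) :
    chainMap g (chainMap f c) = chainMap (g ∘ f) c := by
  have : chainMap g ∘ₗ chainMap f = chainMap (g ∘ f) :=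
    chain_hom_ext fun t => by simp [chainMap_single]
  exact LinearMap.congr_fun this c

theorem chainMap_id (c : List X →₀ ℤ) : chainMap id c = c := by
  have : chainMap (id : X → X) = LinearMap.id :=
    chain_hom_ext fun t => by simp [chainMap_single]
  exact LinearMap.congr_fun this c

/-- The value of a cochain on a chain. -/
noncomputable def chainEval (f : List X → ℤ) : (List X →₀ ℤ) →ₗ[ℤ] ℤ :=
  Finsupp.linearCombination ℤ f

theorem chainEval_single (f : List X → ℤ) (t : List X) (a : ℤ) :
    chainEval f (Finsupp.single t a) = a * f t := by
  simp [chainEval]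

theorem chainEval_chainMap (f : List X' → ℤ) (g : X → X') (c : List X →₀ ℤ) :
    chainEval f (chainMap g c) = chainEval (fun t => f (t.map g)) c := by
  have : chainEval f ∘ₗ chainMap g = chainEval (fun t => f (t.map g)) :=
    chain_hom_ext fun t => by simp [chainMap_single, chainEval_single]
  exact LinearMap.congr_fun this c

theorem chainEval_congr {f g : List X → ℤ} {s : Set (List X)} (h : ∀ t ∈ s, f t = g t)
    {c : List X →₀ ℤ} (hc : c ∈ Finsupp.supported ℤ ℤ s) : chainEval f c = chainEval g c := by
  rw [Finsupp.mem_supported] at hc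
  simp only [chainEval, Finsupp.linearCombination_apply, Finsupp.sum]
  exact Finset.sum_congr rfl fun t ht => by rw [h t (hc ht)]

/-- The homotopy between a chain map `ψ` and the map induced by a map `ρ` of vertices, on tuples. -/
noncomputable def tupleHomotopy (ψ : (List X →₀ ℤ) →ₗ[ℤ] (List X' →₀ ℤ)) (ρ : X → X') :
    List X → (List X' →₀ ℤ)
  | [] => 0
  | x :: t => chainCons (ρ x) (ψ (Finsupp.single (x :: t) 1) - tupleHomotopy ψ ρ t)

/-- The homotopy between a chain map `ψ` and the map induced by a map `ρ` of vertices. -/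
noncomputable def chainHomotopy (ψ : (List X →₀ ℤ) →ₗ[ℤ] (List X' →₀ ℤ)) (ρ : X → X') :
    (List X →₀ ℤ) →ₗ[ℤ] (List X' →₀ ℤ) :=
  Finsupp.linearCombination ℤ (tupleHomotopy ψ ρ)

theorem chainHomotopy_single (ψ : (List X →₀ ℤ) →ₗ[ℤ] (List X' →₀ ℤ)) (ρ : X → X') (t : List X) :
    chainHomotopy ψ ρ (Finsupp.single t 1) = tupleHomotopy ψ ρ t := by
  simp [chainHomotopy]

theorem chainHomotopy_chainCons (ψ : (List X →₀ ℤ) →ₗ[ℤ] (List X' →₀ ℤ)) (ρ : X → X') (x : X)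
    (c : List X →₀ ℤ) : chainHomotopy ψ ρ (chainCons x c) =
      chainCons (ρ x) (ψ (chainCons x c) - chainHomotopy ψ ρ c) := by
  have : chainHomotopy ψ ρ ∘ₗ chainCons x =
      chainCons (ρ x) ∘ₗ (ψ ∘ₗ chainCons x - chainHomotopy ψ ρ) :=
    chain_hom_ext fun t => by simp [chainCons_single, chainHomotopy_single, tupleHomotopy]
  exact LinearMap.congr_fun this c

/-- Induction on the tuple: the difference that remains to be filled is a cycle, and it is coned off
from the vertex `ρ x`. Cones exist from every vertex of `X'`, so `ρ` can be arbitrary. The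
hypothesis on the empty tuple says that `ψ` preserves the augmentation. -/
theorem chainHomotopy_spec {ψ : (List X →₀ ℤ) →ₗ[ℤ] (List X' →₀ ℤ)} (ρ : X → X')
    (hψ : ∀ c, chainBoundary (ψ c) = ψ (chainBoundary c))
    (h0 : ψ (Finsupp.single [] 1) = Finsupp.single [] 1) (c : List X →₀ ℤ) :
    ψ c - chainMap ρ c =
      chainBoundary (chainHomotopy ψ ρ c) + chainHomotopy ψ ρ (chainBoundary c) := by
  have : ψ - chainMap ρ =
      chainBoundary ∘ₗ chainHomotopy ψ ρ + chainHomotopy ψ ρ ∘ₗ chainBoundary := by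
    refine chain_hom_ext fun t => ?_
    induction t with
    | nil => simp [h0, chainMap_single, chainHomotopy_single, tupleHomotopy, chainBoundary_single,
        faces]
    | cons x t ih =>
      simp only [LinearMap.sub_apply, LinearMap.add_apply, LinearMap.comp_apply] at ih ⊢
      have h1 := chainBoundary_chainCons x (Finsupp.single t (1 : ℤ))
      rw [chainHomotopy_single] at ih
      rw [← chainCons_single, chainHomotopy_chainCons, chainBoundary_chainCons, map_sub, hψ, h1,
        map_sub (chainHomotopy ψ ρ), chainHomotopy_chainCons, chainHomotopy_single,
        chainMap_chainCons, map_sub ψ, eq_sub_of_add_eq' ih.symm]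
      simp only [map_sub]
      abel
  exact LinearMap.congr_fun this c

/-- The homotopy is built from `ψ` and from cones at values of `ρ` and involves no further choice,
so it inherits every symmetry that these share. This makes the cochains derived from it invariant.
-/
theorem chainHomotopy_equivariant {ψ : (List X →₀ ℤ) →ₗ[ℤ] (List X' →₀ ℤ)} {ρ : X → X'}
    {α : X → X} {α' : X' → X'} (hψ : ∀ c, ψ (chainMap α c) = chainMap α' (ψ c))
    (hρ : ∀ x, ρ (α x) = α' (ρ x)) (c : List X →₀ ℤ) :
    chainHomotopy ψ ρ (chainMap α c) = chainMap α' (chainHomotopy ψ ρ c) := by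
  have : chainHomotopy ψ ρ ∘ₗ chainMap α = chainMap α' ∘ₗ chainHomotopy ψ ρ := by
    refine chain_hom_ext fun t => ?_
    induction t with
    | nil => simp [chainMap_single, chainHomotopy_single, tupleHomotopy]
    | cons x t ih =>
      simp only [LinearMap.comp_apply] at ih ⊢
      rw [← chainCons_single, chainMap_chainCons, chainHomotopy_chainCons, chainHomotopy_chainCons,
        chainMap_chainCons, ih, ← chainMap_chainCons, hψ, hρ]
      simp only [map_sub]
  exact LinearMap.congr_fun this c

theorem chain_supported_mono {s s' : Set (List X)} {c : List X →₀ ℤ}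
    (hc : c ∈ Finsupp.supported ℤ ℤ s) (h : ∀ t ∈ s, t ∈ s') : c ∈ Finsupp.supported ℤ ℤ s' :=
  Finsupp.supported_mono h hc

theorem chainCons_mem_supported {x : X} {s s' : Set (List X)} {c : List X →₀ ℤ}
    (hc : c ∈ Finsupp.supported ℤ ℤ s) (h : ∀ t ∈ s, x :: t ∈ s') :
    chainCons x c ∈ Finsupp.supported ℤ ℤ s' := by
  classical
  rw [Finsupp.mem_supported] at hc ⊢
  intro t ht
  obtain ⟨u, hu, rfl⟩ := Finset.mem_image.1 (Finsupp.mapDomain_support ht)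
  exact h u (hc hu)

theorem chainMap_mem_supported {f : X → X'} {s : Set (List X)} {s' : Set (List X')}
    {c : List X →₀ ℤ} (hc : c ∈ Finsupp.supported ℤ ℤ s) (h : ∀ t ∈ s, t.map f ∈ s') :
    chainMap f c ∈ Finsupp.supported ℤ ℤ s' := by
  classical
  rw [Finsupp.mem_supported] at hc ⊢
  intro t ht
  obtain ⟨u, hu, rfl⟩ := Finset.mem_image.1 (Finsupp.mapDomain_support ht)
  exact h u (hc hu)

theorem faces_mem_supported (t : List X) :
    faces t ∈ Finsupp.supported ℤ ℤ {u | u.Sublist t ∧ u.length + 1 = t.length} := by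
  induction t with
  | nil => simp [faces]
  | cons x t ih =>
    refine Submodule.sub_mem _ (Finsupp.single_mem_supported ℤ _ ⟨List.sublist_cons_self x t, rfl⟩)
      (chainCons_mem_supported ih fun u hu => ?_)
    exact ⟨hu.1.cons_cons x, by simpa using hu.2⟩

theorem chainBoundary_mem_supported {s : Set (List X)} {c : List X →₀ ℤ}
    (hc : c ∈ Finsupp.supported ℤ ℤ s) (h : ∀ t ∈ s, ∀ u : List X, u.Sublist t → u ∈ s) :
    chainBoundary c ∈ Finsupp.supported ℤ ℤ s := by
  rw [chainBoundary, Finsupp.linearCombination_apply, Finsupp.sum]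
  refine Submodule.sum_mem _ fun t ht => Submodule.smul_mem _ _ ?_
  have hts : t ∈ s := (Finsupp.mem_supported ℤ c).1 hc ht
  exact chain_supported_mono (faces_mem_supported t) fun u hu => h t hts u hu.1

end ListComplex

/-! ### Exactness of the clique complex of a tree-like pair of relations. -/

section CliqueComplex

variable {X : Type*}

/-- The tuples all of whose entries are related by one of the two relations. -/
def cliques (r : Bool → X → X → Prop) : Set (List X) := {t | ∃ b, ∀ x ∈ t, ∀ y ∈ t, r b x y}

theorem mem_cliques_of_sublist {r : Bool → X → X → Prop} {t u : List X} (ht : t ∈ cliques r)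
    (h : u.Sublist t) : u ∈ cliques r := by
  obtain ⟨b, hb⟩ := ht
  exact ⟨b, fun x hx y hy => hb x (h.subset hx) y (h.subset hy)⟩

/-- Two equivalence relations form a tree with root `x₀`, as witnessed by the length function `ℓ`:
every other vertex `x` has a smaller vertex in one of its two classes, and any vertex of the other
class that is not larger than `x` lies in the first one as well. -/
structure IsTreeLike (r : Bool → X → X → Prop) (ℓ : X → ℕ) (x₀ : X) : Prop where
  equiv : ∀ b, Equivalence (r b)
  root : ℓ x₀ = 0
  parent : ∀ x, x ≠ x₀ → ∃ b, (∃ p, r b x p ∧ ℓ p < ℓ x) ∧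
    ∀ y, r (!b) x y → ℓ y ≤ ℓ x → r b x y

variable {r : Bool → X → X → Prop} {ℓ : X → ℕ} {x₀ : X}

/-- A tree is contracted by removing leaves. A vertex `x` of maximal length in `V` plays the role of
a leaf: all cliques in `V` through `x` lie in its class for the relation `k x`, which also contains
its parent. A cycle can thus be pushed off `x` by coning from the parent, and induction applies to
`V` without `x`, which is still closed under parents. -/
theorem cliques_exact_of_closed {p : X → X} {k : X → Bool} (hr : ∀ b, Equivalence (r b))
    (h0 : ℓ x₀ = 0)
    (hp : ∀ x, x ≠ x₀ → (r (k x) x (p x) ∧ ℓ (p x) < ℓ x) ∧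
      ∀ y, r (!(k x)) x y → ℓ y ≤ ℓ x → r (k x) x y) (n : ℕ) :
    ∀ V : Finset X, V.card = n → x₀ ∈ V → (∀ x ∈ V, x ≠ x₀ → p x ∈ V) →
      ∀ c ∈ Finsupp.supported ℤ ℤ (cliques r ∩ {t | ∀ x ∈ t, x ∈ V}), chainBoundary c = 0 →
        ∃ b ∈ Finsupp.supported ℤ ℤ (cliques r ∩ {t | ∀ x ∈ t, x ∈ V}), chainBoundary b = c := by
  classical
  induction n with
  | zero =>
    intro V hV h0
    rw [Finset.card_eq_zero.1 hV] at h0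
    simp at h0
  | succ n ih =>
    intro V hV hx₀ hclosed c hc hdc
    rcases (V.erase x₀).eq_empty_or_nonempty with hE | hE
    · have hV0 : ∀ x ∈ V, x = x₀ := fun x hx => by
        by_contra hne
        have : x ∈ V.erase x₀ := Finset.mem_erase.2 ⟨hne, hx⟩
        rw [hE] at this
        simp at this
      refine ⟨chainCons x₀ c, chainCons_mem_supported hc (fun t ht => ?_), ?_⟩
      · have hall : ∀ x ∈ x₀ :: t, x ∈ V := by
          intro x hx
          rcases List.mem_cons.1 hx with rfl | hx
          · exact hx₀
          · exact ht.2 x hx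
        refine ⟨⟨true, fun x hx y hy => ?_⟩, hall⟩
        rw [hV0 x (hall x hx), hV0 y (hall y hy)]
        exact (hr true).refl _
      · rw [chainBoundary_chainCons, hdc, map_zero, sub_zero]
    · obtain ⟨x, hx, hmax⟩ := Finset.exists_max_image (V.erase x₀) ℓ hE
      obtain ⟨hxne, hxV⟩ := Finset.mem_erase.1 hx
      have hmax' : ∀ y ∈ V, ℓ y ≤ ℓ x := fun y hy => by
        by_cases h : y = x₀
        · rw [h, h0]; exact Nat.zero_le _
        · exact hmax y (Finset.mem_erase.2 ⟨h, hy⟩)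
      obtain ⟨⟨hpx, hlt⟩, hother⟩ := hp x hxne
      have hpne : p x ≠ x := fun h => by rw [h] at hlt; exact lt_irrefl _ hlt
      have hpV := hclosed x hxV hxne
      let K : Set X := {y | y ∈ V ∧ r (k x) x y}
      let K' : Set X := {y | y ∈ V.erase x ∧ r (k x) x y}
      have hKclique : ∀ t : List X, (∀ y ∈ t, y ∈ K) → t ∈ cliques r := fun t ht =>
        ⟨k x, fun y hy z hz => (hr _).trans ((hr _).symm (ht y hy).2) (ht z hz).2⟩
      have hc1 : c.filter (fun t => x ∈ t) ∈ Finsupp.supported ℤ ℤ {t | ∀ y ∈ t, y ∈ K} := by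
        rw [Finsupp.mem_supported]
        intro t ht
        rw [Finset.mem_coe, Finsupp.support_filter, Finset.mem_filter] at ht
        obtain ⟨ht, hxt⟩ := ht
        obtain ⟨⟨b, hb⟩, htV⟩ := (Finsupp.mem_supported ℤ c).1 hc ht
        intro y hy
        refine ⟨htV y hy, ?_⟩
        by_cases hbk : b = k x
        · rw [← hbk]; exact hb x hxt y hy
        -- A clique through `x` for the other relation lies in the class for `k x` too; this is
        -- where the maximality of `x` enters.
        · have : b = !(k x) := by revert hbk; cases b <;> cases k x <;> simp
          exact hother y (this ▸ hb x hxt y hy) (hmax' y (htV y hy))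
      have hc2 : c.filter (fun t => ¬ x ∈ t) ∈
          Finsupp.supported ℤ ℤ (cliques r ∩ {t | ∀ y ∈ t, y ∈ V.erase x}) := by
        rw [Finsupp.mem_supported]
        intro t ht
        rw [Finset.mem_coe, Finsupp.support_filter, Finset.mem_filter] at ht
        obtain ⟨ht, hxt⟩ := ht
        obtain ⟨hcl, htV⟩ := (Finsupp.mem_supported ℤ c).1 hc ht
        refine ⟨hcl, fun y hy => Finset.mem_erase.2 ⟨?_, htV y hy⟩⟩
        rintro rfl
        exact hxt hy
      have hsplit : c.filter (fun t => x ∈ t) + c.filter (fun t => ¬ x ∈ t) = c :=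
        Finsupp.filter_add_filter_not c _
      set c1 := c.filter (fun t => x ∈ t)
      set c2 := c.filter (fun t => ¬ x ∈ t)
      have hd12 : chainBoundary c1 = - chainBoundary c2 := by
        rw [eq_neg_iff_add_eq_zero, ← map_add, hsplit, hdc]
      -- The boundary of `c1` stays in the class of `x`, and it avoids `x` because it is minus the
      -- boundary of `c2`. So it can be filled without using `x`, by the cone `u` from the parent.
      have hd1 : chainBoundary c1 ∈ Finsupp.supported ℤ ℤ {t | ∀ y ∈ t, y ∈ K'} := by
        have e1 : chainBoundary c1 ∈ Finsupp.supported ℤ ℤ {t | ∀ y ∈ t, y ∈ K} :=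
          chainBoundary_mem_supported hc1 fun t ht u hu y hy => ht y (hu.subset hy)
        have e2 : chainBoundary c1 ∈
            Finsupp.supported ℤ ℤ (cliques r ∩ {t | ∀ y ∈ t, y ∈ V.erase x}) := by
          rw [hd12]
          exact Submodule.neg_mem _ (chainBoundary_mem_supported hc2 fun t ht u hu =>
            ⟨mem_cliques_of_sublist ht.1 hu, fun y hy => ht.2 y (hu.subset hy)⟩)
        rw [Finsupp.mem_supported] at e1 e2 ⊢
        intro t ht y hy
        exact ⟨(e2 ht).2 y hy, (e1 ht y hy).2⟩
      have hpK' : p x ∈ K' := ⟨Finset.mem_erase.2 ⟨hpne, hpV⟩, hpx⟩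
      have hK'K : ∀ y ∈ K', y ∈ K := fun y hy => ⟨Finset.mem_of_mem_erase hy.1, hy.2⟩
      set u := chainCons (p x) (chainBoundary c1) with hu
      have hdu : chainBoundary u = chainBoundary c1 := by
        rw [hu, chainBoundary_chainCons, chainBoundary_chainBoundary, map_zero, sub_zero]
      have huK' : u ∈ Finsupp.supported ℤ ℤ {t | ∀ y ∈ t, y ∈ K'} :=
        chainCons_mem_supported hd1 fun t ht => List.forall_mem_cons.2 ⟨hpK', ht⟩
      obtain ⟨w, hw, hdw⟩ := ih (V.erase x) (by rw [Finset.card_erase_of_mem hxV, hV]; rfl)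
        (Finset.mem_erase.2 ⟨hxne.symm, hx₀⟩)
        (fun y hy hne => Finset.mem_erase.2 ⟨fun h => by
          have h1 := (hp y hne).1.2
          have h2 := hmax' y (Finset.mem_of_mem_erase hy)
          rw [h] at h1
          omega, hclosed y (Finset.mem_of_mem_erase hy) hne⟩)
        (c2 + u)
        (Submodule.add_mem _ hc2 (chain_supported_mono huK' fun t ht =>
          ⟨hKclique t fun y hy => hK'K y (ht y hy), fun y hy => (ht y hy).1⟩))
        (by rw [map_add, hdu, hd12]; simp)
      -- The chain `c1 - u` is a cycle inside a single class, where a cone fills it; `w` fills the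
      -- remaining cycle `c2 + u`.
      refine ⟨chainCons (p x) (c1 - u) + w, Submodule.add_mem _ ?_ ?_, ?_⟩
      · refine chainCons_mem_supported (s := {t | ∀ y ∈ t, y ∈ K})
          (Submodule.sub_mem _ hc1 (chain_supported_mono huK'
            fun t ht y hy => hK'K y (ht y hy))) (fun t ht => ?_)
        have := List.forall_mem_cons.2 ⟨hK'K _ hpK', ht⟩
        exact ⟨hKclique _ this, fun y hy => (this y hy).1⟩
      · exact chain_supported_mono hw fun t ht =>
          ⟨ht.1, fun y hy => Finset.mem_of_mem_erase (ht.2 y hy)⟩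
      · rw [map_add, chainBoundary_chainCons, hdw, map_sub, hdu, sub_self, map_zero, ← hsplit]
        abel

/-- Lengths drop along parents, so every vertex has finitely many ancestors, ending at the root. The
vertices of a given chain together with their ancestors form a finite set closed under parents,
which reduces the claim to the finite case. -/
theorem IsTreeLike.exact (h : IsTreeLike r ℓ x₀) {c : List X →₀ ℤ}
    (hc : c ∈ Finsupp.supported ℤ ℤ (cliques r)) (hdc : chainBoundary c = 0) :
    ∃ b ∈ Finsupp.supported ℤ ℤ (cliques r), chainBoundary b = c := by
  classical
  have hpar : ∀ x, ∃ q : Bool × X, x ≠ x₀ → (r q.1 x q.2 ∧ ℓ q.2 < ℓ x) ∧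
      ∀ y, r (!q.1) x y → ℓ y ≤ ℓ x → r q.1 x y := fun x => by
    by_cases hx : x = x₀
    · exact ⟨(true, x), fun h => absurd hx h⟩
    · obtain ⟨b, ⟨p, hp⟩, hb⟩ := h.parent x hx
      exact ⟨(b, p), fun _ => ⟨hp, hb⟩⟩
  choose q hq using hpar
  have hone : ∀ n x, ℓ x ≤ n → ∃ V : Finset X, x ∈ V ∧ x₀ ∈ V ∧
      ∀ y ∈ V, y ≠ x₀ → (q y).2 ∈ V := by
    intro n
    induction n with
    | zero =>
      intro x hx
      by_cases hne : x = x₀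
      · exact ⟨{x₀}, by simp [hne], by simp, by simp⟩
      · have := (hq x hne).1.2
        omega
    | succ n ih =>
      intro x hx
      by_cases hne : x = x₀
      · exact ⟨{x₀}, by simp [hne], by simp, by simp⟩
      · obtain ⟨V, h1, h2, h3⟩ := ih (q x).2 (by have := (hq x hne).1.2; omega)
        refine ⟨insert x V, Finset.mem_insert_self _ _, Finset.mem_insert_of_mem h2, ?_⟩
        intro y hy hy0
        rcases Finset.mem_insert.1 hy with rfl | hy
        · exact Finset.mem_insert_of_mem h1
        · exact Finset.mem_insert_of_mem (h3 y hy hy0)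
  choose W hW using fun x => hone (ℓ x) x le_rfl
  let S : Finset X := insert x₀ (c.support.biUnion fun t => t.toFinset)
  let V : Finset X := S.biUnion W
  obtain ⟨b, hb, hdb⟩ := cliques_exact_of_closed (p := fun x => (q x).2) (k := fun x => (q x).1)
    h.equiv h.root hq V.card V rfl
    (Finset.mem_biUnion.2 ⟨x₀, Finset.mem_insert_self _ _, (hW x₀).1⟩)
    (fun x hx hne => by
      obtain ⟨z, hz, hxz⟩ := Finset.mem_biUnion.1 hx
      exact Finset.mem_biUnion.2 ⟨z, hz, (hW z).2.2 x hxz hne⟩) c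
    (by
      rw [Finsupp.mem_supported] at hc ⊢
      intro t ht
      refine ⟨hc ht, fun x hx => Finset.mem_biUnion.2 ⟨x, ?_, (hW x).1⟩⟩
      exact Finset.mem_insert_of_mem (Finset.mem_biUnion.2 ⟨t, ht, List.mem_toFinset.2 hx⟩)) hdc
  exact ⟨b, Finsupp.supported_mono Set.inter_subset_left hb, hdb⟩

end CliqueComplex

/-! ### The tree of `SL₂(ℤ)` and the reduction of matrices. -/

section ModularTree

/-- Generators of the finite subgroups of orders four and six of which `SL₂(ℤ)` is an amalgam. -/
def ellipticGen : Bool → SL(2, ℤ)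
  | true => ⟨!![0, -1; 1, 0], by decide⟩
  | false => ⟨!![1, -1; 1, 0], by decide⟩

/-- The orders of the generators. -/
def ellipticOrder : Bool → ℕ
  | true => 4
  | false => 6

theorem ellipticOrder_pos (b : Bool) : 0 < ellipticOrder b := by cases b <;> decide

theorem ellipticGen_true_sq : ellipticGen true ^ 2 = -1 := by
  rw [pow_two]
  apply matrixEntries_injective
  decide

theorem ellipticGen_false_cube : ellipticGen false ^ 3 = -1 := by
  rw [pow_succ, pow_two]
  apply matrixEntries_injective
  decide

theorem ellipticGen_pow (b : Bool) : ellipticGen b ^ ellipticOrder b = 1 := by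
  cases b with
  | true => exact (pow_mul (ellipticGen true) 2 2).trans (by rw [ellipticGen_true_sq, neg_one_sq])
  | false => exact (pow_mul (ellipticGen false) 3 2).trans (by
      rw [ellipticGen_false_cube, neg_one_sq])

/-- The cyclic subgroups of orders four and six, as lists. -/
def ellipticList (b : Bool) : List SL(2, ℤ) :=
  (List.range (ellipticOrder b)).map fun k => ellipticGen b ^ k

theorem mem_ellipticList {b : Bool} {x : SL(2, ℤ)} :
    x ∈ ellipticList b ↔ ∃ k : ℕ, x = ellipticGen b ^ k := by
  rw [ellipticList, List.mem_map]
  constructor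
  · rintro ⟨k, _, rfl⟩
    exact ⟨k, rfl⟩
  · rintro ⟨k, rfl⟩
    exact ⟨k % ellipticOrder b, List.mem_range.2 (Nat.mod_lt _ (ellipticOrder_pos b)),
      (pow_eq_pow_mod k (ellipticGen_pow b)).symm⟩

theorem exists_lt_of_mem_ellipticList {b : Bool} {x : SL(2, ℤ)} (h : x ∈ ellipticList b) :
    ∃ k < ellipticOrder b, x = ellipticGen b ^ k := by
  obtain ⟨k, hk, rfl⟩ := List.mem_map.1 h
  exact ⟨k, List.mem_range.1 hk, rfl⟩

/-- Two matrices are related if they lie in the same left coset of one of the cyclic subgroups. -/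
def ellipticRel (b : Bool) (x y : SL(2, ℤ)) : Prop := x⁻¹ * y ∈ ellipticList b

theorem ellipticRel_equivalence (b : Bool) : Equivalence (ellipticRel b) where
  refl x := mem_ellipticList.2 ⟨0, by simp⟩
  symm {x y} h := by
    obtain ⟨k, hk, h⟩ := exists_lt_of_mem_ellipticList h
    refine mem_ellipticList.2 ⟨ellipticOrder b - k, ?_⟩
    have h2 : y⁻¹ * x = (ellipticGen b ^ k)⁻¹ := by rw [← h]; group
    rw [h2, inv_eq_iff_mul_eq_one, ← pow_add, Nat.add_sub_cancel' hk.le, ellipticGen_pow]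
  trans {x y z} h h' := by
    obtain ⟨k, h⟩ := mem_ellipticList.1 h
    obtain ⟨l, h'⟩ := mem_ellipticList.1 h'
    refine mem_ellipticList.2 ⟨k + l, ?_⟩
    rw [pow_add, ← h, ← h']
    group

theorem ellipticRel_mul_left (b : Bool) (g x y : SL(2, ℤ)) :
    ellipticRel b (g * x) (g * y) ↔ ellipticRel b x y := by
  unfold ellipticRel
  rw [mul_inv_rev, mul_assoc, inv_mul_cancel_left]

theorem ellipticRel_iff {b : Bool} {x y : SL(2, ℤ)} :
    ellipticRel b x y ↔ ∃ k < ellipticOrder b, y = x * ellipticGen b ^ k := by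
  constructor
  · intro h
    obtain ⟨k, hk, h⟩ := exists_lt_of_mem_ellipticList h
    exact ⟨k, hk, by rw [← h, mul_inv_cancel_left]⟩
  · rintro ⟨k, -, rfl⟩
    exact mem_ellipticList.2 ⟨k, by rw [inv_mul_cancel_left]⟩

/-- A size of matrices that decreases towards the identity in the tree of the amalgam. -/
def matrixSize (A : SL(2, ℤ)) : ℕ :=
  2 * ((A 0 0).natAbs + (A 1 0).natAbs + (A 0 1).natAbs + (A 1 1).natAbs) +
    (A 0 0 + A 0 1).natAbs + (A 1 0 + A 1 1).natAbs

/-- The size of a matrix, corrected near the identity. -/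
def treeLength (A : SL(2, ℤ)) : ℕ := if A = 1 then 0 else if A = -1 then 1 else matrixSize A

theorem matrixSize_neg (A : SL(2, ℤ)) : matrixSize (-A) = matrixSize A := by
  simp only [matrixSize, Matrix.SpecialLinearGroup.coe_neg, Matrix.neg_apply]
  omega

theorem det_entries (A : SL(2, ℤ)) : A 0 0 * A 1 1 - A 0 1 * A 1 0 = 1 := by
  have := A.det_coe
  rwa [Matrix.det_fin_two] at this

/-- The two columns and their sum are nonzero. If both columns have norm one (sum of absolute
values), then the norm of their sum is even by parity, hence at least two. The bound is attained at
`±1`, so the corrected lengths `0` and `1` lie below all other values. -/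
theorem six_le_matrixSize (A : SL(2, ℤ)) : 6 ≤ matrixSize A := by
  have h := det_entries A
  have h1 : ¬ (A 0 0 = 0 ∧ A 1 0 = 0) := fun ⟨h1, h2⟩ => by simp [h1, h2] at h
  have h2 : ¬ (A 0 1 = 0 ∧ A 1 1 = 0) := fun ⟨h1, h2⟩ => by simp [h1, h2] at h
  have h3 : ¬ (A 0 0 + A 0 1 = 0 ∧ A 1 0 + A 1 1 = 0) := fun ⟨h1, h2⟩ => by
    rw [eq_neg_of_add_eq_zero_left h1, eq_neg_of_add_eq_zero_left h2] at h
    linarith [mul_comm (A 0 1) (A 1 1)]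
  unfold matrixSize
  omega

theorem matrixSize_one : matrixSize 1 = 6 := by simp [matrixSize]

theorem treeLength_of_ne {A : SL(2, ℤ)} (h1 : A ≠ 1) (h2 : A ≠ -1) :
    treeLength A = matrixSize A := by
  rw [treeLength, if_neg h1, if_neg h2]

theorem treeLength_le_matrixSize (A : SL(2, ℤ)) : treeLength A ≤ matrixSize A := by
  have := six_le_matrixSize A
  unfold treeLength
  split_ifs <;> omega

theorem sl_mul_apply (A B : SL(2, ℤ)) (i j : Fin 2) :
    (A * B) i j = A i 0 * B 0 j + A i 1 * B 1 j := by
  rw [Matrix.SpecialLinearGroup.coe_mul, Matrix.mul_apply, Fin.sum_univ_two]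

theorem mul_S_apply (A : SL(2, ℤ)) (i : Fin 2) :
    (A * ellipticGen true) i 0 = A i 1 ∧ (A * ellipticGen true) i 1 = -A i 0 := by
  rw [sl_mul_apply, sl_mul_apply]
  simp [ellipticGen]

theorem mul_U_apply (A : SL(2, ℤ)) (i : Fin 2) :
    (A * ellipticGen false) i 0 = A i 0 + A i 1 ∧ (A * ellipticGen false) i 1 = -A i 0 := by
  rw [sl_mul_apply, sl_mul_apply]
  simp [ellipticGen]

/-- Right multiplication by the generator of order four swaps the columns up to sign. Only the last
term changes, from the norm of the sum of the columns to that of their difference. -/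
theorem matrixSize_mul_S (A : SL(2, ℤ)) : matrixSize (A * ellipticGen true) =
    2 * ((A 0 0).natAbs + (A 1 0).natAbs + (A 0 1).natAbs + (A 1 1).natAbs) +
    (A 0 1 - A 0 0).natAbs + (A 1 1 - A 1 0).natAbs := by
  simp only [matrixSize, (mul_S_apply A _).1, (mul_S_apply A _).2]
  omega

/-- Right multiplication by the generator of order six permutes the first column, the second column
and their sum cyclically up to sign. All that changes is which of the three is counted once instead
of twice. -/
theorem matrixSize_mul_U (A : SL(2, ℤ)) : matrixSize (A * ellipticGen false) =
    2 * ((A 0 0).natAbs + (A 1 0).natAbs + (A 0 0 + A 0 1).natAbs + (A 1 0 + A 1 1).natAbs) +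
    (A 0 1).natAbs + (A 1 1).natAbs := by
  simp only [matrixSize, (mul_U_apply A _).1, (mul_U_apply A _).2]
  omega

theorem matrixSize_mul_U_sq (A : SL(2, ℤ)) : matrixSize (A * ellipticGen false ^ 2) =
    2 * ((A 0 1).natAbs + (A 1 1).natAbs + (A 0 0 + A 0 1).natAbs + (A 1 0 + A 1 1).natAbs) +
    (A 0 0).natAbs + (A 1 0).natAbs := by
  rw [pow_two, ← mul_assoc, matrixSize_mul_U]
  simp only [(mul_U_apply A _).1, (mul_U_apply A _).2]
  omega

/-- Among the matrices whose rows have nonnegative products, these are the ones whose size does not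
drop when the columns are swapped. They are the powers of the generator of order four and have to be
treated apart. -/
theorem entries_eq_of_diag {A : SL(2, ℤ)} (h1 : A 0 0 * A 0 1 = 0) (h2 : A 1 0 * A 1 1 = 0) :
    (A = 1 ∨ A = -1) ∨ (A = ellipticGen true ∨ A = -ellipticGen true) := by
  have h := det_entries A
  rcases mul_eq_zero.1 h1 with h1 | h1
  · have hc : A 1 0 ≠ 0 := fun hc => by simp [h1, hc] at h
    have hd : A 1 1 = 0 := (mul_eq_zero.1 h2).resolve_left hc
    rw [h1, hd] at h
    have h' : A 0 1 * A 1 0 = -1 := by linarith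
    right
    rcases Int.mul_eq_neg_one_iff_eq_one_or_neg_one.1 h' with ⟨hb, hc⟩ | ⟨hb, hc⟩
    · right
      apply matrixEntries_injective
      simp only [matrixEntries, Matrix.SpecialLinearGroup.coe_neg, Matrix.neg_apply, h1, hb, hc, hd]
      simp [ellipticGen]
    · left
      apply matrixEntries_injective
      simp [matrixEntries, ellipticGen, h1, hb, hc, hd]
  · have hd : A 1 1 ≠ 0 := fun hd => by simp [h1, hd] at h
    have hc : A 1 0 = 0 := (mul_eq_zero.1 h2).resolve_right hd
    rw [h1, hc] at h
    have h' : A 0 0 * A 1 1 = 1 := by linarith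
    left
    rcases Int.mul_eq_one_iff_eq_one_or_neg_one.1 h' with ⟨ha, hd⟩ | ⟨ha, hd⟩
    · left
      apply matrixEntries_injective
      simp [matrixEntries, h1, ha, hc, hd]
    · right
      apply matrixEntries_injective
      simp [matrixEntries, h1, ha, hc, hd]

theorem natAbs_add_of_mul_nonneg {a b : ℤ} (h : 0 ≤ a * b) :
    (a + b).natAbs = a.natAbs + b.natAbs ∧ ((b - a).natAbs ≤ a.natAbs + b.natAbs) ∧
      (a * b ≠ 0 → (b - a).natAbs < a.natAbs + b.natAbs) := by
  have h0 : a * b ≠ 0 → a ≠ 0 ∧ b ≠ 0 := fun h => ⟨left_ne_zero_of_mul h, right_ne_zero_of_mul h⟩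
  rcases mul_nonneg_iff.1 h with ⟨h1, h2⟩ | ⟨h1, h2⟩ <;>
    refine ⟨by omega, by omega, fun h => ?_⟩ <;> have := h0 h <;> omega

theorem natAbs_add_of_mul_nonpos {a b : ℤ} (h : a * b ≤ 0) :
    (b - a).natAbs = a.natAbs + b.natAbs ∧
      ((a + b).natAbs + b.natAbs = a.natAbs ∨ (a + b).natAbs + a.natAbs = b.natAbs) ∧
      (a.natAbs ≤ b.natAbs → (a + b).natAbs + a.natAbs = b.natAbs) ∧
      (b.natAbs ≤ a.natAbs → (a + b).natAbs + b.natAbs = a.natAbs) := by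
  rcases mul_nonpos_iff.1 h with ⟨h1, h2⟩ | ⟨h1, h2⟩ <;>
    refine ⟨by omega, by omega, by omega, by omega⟩

/-- The products of the two rows cannot have strictly opposite signs: their product equals `(a * d)
* (b * c)`, a product of two consecutive integers, and is therefore never negative. -/
theorem mul_nonpos_of_det {a b c d : ℤ} (h : a * d - b * c = 1) (hn : ¬ (0 ≤ a * b ∧ 0 ≤ c * d)) :
    a * b ≤ 0 ∧ c * d ≤ 0 := by
  by_contra hcon
  have key : (a * b) * (c * d) < 0 := by
    rcases lt_or_ge (a * b) 0 with h1 | h1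
    · have : 0 < c * d := by
        by_contra h2
        exact hcon ⟨h1.le, not_lt.1 h2⟩
      exact mul_neg_of_neg_of_pos h1 this
    · have h2 : c * d < 0 := by
        by_contra h2
        exact hn ⟨h1, not_lt.1 h2⟩
      have : 0 < a * b := by
        by_contra h3
        exact hcon ⟨not_lt.1 h3, h2.le⟩
      exact mul_neg_of_pos_of_neg this h2
  have h3 : (a * d) * (b * c) < 0 := lt_of_eq_of_lt (by ring) key
  have h4 : a * d = b * c + 1 := by linarith
  rw [h4] at h3
  rcases lt_or_ge (b * c) 0 with h5 | h5
  · have : b * c + 1 ≤ 0 := h5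
    nlinarith
  · nlinarith

/-- The entries of each row have opposite signs, so in a row the absolute value of the sum falls
below the larger of the two by the smaller one. If the larger entries lie in the same column, this
column is longer than the sum. Otherwise, up to ties, the larger entries lie on a diagonal, and
determinant one would force the other diagonal to vanish, against `hn`. -/
theorem natAbs_lt_or_lt {a b c d : ℤ} (h : a * d - b * c = 1) (hn : ¬ (0 ≤ a * b ∧ 0 ≤ c * d)) :
    (a + b).natAbs + (c + d).natAbs < a.natAbs + c.natAbs ∨
      (a + b).natAbs + (c + d).natAbs < b.natAbs + d.natAbs := by
  obtain ⟨h1, h2⟩ := mul_nonpos_of_det h hn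
  obtain ⟨-, -, e1, e2⟩ := natAbs_add_of_mul_nonpos h1
  obtain ⟨-, -, f1, f2⟩ := natAbs_add_of_mul_nonpos h2
  have n1 : ¬ (a = 0 ∧ c = 0) := fun ⟨ha, hc⟩ => by simp [ha, hc] at h
  have n2 : ¬ (b = 0 ∧ d = 0) := fun ⟨ha, hc⟩ => by simp [ha, hc] at h
  have m1 : b.natAbs * c.natAbs ≤ a.natAbs * d.natAbs + 1 := by
    rw [← Int.natAbs_mul, ← Int.natAbs_mul]
    omega
  have m2 : a.natAbs * d.natAbs ≤ b.natAbs * c.natAbs + 1 := by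
    rw [← Int.natAbs_mul, ← Int.natAbs_mul]
    omega
  rcases le_or_gt a.natAbs b.natAbs with hab | hab <;>
    rcases le_or_gt c.natAbs d.natAbs with hcd | hcd
  · right; have := e1 hab; have := f1 hcd; omega
  · rcases hab.eq_or_lt with hab | hab
    · have := e2 hab.ge; have := f2 hcd.le; left; omega
    · have hz : a.natAbs + d.natAbs = 0 := by
        have : (a.natAbs + 1) * (d.natAbs + 1) ≤ b.natAbs * c.natAbs := Nat.mul_le_mul hab hcd
        rw [add_mul, one_mul, mul_add, mul_one] at this
        omega
      have ha : a = 0 := by omega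
      have hd : d = 0 := by omega
      exact absurd (by simp [ha, hd]) hn
  · rcases hcd.eq_or_lt with hcd | hcd
    · have := e2 hab.le; have := f2 hcd.ge; left; omega
    · have hz : b.natAbs + c.natAbs = 0 := by
        have : (b.natAbs + 1) * (c.natAbs + 1) ≤ a.natAbs * d.natAbs := Nat.mul_le_mul hab hcd
        rw [add_mul, one_mul, mul_add, mul_one] at this
        omega
      have ha : b = 0 := by omega
      have hd : c = 0 := by omega
      exact absurd (by simp [ha, hd]) hn
  · left; have := e2 hab.le; have := f2 hcd.le; omega

/-- If no row has entries of opposite signs, the sum of the columns is strictly longer than each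
column: the generator of order six only increases the size, and the one of order four leads to the
parent. Otherwise the sum is shorter than some column: a power of the generator of order six
decreases the size, and the one of order four increases it. In both cases the matrices in the other
class that are not larger are `±x`, and these lie in the same class for either relation. -/
theorem modular_isTreeLike : IsTreeLike ellipticRel treeLength 1 where
  equiv := ellipticRel_equivalence
  root := by simp [treeLength]
  parent x hx := by
    have hS2 := ellipticGen_true_sq
    have hU3 := ellipticGen_false_cube
    have hneg : ∀ b (y : SL(2, ℤ)), ellipticRel b y (-y) := fun b y => by
      rw [ellipticRel_iff]
      cases b with
      | true => exact ⟨2, by decide, by rw [hS2]; simp⟩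
      | false => exact ⟨3, by decide, by rw [hU3]; simp⟩
    -- The matrix `-1` has the same size as the identity; its corrected length makes the identity
    -- its parent and leaves every other matrix longer.
    by_cases hx1 : x = -1
    · subst hx1
      have h1 : treeLength (-1 : SL(2, ℤ)) = 1 := by rw [treeLength, if_neg hx, if_pos rfl]
      refine ⟨true, ⟨1, ?_, ?_⟩, fun y hy hle => ?_⟩
      · have := hneg true (-1)
        rwa [neg_neg] at this
      · rw [h1]; simp [treeLength]
      · rw [h1] at hle
        have h4 := six_le_matrixSize y
        by_cases hy1 : y = 1
        · have := hneg true (-1)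
          rw [neg_neg] at this
          rwa [hy1]
        · by_cases hy2 : y = -1
          · rw [hy2]; exact (ellipticRel_equivalence _).refl _
          · rw [treeLength_of_ne hy1 hy2] at hle
            omega
    have hxl := treeLength_of_ne hx hx1
    have hdet := det_entries x
    have n1 : ¬ (x 0 0 = 0 ∧ x 1 0 = 0) := fun ⟨ha, hc⟩ => by simp [ha, hc] at hdet
    have n2 : ¬ (x 0 1 = 0 ∧ x 1 1 = 0) := fun ⟨ha, hc⟩ => by simp [ha, hc] at hdet
    have hbig : ∀ y : SL(2, ℤ), matrixSize x < matrixSize y → ¬ treeLength y ≤ treeLength x := by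
      intro y h1 h2
      have h6 := six_le_matrixSize x
      rw [treeLength_of_ne, hxl] at h2
      · omega
      · rintro rfl
        rw [matrixSize_one] at h1
        omega
      · rintro rfl
        rw [matrixSize_neg, matrixSize_one] at h1
        omega
    by_cases hA : 0 ≤ x 0 0 * x 0 1 ∧ 0 ≤ x 1 0 * x 1 1
    · obtain ⟨a1, a2, a3⟩ := natAbs_add_of_mul_nonneg hA.1
      obtain ⟨b1, b2, b3⟩ := natAbs_add_of_mul_nonneg hA.2
      refine ⟨true, ⟨x * ellipticGen true, ?_, ?_⟩, fun y hy hle => ?_⟩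
      · exact ellipticRel_iff.2 ⟨1, by decide, by rw [pow_one]⟩
      -- For `x` plus or minus the generator the size stays the same, but the product is `∓1`, whose
      -- length has been lowered by the correction.
      · by_cases h0 : x 0 0 * x 0 1 = 0 ∧ x 1 0 * x 1 1 = 0
        · rcases entries_eq_of_diag h0.1 h0.2 with (h | h) | (h | h)
          · exact absurd h hx
          · exact absurd h hx1
          · have : x * ellipticGen true = -1 := by rw [h, ← pow_two, hS2]
            rw [hxl, this]
            have := six_le_matrixSize x
            simp only [treeLength]
            split_ifs <;> omega
          · have : x * ellipticGen true = 1 := by rw [h, neg_mul, ← pow_two, hS2, neg_neg]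
            rw [hxl, this]
            have := six_le_matrixSize x
            simp only [treeLength, if_true]
            omega
        · rw [hxl]
          refine lt_of_le_of_lt (treeLength_le_matrixSize _) ?_
          rw [matrixSize_mul_S, matrixSize]
          by_cases h1 : x 0 0 * x 0 1 = 0
          · have := b3 fun h => h0 ⟨h1, h⟩
            omega
          · have := a3 h1
            omega
      · obtain ⟨k, hk, rfl⟩ := ellipticRel_iff.1 hy
        have hU1 : matrixSize x < matrixSize (x * ellipticGen false) := by
          rw [matrixSize_mul_U, matrixSize]
          omega
        have hU2 : matrixSize x < matrixSize (x * ellipticGen false ^ 2) := by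
          rw [matrixSize_mul_U_sq, matrixSize]
          omega
        rcases show k = 0 ∨ k = 1 ∨ k = 2 ∨ k = 0 + 3 ∨ k = 1 + 3 ∨ k = 2 + 3 by
          have : k < 6 := hk
          omega with rfl | rfl | rfl | rfl | rfl | rfl
        · rw [pow_zero, mul_one]; exact (ellipticRel_equivalence _).refl _
        · rw [Bool.not_true, pow_one] at hle
          exact absurd hle (hbig _ hU1)
        · exact absurd hle (hbig _ hU2)
        · rw [Bool.not_true, pow_add, hU3, pow_zero, one_mul, mul_neg, mul_one]
          exact hneg _ _
        · rw [Bool.not_true, pow_add, hU3, pow_one, mul_neg_one, mul_neg] at hle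
          exact absurd hle (hbig _ (by rwa [matrixSize_neg]))
        · rw [Bool.not_true, pow_add, hU3, mul_neg_one, mul_neg] at hle
          exact absurd hle (hbig _ (by rwa [matrixSize_neg]))
    · obtain ⟨h1, h2⟩ := mul_nonpos_of_det hdet hA
      obtain ⟨a1, a2, -, -⟩ := natAbs_add_of_mul_nonpos h1
      obtain ⟨b1, b2, -, -⟩ := natAbs_add_of_mul_nonpos h2
      refine ⟨false, ?_, fun y hy hle => ?_⟩
      · rcases natAbs_lt_or_lt hdet hA with h | h
        · refine ⟨x * ellipticGen false ^ 2, ellipticRel_iff.2 ⟨2, by decide, rfl⟩, ?_⟩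
          rw [hxl]
          refine lt_of_le_of_lt (treeLength_le_matrixSize _) ?_
          rw [matrixSize_mul_U_sq, matrixSize]
          omega
        · refine ⟨x * ellipticGen false, ellipticRel_iff.2 ⟨1, by decide, by rw [pow_one]⟩, ?_⟩
          rw [hxl]
          refine lt_of_le_of_lt (treeLength_le_matrixSize _) ?_
          rw [matrixSize_mul_U, matrixSize]
          omega
      · obtain ⟨k, hk, rfl⟩ := ellipticRel_iff.1 hy
        have h0 : ¬ ((x 0 0 = 0 ∨ x 0 1 = 0) ∧ (x 1 0 = 0 ∨ x 1 1 = 0)) := fun h =>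
          hA ⟨(mul_eq_zero.2 h.1).ge, (mul_eq_zero.2 h.2).ge⟩
        have hS1 : matrixSize x < matrixSize (x * ellipticGen true) := by
          rw [matrixSize_mul_S, matrixSize]
          omega
        rcases show k = 0 ∨ k = 1 ∨ k = 0 + 2 ∨ k = 1 + 2 by
          have : k < 4 := hk
          omega with rfl | rfl | rfl | rfl
        · rw [pow_zero, mul_one]; exact (ellipticRel_equivalence _).refl _
        · rw [Bool.not_false, pow_one] at hle
          exact absurd hle (hbig _ hS1)
        · rw [Bool.not_false, pow_add, hS2, pow_zero, one_mul, mul_neg, mul_one]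
          exact hneg _ _
        · rw [Bool.not_false, pow_add, hS2, pow_one, mul_neg_one, mul_neg] at hle
          exact absurd hle (hbig _ (by rwa [matrixSize_neg]))

end ModularTree

/-! ### Chains as finite lists of terms. -/

section FormalSums

variable {X X' : Type*}

/-- The chain with the given list of terms. -/
noncomputable def toChain (y : List (ℤ × List X)) : List X →₀ ℤ :=
  (y.map fun p => Finsupp.single p.2 p.1).sum

theorem toChain_nil : toChain ([] : List (ℤ × List X)) = 0 := rfl

theorem toChain_cons (p : ℤ × List X) (y : List (ℤ × List X)) :
    toChain (p :: y) = Finsupp.single p.2 p.1 + toChain y := by simp [toChain]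

theorem toChain_append (y y' : List (ℤ × List X)) :
    toChain (y ++ y') = toChain y + toChain y' := by simp [toChain]

theorem toChain_flatten (l : List (List (ℤ × List X))) :
    toChain l.flatten = (l.map toChain).sum := by
  induction l with
  | nil => rfl
  | cons y l ih => rw [List.flatten_cons, toChain_append, ih, List.map_cons, List.sum_cons]

theorem map_toChain {M : Type*} [AddCommGroup M] (f : (List X →₀ ℤ) →ₗ[ℤ] M)
    (y : List (ℤ × List X)) :
    f (toChain y) = (y.map fun p => p.1 • f (Finsupp.single p.2 1)).sum := by
  rw [toChain, map_list_sum, List.map_map]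
  congr 2
  funext p
  rw [Function.comp_apply, ← map_smul, Finsupp.smul_single, smul_eq_mul, mul_one]

theorem toChain_mem_supported {s : Set (List X)} {y : List (ℤ × List X)}
    (h : ∀ p ∈ y, p.2 ∈ s) : toChain y ∈ Finsupp.supported ℤ ℤ s := by
  refine list_sum_mem fun c hc => ?_
  obtain ⟨p, hp, rfl⟩ := List.mem_map.1 hc
  exact Finsupp.single_mem_supported ℤ _ (h p hp)

theorem exists_toChain_eq {s : Set (List X)} {c : List X →₀ ℤ}
    (hc : c ∈ Finsupp.supported ℤ ℤ s) : ∃ y, toChain y = c ∧ ∀ p ∈ y, p.2 ∈ s := by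
  refine ⟨c.support.toList.map fun t => (c t, t), ?_, fun p hp => ?_⟩
  · rw [toChain, List.map_map]
    exact (Finset.sum_map_toList c.support fun t => Finsupp.single t (c t)).trans c.sum_single
  · obtain ⟨t, ht, rfl⟩ := List.mem_map.1 hp
    exact (Finsupp.mem_supported ℤ c).1 hc (Finset.mem_toList.1 ht)

theorem chainEval_toChain (f : List X → ℤ) (y : List (ℤ × List X)) :
    chainEval f (toChain y) = (y.map fun p => p.1 * f p.2).sum := by
  rw [map_toChain]
  simp [chainEval_single]

/-- Scaling a formal sum and applying a map to the vertices. -/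
def transformTerms (a : ℤ) (f : X → X') (y : List (ℤ × List X)) : List (ℤ × List X') :=
  y.map fun p => (a * p.1, p.2.map f)

theorem toChain_transformTerms (a : ℤ) (f : X → X') (y : List (ℤ × List X)) :
    toChain (transformTerms a f y) = a • chainMap f (toChain y) := by
  rw [map_toChain, List.smul_sum, List.map_map, transformTerms, toChain, List.map_map]
  congr 2
  funext p
  simp [chainMap_single]

/-- The faces of a tuple, with signs. -/
def faceTerms : List X → List (ℤ × List X)
  | [] => []
  | x :: t => (1, t) :: (faceTerms t).map fun p => (-p.1, x :: p.2)

theorem toChain_faceTerms (t : List X) : toChain (faceTerms t) = faces t := by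
  induction t with
  | nil => rfl
  | cons x t ih =>
    rw [faceTerms, toChain_cons, faces, ← ih, sub_eq_add_neg, ← LinearMap.neg_apply, map_toChain]
    congr 1
    rw [toChain, List.map_map]
    congr 2
    funext p
    simp [chainCons_single]

theorem faceTerms_sublist (t : List X) :
    ∀ p ∈ faceTerms t, p.2.Sublist t ∧ p.2.length + 1 = t.length := by
  induction t with
  | nil => simp [faceTerms]
  | cons x t ih =>
    intro p hp
    rcases List.mem_cons.1 hp with rfl | hp
    · exact ⟨List.sublist_cons_self x t, rfl⟩
    · obtain ⟨q, hq, rfl⟩ := List.mem_map.1 hp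
      exact ⟨(ih q hq).1.cons_cons x, by simpa using (ih q hq).2⟩

/-- The boundary of a formal sum. -/
def boundaryTerms (y : List (ℤ × List X)) : List (ℤ × List X) :=
  y.flatMap fun p => (faceTerms p.2).map fun q => (p.1 * q.1, q.2)

theorem toChain_boundaryTerms (y : List (ℤ × List X)) :
    toChain (boundaryTerms y) = chainBoundary (toChain y) := by
  induction y with
  | nil => simp [boundaryTerms, toChain_nil]
  | cons p y ih =>
    rw [boundaryTerms, List.flatMap_cons, toChain_append]
    rw [boundaryTerms] at ih
    rw [ih, toChain_cons, map_add, chainBoundary_single, ← toChain_faceTerms]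
    congr 1
    rw [toChain, toChain, List.smul_sum, List.map_map, List.map_map]
    congr 2
    funext q
    simp

theorem toChain_apply [DecidableEq X] (y : List (ℤ × List X)) (t : List X) :
    toChain y t = (y.map fun p => if p.2 = t then p.1 else 0).sum := by
  induction y with
  | nil => rfl
  | cons p y ih =>
    rw [toChain_cons, Finsupp.add_apply, ih, List.map_cons, List.sum_cons, Finsupp.single_apply]

/-- The terms of the formal sum cancel. -/
def TermsCancel [DecidableEq X] (y : List (ℤ × List X)) : Prop :=
  ∀ q ∈ y, (y.map fun p => if p.2 = q.2 then p.1 else 0).sum = 0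

/-- A coefficient can be nonzero only at a tuple that occurs in the list, so the vanishing of a
chain becomes a finite check. -/
theorem termsCancel_iff [DecidableEq X] (y : List (ℤ × List X)) :
    TermsCancel y ↔ toChain y = 0 := by
  constructor
  · intro h
    ext t
    rw [Finsupp.zero_apply]
    by_cases ht : ∃ q ∈ y, q.2 = t
    · obtain ⟨q, hq, rfl⟩ := ht
      rw [toChain_apply]
      exact h q hq
    · rw [toChain_apply]
      refine List.sum_eq_zero fun a ha => ?_
      obtain ⟨p, hp, rfl⟩ := List.mem_map.1 ha
      exact if_neg fun h => ht ⟨p, hp, h⟩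
  · intro h q _
    rw [← toChain_apply, h, Finsupp.zero_apply]

end FormalSums

/-! ### Primitive recursiveness of the operations on formal sums. -/

section FormalSumsPrimrec

variable {α X : Type*} [Primcodable α] [Primcodable X]

theorem Primrec.transformTerms {a : α → ℤ} {f : α → X → X} {y : α → List (ℤ × List X)}
    (ha : Primrec a) (hf : Primrec₂ f) (hy : Primrec y) :
    Primrec fun z => transformTerms (a z) (f z) (y z) := by
  refine Primrec.list_map hy (g := fun z p => (a z * p.1, p.2.map (f z))) (Primrec.pair ?_ ?_)
  · exact Primrec.int_mul.comp (ha.comp Primrec.fst) (Primrec.fst.comp Primrec.snd)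
  · exact Primrec.list_map (Primrec.snd.comp Primrec.snd)
      (hf.comp (Primrec.fst.comp Primrec.fst) Primrec.snd)

theorem Primrec.faceTerms : Primrec (faceTerms : List X → List (ℤ × List X)) := by
  refine (Primrec.list_rec (f := fun t : List X => t) (g := fun _ => ([] : List (ℤ × List X)))
    (h := fun _ q => (1, q.2.1) :: q.2.2.map fun p => (-p.1, q.1 :: p.2))
    Primrec.id (Primrec.const []) ?_).of_eq fun t => ?_
  · refine Primrec.list_cons.comp (Primrec.pair (Primrec.const 1)
      (Primrec.fst.comp (Primrec.snd.comp Primrec.snd))) ?_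
    refine Primrec.list_map (Primrec.snd.comp (Primrec.snd.comp Primrec.snd)) (Primrec.pair ?_ ?_)
    · exact Primrec.int_neg.comp (Primrec.fst.comp Primrec.snd)
    · exact Primrec.list_cons.comp (Primrec.fst.comp (Primrec.snd.comp Primrec.fst))
        (Primrec.snd.comp Primrec.snd)
  · induction t with
    | nil => rfl
    | cons x t ih =>
      dsimp only at ih ⊢
      rw [_root_.faceTerms, ← ih]

theorem Primrec.boundaryTerms :
    Primrec (boundaryTerms : List (ℤ × List X) → List (ℤ × List X)) := by
  refine Primrec.list_flatMap Primrec.id ?_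
  refine Primrec.list_map (Primrec.faceTerms.comp (Primrec.snd.comp Primrec.snd))
    (Primrec.pair ?_ (Primrec.snd.comp Primrec.snd))
  exact Primrec.int_mul.comp (Primrec.fst.comp (Primrec.snd.comp Primrec.fst))
    (Primrec.fst.comp Primrec.snd)

theorem PrimrecPred.termsCancel [DecidableEq X] :
    PrimrecPred (TermsCancel : List (ℤ × List X) → Prop) := by
  refine PrimrecPred.forall_mem Primrec.id ?_
  refine Primrec.eq.comp (Primrec.list_sum_int.comp (Primrec.list_map Primrec.fst
    (Primrec.ite ?_ (Primrec.fst.comp Primrec.snd) (Primrec.const 0)))) (Primrec.const 0)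
  exact Primrec.eq.comp (Primrec.snd.comp Primrec.snd)
    (Primrec.snd.comp (Primrec.snd.comp Primrec.fst))

theorem PrimrecPred.mem_const (l : List X) : PrimrecPred fun x : X => x ∈ l :=
  (PrimrecPred.forall_mem (α := X) (l := fun _ => l) (p := fun x y => ¬ y = x) (Primrec.const l)
    (PrimrecPred.not (Primrec.eq.comp Primrec.snd Primrec.fst))).not.of_eq fun x => by simp

theorem PrimrecPred.mem_cliques : PrimrecPred fun t => t ∈ cliques ellipticRel := by
  have h : ∀ b, PrimrecPred fun t : List SL(2, ℤ) => ∀ x ∈ t, ∀ y ∈ t, ellipticRel b x y :=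
    fun b => PrimrecPred.forall_mem Primrec.id
      (PrimrecPred.primrecRel (p := fun q : List SL(2, ℤ) × SL(2, ℤ) =>
          ∀ y ∈ q.1, ellipticRel b q.2 y)
        (PrimrecPred.forall_mem Primrec.fst ((PrimrecPred.mem_const (ellipticList b)).comp
          (Primrec.sl_mul.comp (Primrec.sl_inv.comp (Primrec.snd.comp Primrec.fst)) Primrec.snd))))
  refine ((h true).or (h false)).of_eq fun t => ?_
  constructor
  · rintro (h | h)
    · exact ⟨true, h⟩
    · exact ⟨false, h⟩
  · rintro ⟨b, h⟩
    cases b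
    · exact Or.inr h
    · exact Or.inl h

end FormalSumsPrimrec

/-! ### The computable equivariant projection onto the complex of cliques. -/

section CliqueProjection

open Nat.Partrec (Code)

theorem cliques_smul {t : List SL(2, ℤ)} (g : SL(2, ℤ)) (h : t ∈ cliques ellipticRel) :
    t.map (g * ·) ∈ cliques ellipticRel := by
  obtain ⟨b, hb⟩ := h
  refine ⟨b, fun x hx y hy => ?_⟩
  obtain ⟨x', hx', rfl⟩ := List.mem_map.1 hx
  obtain ⟨y', hy', rfl⟩ := List.mem_map.1 hy
  exact (ellipticRel_mul_left b g x' y').2 (hb x' hx' y' hy')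

/-- Cycles of cliques can be filled by a search. -/
theorem exists_partrec_filling :
    ∃ F : List (ℤ × List SL(2, ℤ)) → Part (List (ℤ × List SL(2, ℤ))), Partrec F ∧
      ∀ y, toChain y ∈ Finsupp.supported ℤ ℤ (cliques ellipticRel) →
        chainBoundary (toChain y) = 0 →
        ∃ z, F y = Part.some z ∧ toChain z ∈ Finsupp.supported ℤ ℤ (cliques ellipticRel) ∧
          chainBoundary (toChain z) = toChain y := by
  let p : List (ℤ × List SL(2, ℤ)) → List (ℤ × List SL(2, ℤ)) → Prop := fun y z =>
    TermsCancel (boundaryTerms z ++ transformTerms (-1) id y) ∧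
      ∀ q ∈ z, q.2 ∈ cliques ellipticRel
  have hp : PrimrecRel p := by
    refine PrimrecPred.and (PrimrecPred.comp (PrimrecPred.termsCancel (X := SL(2, ℤ)))
      (Primrec.list_append.comp
      (Primrec.boundaryTerms.comp Primrec.snd)
      (Primrec.transformTerms (f := fun _ => id) (Primrec.const (-1)) Primrec.snd Primrec.fst))) ?_
    exact PrimrecPred.forall_mem Primrec.snd
      (PrimrecPred.mem_cliques.comp (Primrec.snd.comp Primrec.snd))
  have hpiff : ∀ y z : List (ℤ × List SL(2, ℤ)),
      TermsCancel (boundaryTerms z ++ transformTerms (-1) id y) ↔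
      chainBoundary (toChain z) = toChain y := fun y z => by
    rw [termsCancel_iff, toChain_append, toChain_boundaryTerms, toChain_transformTerms, chainMap_id,
      neg_one_smul, ← sub_eq_add_neg, sub_eq_zero]
  obtain ⟨F, hF, h⟩ := exists_primrec_search hp
  refine ⟨F, hF, fun y hy hdy => ?_⟩
  -- Exactness of the clique complex is what makes the search halt.
  obtain ⟨c, hc, hdc⟩ := modular_isTreeLike.exact hy hdy
  obtain ⟨z, rfl, hz⟩ := exists_toChain_eq hc
  obtain ⟨z', h1, h2, h3⟩ := h y ⟨z, (hpiff y z).2 hdc, hz⟩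
  exact ⟨z', h1, toChain_mem_supported h3, (hpiff y z').1 h2⟩

/-- The equivariant map of chains that sends the tuple `1 :: t` to the formal sum `y t`. -/
noncomputable def tupleExtension (y : List SL(2, ℤ) → List (ℤ × List SL(2, ℤ))) :
    List SL(2, ℤ) → (List SL(2, ℤ) →₀ ℤ)
  | [] => Finsupp.single [] 1
  | g :: t => chainMap (g * ·) (toChain (y (t.map (g⁻¹ * ·))))

/-- The equivariant map of chains that sends the tuple `1 :: t` to the formal sum `y t`. -/
noncomputable def chainExtension (y : List SL(2, ℤ) → List (ℤ × List SL(2, ℤ))) :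
    (List SL(2, ℤ) →₀ ℤ) →ₗ[ℤ] (List SL(2, ℤ) →₀ ℤ) :=
  Finsupp.linearCombination ℤ (tupleExtension y)

variable {y : List SL(2, ℤ) → List (ℤ × List SL(2, ℤ))}

theorem chainExtension_single (t : List SL(2, ℤ)) :
    chainExtension y (Finsupp.single t 1) = tupleExtension y t := by simp [chainExtension]

/-- This holds for every `y`: a nonempty tuple is sent to the translate, by its first entry, of the
value at the normalized tuple. -/
theorem chainExtension_equivariant (g : SL(2, ℤ)) (c : List SL(2, ℤ) →₀ ℤ) :
    chainExtension y (chainMap (g * ·) c) = chainMap (g * ·) (chainExtension y c) := by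
  have : chainExtension y ∘ₗ chainMap (g * ·) = chainMap (g * ·) ∘ₗ chainExtension y := by
    refine chain_hom_ext fun t => ?_
    simp only [LinearMap.comp_apply, chainMap_single, chainExtension_single]
    cases t with
    | nil => simp [tupleExtension, chainMap_single]
    | cons x t =>
      rw [List.map_cons, tupleExtension, tupleExtension, chainMap_chainMap, List.map_map]
      have h1 : ((g * x)⁻¹ * ·) ∘ (g * ·) = (x⁻¹ * · : SL(2, ℤ) → SL(2, ℤ)) := by
        funext z
        simp only [Function.comp_apply, mul_inv_rev, mul_assoc, inv_mul_cancel_left]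
      have h2 : (g * x * · : SL(2, ℤ) → SL(2, ℤ)) = (g * ·) ∘ (x * ·) := by
        funext z
        simp only [Function.comp_apply, mul_assoc]
      rw [h1, h2]
  exact LinearMap.congr_fun this c

/-- The tuple `t` satisfies the conditions for the equivariant extension of `y` to be a chain map
that projects onto the complex of cliques. -/
structure IsProjectionAt (y : List SL(2, ℤ) → List (ℤ × List SL(2, ℤ))) (t : List SL(2, ℤ)) :
    Prop where
  mem : toChain (y t) ∈ Finsupp.supported ℤ ℤ (cliques ellipticRel)
  clique : 1 :: t ∈ cliques ellipticRel → y t = [(1, 1 :: t)]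
  boundary : chainBoundary (toChain (y t)) = chainExtension y (faces (1 :: t))

theorem chainMap_mul_one (c : List SL(2, ℤ) →₀ ℤ) : chainMap ((1 : SL(2, ℤ)) * ·) c = c := by
  have : ((1 : SL(2, ℤ)) * ·) = (id : SL(2, ℤ) → SL(2, ℤ)) := by funext x; simp
  rw [this, chainMap_id]

theorem tupleExtension_one_cons (t : List SL(2, ℤ)) :
    tupleExtension y (1 :: t) = toChain (y t) := by
  rw [tupleExtension, chainMap_mul_one]
  simp

theorem tupleExtension_boundary {g : SL(2, ℤ)} {t : List SL(2, ℤ)}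
    (h : IsProjectionAt y (t.map (g⁻¹ * ·))) :
    chainBoundary (tupleExtension y (g :: t)) = chainExtension y (faces (g :: t)) := by
  have e : g :: t = (1 :: t.map (g⁻¹ * ·)).map (g * ·) := by
    simp [Function.comp_def]
  rw [tupleExtension, ← chainMap_chainBoundary, h.boundary, ← chainExtension_equivariant,
    chainMap_faces, ← e]

/-- The version for a single length is needed because, during the recursion, the conditions are
available for shorter tuples only. -/
theorem chainExtension_boundary {n : ℕ} (h : ∀ t, t.length = n → IsProjectionAt y t)
    {c : List SL(2, ℤ) →₀ ℤ} (hc : c ∈ Finsupp.supported ℤ ℤ {t | t.length = n + 1}) :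
    chainBoundary (chainExtension y c) = chainExtension y (chainBoundary c) := by
  obtain ⟨z, rfl, hz⟩ := exists_toChain_eq hc
  rw [map_toChain, map_toChain, map_list_sum, map_list_sum, List.map_map, List.map_map]
  congr 1
  refine List.map_congr_left fun p hp => ?_
  have hl := hz p hp
  obtain ⟨a, t⟩ := p
  cases t with
  | nil => simp at hl
  | cons g t =>
    simp only [Function.comp_apply, map_smul, chainExtension_single, chainBoundary_single, one_smul]
    rw [tupleExtension_boundary (h _ (by simpa using hl))]

theorem tupleExtension_mem {g : SL(2, ℤ)} {t : List SL(2, ℤ)}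
    (h : IsProjectionAt y (t.map (g⁻¹ * ·))) :
    tupleExtension y (g :: t) ∈ Finsupp.supported ℤ ℤ (cliques ellipticRel) :=
  chainMap_mem_supported h.mem fun _ ht => cliques_smul g ht

theorem tupleExtension_clique {g : SL(2, ℤ)} {t : List SL(2, ℤ)}
    (h : IsProjectionAt y (t.map (g⁻¹ * ·))) (ht : g :: t ∈ cliques ellipticRel) :
    tupleExtension y (g :: t) = Finsupp.single (g :: t) 1 := by
  have := h.clique (by have := cliques_smul g⁻¹ ht; simpa using this)
  rw [tupleExtension, this, toChain_cons, toChain_nil, add_zero, chainMap_single]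
  simp [Function.comp_def]

/-- The right hand side of the equation that determines the projection at the tuple `t`, as a
combination of translates of its values at shorter tuples. -/
def projectionTerms : List SL(2, ℤ) → List ((ℤ × SL(2, ℤ)) × List SL(2, ℤ))
  | [] => []
  | g :: t => ((1, g), t.map (g⁻¹ * ·)) :: (faceTerms (g :: t)).map fun p => ((-p.1, 1), p.2)

theorem projectionTerms_length (t : List SL(2, ℤ)) :
    ∀ p ∈ projectionTerms t, p.2.length + 1 = t.length := by
  cases t with
  | nil => simp [projectionTerms]
  | cons g t =>
    intro p hp
    rcases List.mem_cons.1 hp with rfl | hp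
    · simp
    · obtain ⟨q, hq, rfl⟩ := List.mem_map.1 hp
      exact (faceTerms_sublist (g :: t) q hq).2

/-- Among the faces of `1 :: t`, those that keep the first vertex involve `y` at faces of `t`, and
the remaining face `t` involves a translate of a value of `y`. All these values belong to tuples of
length one less. The empty `t` is excluded, because the only face of `[1]` is the empty tuple, at
which the extension does not involve `y`. -/
theorem toChain_projectionTerms {t : List SL(2, ℤ)} (ht : t ≠ []) :
    toChain ((projectionTerms t).map fun p => transformTerms p.1.1 (p.1.2 * ·) (y p.2)).flatten =
      chainExtension y (faces (1 :: t)) := by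
  cases t with
  | nil => exact absurd rfl ht
  | cons g t =>
    rw [toChain_flatten, projectionTerms, List.map_cons, List.map_cons, List.sum_cons,
      toChain_transformTerms, faces, map_sub, chainExtension_single, tupleExtension, one_smul,
      sub_eq_add_neg]
    congr 1
    have : -chainExtension y (chainCons 1 (faces (g :: t))) =
        (-(chainExtension y ∘ₗ chainCons 1)) (faces (g :: t)) := rfl
    rw [this, ← toChain_faceTerms, map_toChain, List.map_map, List.map_map]
    congr 1
    refine List.map_congr_left fun p _ => ?_
    simp only [Function.comp_apply, toChain_transformTerms, chainMap_mul_one, LinearMap.neg_apply,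
      LinearMap.comp_apply, chainCons_single, chainExtension_single, tupleExtension_one_cons,
      neg_smul, smul_neg]

theorem Primrec.projectionTerms : Primrec projectionTerms := by
  refine (Primrec.list_casesOn (f := fun t : List SL(2, ℤ) => t) (g := fun _ => [])
    (h := fun t q => ((1, q.1), q.2.map (q.1⁻¹ * ·)) ::
      (_root_.faceTerms t).map fun p => ((-p.1, 1), p.2))
    Primrec.id (Primrec.const []) ?_).of_eq fun t => by cases t <;> rfl
  have hg : Primrec fun q : List SL(2, ℤ) × (SL(2, ℤ) × List SL(2, ℤ)) => q.2.1 :=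
    Primrec.fst.comp Primrec.snd
  refine Primrec.list_cons.comp (Primrec.pair (Primrec.pair (Primrec.const 1) hg)
    (Primrec.list_map (Primrec.snd.comp Primrec.snd) ?_)) (Primrec.list_map
      (Primrec.faceTerms.comp Primrec.fst) ?_)
  · exact Primrec.sl_mul.comp (Primrec.sl_inv.comp (hg.comp Primrec.fst)) Primrec.snd
  · exact Primrec.pair (Primrec.pair (Primrec.int_neg.comp (Primrec.fst.comp Primrec.snd))
      (Primrec.const 1)) (Primrec.snd.comp Primrec.snd)

theorem chainExtension_eq_self {c : List SL(2, ℤ) →₀ ℤ}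
    (hc : c ∈ Finsupp.supported ℤ ℤ (cliques ellipticRel ∩
      {t | ∀ g u, t = g :: u → IsProjectionAt y (u.map (g⁻¹ * ·))})) :
    chainExtension y c = c := by
  obtain ⟨z, rfl, hz⟩ := exists_toChain_eq hc
  rw [map_toChain, toChain]
  congr 1
  refine List.map_congr_left fun p hp => ?_
  obtain ⟨h1, h2⟩ := hz p hp
  obtain ⟨a, t⟩ := p
  have : tupleExtension y t = Finsupp.single t 1 := by
    cases t with
    | nil => rfl
    | cons g u => exact tupleExtension_clique (h2 g u rfl) h1
  dsimp only
  rw [chainExtension_single, this, Finsupp.smul_single, smul_eq_mul, mul_one]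

/-- There is a computable equivariant chain map that projects the complex of all tuples onto the
complex of cliques. -/
theorem exists_computable_projection :
    ∃ y : List SL(2, ℤ) → List (ℤ × List SL(2, ℤ)), Computable y ∧ ∀ t, IsProjectionAt y t := by
  classical
  obtain ⟨F, hF, hFspec⟩ := exists_partrec_filling
  let value : Code → (ℤ × SL(2, ℤ)) × List SL(2, ℤ) → Part (List (ℤ × List SL(2, ℤ))) := fun c p =>
    (c.eval (Encodable.encode p.2)).map fun n => transformTerms p.1.1 (p.1.2 * ·)
      ((Encodable.decode (α := List (ℤ × List SL(2, ℤ))) n).getD [])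
  -- One step of the recursion: cliques are left unchanged, and for any other tuple the boundary
  -- equation prescribes the cycle to be filled, in terms of the values that the program `c` gives
  -- at shorter tuples.
  let body : Code → List SL(2, ℤ) → Part (List (ℤ × List SL(2, ℤ))) := fun c t =>
    cond (decide (1 :: t ∈ cliques ellipticRel)) (Part.some [(1, 1 :: t)])
      ((partMap (value c) (projectionTerms t)).bind fun l => F l.flatten)
  have hgetD : Primrec fun n : ℕ =>
      (Encodable.decode (α := List (ℤ × List SL(2, ℤ))) n).getD [] :=
    Primrec.option_getD.comp Primrec.decode (Primrec.const [])
  have hvalue : Partrec₂ value := by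
    refine Partrec.map (Code.eval_part.comp Computable.fst (Computable.encode.comp
      (Computable.snd.comp Computable.snd))) (Primrec₂.to_comp ?_)
    refine Primrec.transformTerms (a := fun q : (Code × (ℤ × SL(2, ℤ)) × List SL(2, ℤ)) × ℕ =>
      q.1.2.1.1) (f := fun q x => q.1.2.1.2 * x) ?_ ?_ (hgetD.comp Primrec.snd)
    · exact Primrec.fst.comp (Primrec.fst.comp (Primrec.snd.comp Primrec.fst))
    · exact Primrec.sl_mul.comp (Primrec.snd.comp (Primrec.fst.comp (Primrec.snd.comp
        (Primrec.fst.comp Primrec.fst)))) Primrec.snd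
  have hone : Primrec fun q : Code × List SL(2, ℤ) => (1 : SL(2, ℤ)) :: q.2 :=
    Primrec.list_cons.comp (Primrec.const 1) Primrec.snd
  have hbody : Partrec₂ body := by
    refine Partrec.cond (Primrec.to_comp (PrimrecPred.mem_cliques.decide.comp hone)) ?_ ?_
    · exact Computable.partrec (Primrec.to_comp (Primrec.list_cons.comp
        (Primrec.pair (Primrec.const 1) hone) (Primrec.const [])))
    · refine Partrec.bind (Partrec.partMap (f := fun q : Code × List SL(2, ℤ) => value q.1)
        (hvalue.comp (Computable.fst.comp Computable.fst) Computable.snd)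
        (Primrec.to_comp (Primrec.projectionTerms.comp Primrec.snd))) ?_
      exact hF.comp (Primrec.to_comp (Primrec.list_flatten.comp Primrec.snd))
  have hdec : Computable fun n : ℕ => (Encodable.decode (α := List SL(2, ℤ)) n).getD [] :=
    Primrec.to_comp (Primrec.option_getD.comp Primrec.decode (Primrec.const []))
  -- The second recursion theorem provides a program that may call itself. This is needed because
  -- the recursive calls go to translates and faces of the tuple and not only to its tail.
  obtain ⟨c, hc⟩ := Code.fixed_point₂ (f := fun c n =>
    (body c ((Encodable.decode (α := List SL(2, ℤ)) n).getD [])).map Encodable.encode)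
    (Partrec.map (hbody.comp Computable.fst (hdec.comp Computable.snd))
      (Computable.encode.comp Computable.snd))
  have heval : ∀ t, c.eval (Encodable.encode t) = (body c t).map Encodable.encode := fun t => by
    rw [hc]
    dsimp only
    rw [Encodable.encodek]
    rfl
  let y : List SL(2, ℤ) → List (ℤ × List SL(2, ℤ)) := fun t =>
    if h : (body c t).Dom then (body c t).get h else []
  have hy : ∀ t z, body c t = Part.some z → y t = z := fun t z h => by
    have hd : (body c t).Dom := by rw [h]; trivial
    exact (dif_pos hd).trans (Part.get_eq_of_mem (Part.eq_some_iff.1 h) hd)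
  have key : ∀ n t, t.length = n → body c t = Part.some (y t) ∧ IsProjectionAt y t := by
    intro n
    induction n using Nat.strong_induction_on with
    | _ n ih =>
    intro t ht
    have ih' : ∀ u : List SL(2, ℤ), u.length + 1 = n → IsProjectionAt y u := fun u hu =>
      (ih u.length (by omega) u rfl).2
    by_cases hcl : 1 :: t ∈ cliques ellipticRel
    · have hb : body c t = Part.some [(1, 1 :: t)] := by
        dsimp only [body]
        rw [decide_eq_true hcl, cond_true]
      have hyt := hy t _ hb
      refine ⟨by rw [hyt, hb], ?_, fun _ => hyt, ?_⟩
      · rw [hyt]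
        exact toChain_mem_supported (by simpa using hcl)
      · rw [hyt, toChain_cons, toChain_nil, add_zero, chainBoundary_single, one_smul,
          chainExtension_eq_self]
        refine chain_supported_mono (faces_mem_supported (1 :: t)) fun u hu =>
          ⟨mem_cliques_of_sublist hcl hu.1, ?_⟩
        rintro g v rfl
        have := hu.2
        simp only [List.length_cons] at this
        exact ih' _ (by rw [List.length_map]; omega)
    -- The tuple `[1]` is a clique, so the case of the empty `t` has been dealt with already.
    · have hne : t ≠ [] := by
        rintro rfl
        refine hcl ⟨true, fun x hx z hz => ?_⟩
        rw [List.mem_singleton.1 hx, List.mem_singleton.1 hz]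
        exact (ellipticRel_equivalence true).refl 1
      have hpm : partMap (value c) (projectionTerms t) = Part.some ((projectionTerms t).map
          fun p => transformTerms p.1.1 (p.1.2 * ·) (y p.2)) := by
        refine partMap_eq fun p hp => ?_
        have h1 := projectionTerms_length t p hp
        dsimp only [value]
        rw [heval, (ih _ (by omega) p.2 rfl).1, Part.map_some, Part.map_some, Encodable.encodek]
        rfl
      obtain ⟨k, hk⟩ : ∃ k, n = k + 1 := ⟨n - 1, by
        have := List.length_pos_iff.2 hne
        omega⟩
      have hsup : faces (1 :: t) ∈ Finsupp.supported ℤ ℤ {u | u.length = k + 1} :=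
        chain_supported_mono (faces_mem_supported (1 :: t)) fun u hu => by
          have := hu.2
          simp only [List.length_cons] at this
          change u.length = k + 1
          omega
      have hrhs := toChain_projectionTerms (y := y) hne
      -- By the conditions for tuples of length one less, the prescribed chain consists of cliques
      -- and is a cycle, being the image of the boundary of `1 :: t`.
      obtain ⟨z, hz, hz1, hz2⟩ := hFspec ((projectionTerms t).map fun p =>
          transformTerms p.1.1 (p.1.2 * ·) (y p.2)).flatten (by
            rw [hrhs]
            obtain ⟨w, hw, hws⟩ := exists_toChain_eq hsup
            rw [← hw, map_toChain]
            refine list_sum_mem fun x hx => ?_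
            obtain ⟨p, hp, rfl⟩ := List.mem_map.1 hx
            refine Submodule.smul_mem _ _ ?_
            rw [chainExtension_single]
            have hl := hws p hp
            obtain ⟨a, u⟩ := p
            cases u with
            | nil => simp at hl
            | cons g u => exact tupleExtension_mem (ih' _ (by
                rw [List.length_map, hk]
                simpa using hl))) (by
            rw [hrhs, chainExtension_boundary (fun u hu => ih' u (by omega)) hsup,
              chainBoundary_faces, map_zero])
      have hb : body c t = Part.some z := by
        dsimp only [body]
        rw [decide_eq_false hcl, cond_false, hpm, Part.bind_some, hz]
      have hyt := hy t _ hb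
      exact ⟨by rw [hyt, hb], by rwa [hyt], fun h => absurd h hcl, by rw [hyt, hz2, hrhs]⟩
  refine ⟨y, ?_, fun t => (key _ t rfl).2⟩
  exact Partrec.of_eq_tot (hbody.comp (Computable.const c) Computable.id) fun t =>
    Part.eq_some_iff.1 (key _ t rfl).1

theorem chainExtension_chainBoundary (h : ∀ t, IsProjectionAt y t) (c : List SL(2, ℤ) →₀ ℤ) :
    chainBoundary (chainExtension y c) = chainExtension y (chainBoundary c) := by
  have : chainBoundary ∘ₗ chainExtension y = chainExtension y ∘ₗ chainBoundary := by
    refine chain_hom_ext fun t => ?_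
    simp only [LinearMap.comp_apply, chainExtension_single, chainBoundary_single, one_smul]
    cases t with
    | nil => simp [tupleExtension, chainBoundary_single, faces]
    | cons g t => exact tupleExtension_boundary (h _)
  exact LinearMap.congr_fun this c

theorem chainExtension_mem (h : ∀ t, IsProjectionAt y t) (c : List SL(2, ℤ) →₀ ℤ) :
    chainExtension y c ∈ Finsupp.supported ℤ ℤ (cliques ellipticRel) := by
  rw [chainExtension, Finsupp.linearCombination_apply, Finsupp.sum]
  refine Submodule.sum_mem _ fun t _ => Submodule.smul_mem _ _ ?_
  cases t with
  | nil => exact Finsupp.single_mem_supported ℤ _ ⟨true, by simp⟩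
  | cons g t => exact tupleExtension_mem (h _)

theorem chainExtension_of_mem (h : ∀ t, IsProjectionAt y t) {c : List SL(2, ℤ) →₀ ℤ}
    (hc : c ∈ Finsupp.supported ℤ ℤ (cliques ellipticRel)) : chainExtension y c = c :=
  chainExtension_eq_self (chain_supported_mono hc fun _ ht => ⟨ht, fun _ _ _ => h _⟩)

end CliqueProjection

/-! ### Presentations of homology that are certified by matrix identities. -/

section HomologyCertificate

/-- The image of `β` is a submodule of a free `ℤ`-module, hence projective, so its kernel is a
direct summand. The complementary projection factors through `β` as a map on the image only; after
multiplication by a suitable `N` the factor extends to all of `ℤᶜ`. The resulting equation is a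
matrix identity from which it follows that `P` fixes cycles. -/
theorem exists_integral_projection {b c : ℕ} (β : (Fin b → ℤ) →ₗ[ℤ] (Fin c → ℤ)) :
    ∃ (P : (Fin b → ℤ) →ₗ[ℤ] LinearMap.ker β) (K : (Fin c → ℤ) →ₗ[ℤ] (Fin b → ℤ)) (N : ℕ),
      N ≠ 0 ∧ (∀ x : LinearMap.ker β, P x = x) ∧
        ∀ x, (N : ℤ) • (x - (P x : Fin b → ℤ)) = K (β x) := by
  classical
  obtain ⟨σ, hσ⟩ := Module.projective_lifting_property β.rangeRestrict
    (LinearMap.id : LinearMap.range β →ₗ[ℤ] LinearMap.range β) β.surjective_rangeRestrict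
  have hσ' : ∀ x, β (σ (β.rangeRestrict x)) = β x := fun x =>
    congrArg Subtype.val (LinearMap.congr_fun hσ (β.rangeRestrict x))
  have hker : ∀ x, ((LinearMap.id : (Fin b → ℤ) →ₗ[ℤ] (Fin b → ℤ)) - σ ∘ₗ β.rangeRestrict) x ∈
      LinearMap.ker β := fun x => by
    rw [LinearMap.mem_ker, LinearMap.sub_apply, map_sub]
    exact sub_eq_zero.2 (hσ' x).symm
  obtain ⟨n, s⟩ := Submodule.smithNormalForm (Pi.basisFun ℤ (Fin c)) (LinearMap.range β)
  have ha : ∀ i, s.a i ≠ 0 := fun i h => by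
    have h1 := s.snf i
    rw [h, zero_smul] at h1
    exact s.bN.ne_zero i (Subtype.ext h1)
  let N : ℤ := ∏ i, s.a i
  have hN : N ≠ 0 := Finset.prod_ne_zero_iff.2 fun i _ => ha i
  -- In a basis adapted to the image, the `i`-th basis vector of the image is `s.a i` times one of
  -- the ambient basis. So `N • σ` extends, the factor being the product of the other divisors.
  let K : (Fin c → ℤ) →ₗ[ℤ] (Fin b → ℤ) := s.bM.constr ℤ fun j =>
    if h : ∃ i, s.f i = j then (∏ i ∈ Finset.univ.erase h.choose, s.a i) • σ (s.bN h.choose) else 0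
  have hK : K ∘ₗ (LinearMap.range β).subtype = N • σ := by
    refine s.bN.ext fun i => ?_
    have hex : ∃ i', s.f i' = s.f i := ⟨i, rfl⟩
    have hch : hex.choose = i := s.f.injective hex.choose_spec
    rw [LinearMap.comp_apply, Submodule.subtype_apply, s.snf, map_smul, LinearMap.smul_apply]
    dsimp only [K]
    rw [Module.Basis.constr_basis, dif_pos hex, hch, smul_smul,
      Finset.mul_prod_erase _ _ (Finset.mem_univ i)]
  -- The product of the divisors may be negative; its sign is moved into `K` to obtain a natural
  -- number.
  refine ⟨LinearMap.codRestrict _ _ hker, N.sign • K, N.natAbs, Int.natAbs_ne_zero.2 hN,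
    fun x => ?_, fun x => ?_⟩
  · have hz : β.rangeRestrict x = 0 := Subtype.ext x.2
    refine Subtype.ext ?_
    rw [LinearMap.codRestrict_apply, LinearMap.sub_apply, LinearMap.comp_apply, hz, map_zero]
    exact sub_zero _
  · have h1 : K (β x) = N • σ (β.rangeRestrict x) := LinearMap.congr_fun hK (β.rangeRestrict x)
    rw [LinearMap.smul_apply, h1, smul_smul, Int.sign_mul_self_eq_natAbs,
      LinearMap.codRestrict_apply]
    congr 1
    exact sub_sub_cancel _ _

/-- The homology of a complex `ℤᵃ → ℤᵇ → ℤᶜ` has a presentation that is certified by matrix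
identities. -/
theorem exists_homology_presentation {a b c : ℕ} (A : Matrix (Fin b) (Fin a) ℤ)
    (B : Matrix (Fin c) (Fin b) ℤ) (hBA : B * A = 0) :
    ∃ (r : ℕ) (d : Fin r → ℕ) (E : Matrix (Fin b) (Fin r) ℤ) (Q : Matrix (Fin r) (Fin b) ℤ)
      (R : Matrix (Fin a) (Fin r) ℤ) (Y : Matrix (Fin r) (Fin a) ℤ) (K : Matrix (Fin b) (Fin c) ℤ)
      (N : ℕ), N ≠ 0 ∧ B * E = 0 ∧ (∀ i j, E i j * d j = (A * R) i j) ∧ Q * E = 1 ∧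
        (∀ i j, (Q * A) i j = d i * Y i j) ∧ (N : ℤ) • (1 - E * Q) = K * B := by
  classical
  obtain ⟨P, K, N, hN, hP, hK⟩ := exists_integral_projection (Matrix.toLin' B)
  let kr := LinearMap.ker (Matrix.toLin' B)
  -- The boundaries inside the module of cycles; a Smith basis for this inclusion presents the
  -- homology.
  let I : Submodule ℤ kr := (LinearMap.range (Matrix.toLin' A)).comap kr.subtype
  obtain ⟨n, s⟩ := Submodule.smithNormalForm (Module.finBasis ℤ kr) I
  let r := Module.finrank ℤ kr
  -- Basis vectors of the cycles that no divisor belongs to span the free part of the homology, so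
  -- their invariant is `0`.
  let dz : Fin r → ℤ := fun j => if h : ∃ i, s.f i = j then s.a h.choose else 0
  have hdz : ∀ i, dz (s.f i) = s.a i := fun i => by
    have hex : ∃ i', s.f i' = s.f i := ⟨i, rfl⟩
    dsimp only [dz]
    rw [dif_pos hex, s.f.injective hex.choose_spec]
  have hI : ∀ j, dz j • s.bM j ∈ I := fun j => by
    by_cases h : ∃ i, s.f i = j
    · obtain ⟨i, rfl⟩ := h
      rw [hdz, ← s.snf]
      exact (s.bN i).2
    · dsimp only [dz]
      rw [dif_neg h, zero_smul]
      exact I.zero_mem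
  have hrepr : ∀ x ∈ I, ∀ j, dz j ∣ s.bM.repr x j := fun x hx j => by
    have hx' : x = ∑ i, s.bN.repr ⟨x, hx⟩ i • dz (s.f i) • s.bM (s.f i) := by
      have := congrArg Subtype.val (s.bN.sum_repr ⟨x, hx⟩)
      rw [AddSubmonoidClass.coe_finsetSum] at this
      refine this.symm.trans (Finset.sum_congr rfl fun i _ => ?_)
      rw [hdz, ← s.snf]
      rfl
    rw [hx', map_sum, Finsupp.finsetSum_apply]
    refine Finset.dvd_sum fun i _ => ?_
    rw [map_smul, map_smul, Module.Basis.repr_self, Finsupp.smul_apply, Finsupp.smul_apply,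
      Finsupp.single_apply, smul_eq_mul, smul_eq_mul]
    split_ifs with h
    · rw [h, mul_one]; exact dvd_mul_left _ _
    · simp
  let Elin : (Fin r → ℤ) →ₗ[ℤ] (Fin b → ℤ) := kr.subtype ∘ₗ s.bM.equivFun.symm.toLinearMap
  let Qlin : (Fin b → ℤ) →ₗ[ℤ] (Fin r → ℤ) := s.bM.equivFun.toLinearMap ∘ₗ P
  have hE : ∀ j, Elin (Pi.single j 1) = s.bM j := fun j => by
    simp [Elin]
  have hR : ∀ j, ∃ u, Matrix.toLin' A u = (((dz j).natAbs : ℕ) : ℤ) • (s.bM j : Fin b → ℤ) :=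
    fun j => by
      -- The divisors of the Smith form can be negative. Passing to absolute values changes the
      -- preimage `u` by a sign.
      obtain ⟨u, hu⟩ := hI j
      rcases Int.natAbs_eq (dz j) with h | h
      · refine ⟨u, hu.trans ?_⟩
        rw [← h]
        rfl
      · refine ⟨-u, ?_⟩
        rw [map_neg, hu, show (((dz j).natAbs : ℕ) : ℤ) = -dz j by omega, neg_smul]
        rfl
  choose R hR using hR
  have hY : ∀ i j, ∃ y, (LinearMap.toMatrix' Qlin * A) i j = ((dz i).natAbs : ℕ) * y := fun i j => by
    have h1 : (LinearMap.toMatrix' Qlin * A) i j = Qlin (Matrix.toLin' A (Pi.single j 1)) i := by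
      rw [← LinearMap.toMatrix'_toLin' A, ← LinearMap.toMatrix'_comp, LinearMap.toMatrix'_apply]
      simp
    have h2 : Matrix.toLin' A (Pi.single j 1) ∈ kr := by
      rw [LinearMap.mem_ker, ← LinearMap.comp_apply, ← Matrix.toLin'_mul, hBA]
      simp
    rw [h1]
    refine (Int.natAbs_dvd).2 ?_
    have h3 : P (Matrix.toLin' A (Pi.single j 1)) = ⟨_, h2⟩ := hP ⟨_, h2⟩
    change dz i ∣ s.bM.equivFun (P (Matrix.toLin' A (Pi.single j 1))) i
    rw [h3, Module.Basis.equivFun_apply]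
    exact hrepr _ ⟨_, rfl⟩ i
  choose Y hY using hY
  refine ⟨r, fun j => (dz j).natAbs, LinearMap.toMatrix' Elin, LinearMap.toMatrix' Qlin,
    Matrix.of fun i j => R j i, Matrix.of Y, LinearMap.toMatrix' K, N, hN, ?_, fun i j => ?_, ?_,
    hY, ?_⟩
  · rw [← LinearMap.toMatrix'_toLin' B, ← LinearMap.toMatrix'_comp]
    have : Matrix.toLin' B ∘ₗ Elin = 0 := LinearMap.ext fun v =>
      (s.bM.equivFun.symm v).2
    rw [this, map_zero]
  · have := congrFun (hR j) i
    rw [Matrix.toLin'_apply] at this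
    rw [LinearMap.toMatrix'_apply]
    rw [Matrix.mul_apply]
    change _ = ∑ k, A i k * R j k
    rw [show ∑ k, A i k * R j k = (A.mulVec (R j)) i from rfl, this, hE, Pi.smul_apply, smul_eq_mul,
      mul_comm]
  · rw [← LinearMap.toMatrix'_comp, ← LinearMap.toMatrix'_id]
    congr 1
    refine LinearMap.ext fun v => ?_
    change s.bM.equivFun (P (s.bM.equivFun.symm v : kr)) = v
    rw [hP, LinearEquiv.apply_symm_apply]
  · have : (N : ℤ) • (LinearMap.id - Elin ∘ₗ Qlin) = K ∘ₗ Matrix.toLin' B := by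
      refine LinearMap.ext fun x => ?_
      have := hK x
      simp only [LinearMap.smul_apply, LinearMap.sub_apply, LinearMap.comp_apply] at this ⊢
      rw [← this]
      simp [Elin, Qlin]
    rw [← LinearMap.toMatrix'_comp, ← LinearMap.toMatrix'_id, ← map_sub, ← map_smul, this,
      LinearMap.toMatrix'_comp, LinearMap.toMatrix'_toLin']

end HomologyCertificate

/-! ### Search for certified presentations of homology. -/

section MatrixSearch

/-- An entry of a matrix that is given as a list of rows. -/
def listEntry (M : List (List ℤ)) (i j : ℕ) : ℤ := (M.getD i []).getD j 0

/-- An entry of a product of matrices that are given as lists of rows. -/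
def listMulEntry (n : ℕ) (M M' : List (List ℤ)) (i j : ℕ) : ℤ :=
  ∑ k ∈ Finset.range n, listEntry M i k * listEntry M' k j

/-- The matrix with the given list of rows. -/
def listMatrix (m n : ℕ) (M : List (List ℤ)) : Matrix (Fin m) (Fin n) ℤ :=
  Matrix.of fun i j => listEntry M i j

theorem listMatrix_apply {m n : ℕ} (M : List (List ℤ)) (i : Fin m) (j : Fin n) :
    listMatrix m n M i j = listEntry M i j := rfl

theorem listMatrix_mul {m n l : ℕ} (M M' : List (List ℤ)) (i : Fin m) (j : Fin l) :
    (listMatrix m n M * listMatrix n l M') i j = listMulEntry n M M' i j := by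
  rw [Matrix.mul_apply, listMulEntry, Finset.sum_range]
  rfl

theorem listEntry_ofFn {m n : ℕ} (M : Fin m → Fin n → ℤ) (i : Fin m) (j : Fin n) :
    listEntry (List.ofFn fun i => List.ofFn (M i)) i j = M i j := by
  simp [listEntry, List.getD_eq_getElem?_getD]

theorem listMatrix_ofFn {m n : ℕ} (M : Matrix (Fin m) (Fin n) ℤ) :
    listMatrix m n (List.ofFn fun i => List.ofFn (M i)) = M := by
  ext i j
  exact listEntry_ofFn M i j

variable {α : Type*} [Primcodable α]

theorem Primrec.listEntry {M : α → List (List ℤ)} {i j : α → ℕ} (hM : Primrec M) (hi : Primrec i)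
    (hj : Primrec j) : Primrec fun q => listEntry (M q) (i q) (j q) :=
  (Primrec.list_getD 0).comp ((Primrec.list_getD []).comp hM hi) hj

theorem Primrec.listMulEntry {n : α → ℕ} {M M' : α → List (List ℤ)} {i j : α → ℕ} (hn : Primrec n)
    (hM : Primrec M) (hM' : Primrec M') (hi : Primrec i) (hj : Primrec j) :
    Primrec fun q => listMulEntry (n q) (M q) (M' q) (i q) (j q) := by
  refine Primrec.sum_range hn (Primrec.int_mul.comp ?_ ?_)
  · exact Primrec.listEntry (hM.comp Primrec.fst) (hi.comp Primrec.fst) Primrec.snd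
  · exact Primrec.listEntry (hM'.comp Primrec.fst) Primrec.snd (hj.comp Primrec.fst)

theorem PrimrecPred.entries_eq {m n : α → ℕ} {f g : (α × ℕ) × ℕ → ℤ} (hm : Primrec m)
    (hn : Primrec n) (hf : Primrec f) (hg : Primrec g) :
    PrimrecPred fun q => ∀ i < m q, ∀ j < n q, f ((q, i), j) = g ((q, i), j) :=
  PrimrecPred.forall_range hm (PrimrecPred.primrecRel
    (p := fun s : α × ℕ => ∀ j < n s.1, f (s, j) = g (s, j))
    (PrimrecPred.forall_range (hn.comp Primrec.fst) (Primrec.eq.comp hf hg)))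

/-- A presentation of the homology of `ℤᵃ → ℤᵇ → ℤᶜ`: the columns of `E` are cycles that generate
the homology with the relations `dᵢ eᵢ = 0`, and `Q` gives the coordinates of a cycle. -/
structure IsHomologyPresentation {a b c : ℕ} (A : Matrix (Fin b) (Fin a) ℤ)
    (B : Matrix (Fin c) (Fin b) ℤ) {r : ℕ} (d : Fin r → ℕ) (E : Matrix (Fin b) (Fin r) ℤ)
    (Q : Matrix (Fin r) (Fin b) ℤ) : Prop where
  cycle : ∀ v, B.mulVec (E.mulVec v) = 0
  boundary_iff : ∀ v, (∃ u, E.mulVec v = A.mulVec u) ↔ ∀ i, (d i : ℤ) ∣ v i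
  coordinates : ∀ w, B.mulVec w = 0 → E.mulVec (Q.mulVec w) = w

/-- A boundary `E v = A u` has `v = Q A u` by `Q * E = 1`, so `Y` shows the divisibilities to be
necessary, and `R` shows them to be sufficient. On a cycle `w` the right side of `hK` vanishes, and
the nonzero factor `N` can be cancelled in the torsion-free module. -/
theorem IsHomologyPresentation.of_certificate {a b c r : ℕ} {A : Matrix (Fin b) (Fin a) ℤ}
    {B : Matrix (Fin c) (Fin b) ℤ} {d : Fin r → ℕ} {E : Matrix (Fin b) (Fin r) ℤ}
    {Q : Matrix (Fin r) (Fin b) ℤ} {R : Matrix (Fin a) (Fin r) ℤ} {Y : Matrix (Fin r) (Fin a) ℤ}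
    {K : Matrix (Fin b) (Fin c) ℤ} {N : ℕ} (hN : N ≠ 0) (hBE : B * E = 0)
    (hR : ∀ i j, E i j * d j = (A * R) i j) (hQE : Q * E = 1)
    (hY : ∀ i j, (Q * A) i j = d i * Y i j) (hK : (N : ℤ) • (1 - E * Q) = K * B) :
    IsHomologyPresentation A B d E Q where
  cycle v := by rw [Matrix.mulVec_mulVec, hBE, Matrix.zero_mulVec]
  boundary_iff v := by
    constructor
    · rintro ⟨u, hu⟩ i
      have h1 : v = (Q * A).mulVec u := by
        rw [← Matrix.mulVec_mulVec, ← hu, Matrix.mulVec_mulVec, hQE, Matrix.one_mulVec]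
      rw [h1, Matrix.mulVec, dotProduct]
      refine Finset.dvd_sum fun j _ => ?_
      rw [hY, mul_assoc]
      exact dvd_mul_right _ _
    · intro h
      choose u hu using h
      refine ⟨R.mulVec u, ?_⟩
      rw [Matrix.mulVec_mulVec]
      funext i
      change ∑ j, E i j * v j = ∑ j, (A * R) i j * u j
      refine Finset.sum_congr rfl fun j _ => ?_
      rw [← hR, hu, mul_assoc]
  coordinates w hw := by
    have h : (N : ℤ) • (w - E.mulVec (Q.mulVec w)) = 0 := by
      have : ((N : ℤ) • (1 - E * Q)).mulVec w = (K * B).mulVec w := by rw [hK]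
      rw [← Matrix.mulVec_mulVec, hw, Matrix.mulVec_zero, Matrix.smul_mulVec, Matrix.sub_mulVec,
        Matrix.one_mulVec, ← Matrix.mulVec_mulVec] at this
      exact this
    rcases smul_eq_zero.1 h with h | h
    · exact absurd h (by exact_mod_cast hN)
    · exact (sub_eq_zero.1 h).symm

/-- The certificate `((d, N), [E, Q, R, Y, K])` satisfies the matrix identities that make it a
presentation of the homology of the complex given by the dimensions and matrices `((a, b, c), A, B)`.
-/
def IsPresentationCertificate (s : (ℕ × ℕ × ℕ) × List (List ℤ) × List (List ℤ))
    (t : (List ℕ × ℕ) × List (List (List ℤ))) : Prop :=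
  t.1.2 ≠ 0 ∧
  (∀ i < s.1.2.2, ∀ j < t.1.1.length, listMulEntry s.1.2.1 s.2.2 (t.2.getD 0 []) i j = 0) ∧
  (∀ i < s.1.2.1, ∀ j < t.1.1.length, listEntry (t.2.getD 0 []) i j * (t.1.1.getD j 0 : ℕ) =
    listMulEntry s.1.1 s.2.1 (t.2.getD 2 []) i j) ∧
  (∀ i < t.1.1.length, ∀ j < t.1.1.length,
    listMulEntry s.1.2.1 (t.2.getD 1 []) (t.2.getD 0 []) i j = if i = j then 1 else 0) ∧
  (∀ i < t.1.1.length, ∀ j < s.1.1, listMulEntry s.1.2.1 (t.2.getD 1 []) s.2.1 i j =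
    (t.1.1.getD i 0 : ℕ) * listEntry (t.2.getD 3 []) i j) ∧
  (∀ i < s.1.2.1, ∀ j < s.1.2.1, (t.1.2 : ℤ) * ((if i = j then 1 else 0) -
    listMulEntry t.1.1.length (t.2.getD 0 []) (t.2.getD 1 []) i j) =
      listMulEntry s.1.2.2 (t.2.getD 4 []) s.2.2 i j)

theorem PrimrecRel.isPresentationCertificate : PrimrecRel IsPresentationCertificate := by
  let α := ((ℕ × ℕ × ℕ) × List (List ℤ) × List (List ℤ)) ×
    ((List ℕ × ℕ) × List (List (List ℤ)))
  have ha : Primrec fun q : α => q.1.1.1 := Primrec.fst.comp (Primrec.fst.comp Primrec.fst)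
  have hb : Primrec fun q : α => q.1.1.2.1 :=
    Primrec.fst.comp (Primrec.snd.comp (Primrec.fst.comp Primrec.fst))
  have hc : Primrec fun q : α => q.1.1.2.2 :=
    Primrec.snd.comp (Primrec.snd.comp (Primrec.fst.comp Primrec.fst))
  have hA : Primrec fun q : α => q.1.2.1 := Primrec.fst.comp (Primrec.snd.comp Primrec.fst)
  have hB : Primrec fun q : α => q.1.2.2 := Primrec.snd.comp (Primrec.snd.comp Primrec.fst)
  have hd : Primrec fun q : α => q.2.1.1 := Primrec.fst.comp (Primrec.fst.comp Primrec.snd)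
  have hN : Primrec fun q : α => q.2.1.2 := Primrec.snd.comp (Primrec.fst.comp Primrec.snd)
  have hM : ∀ n, Primrec fun q : α => q.2.2.getD n [] := fun n =>
    (Primrec.list_getD []).comp (Primrec.snd.comp Primrec.snd) (Primrec.const n)
  have hr : Primrec fun q : α => q.2.1.1.length := Primrec.list_length.comp hd
  have hq : Primrec fun p : (α × ℕ) × ℕ => p.1.1 := Primrec.fst.comp Primrec.fst
  have hi : Primrec fun p : (α × ℕ) × ℕ => p.1.2 := Primrec.snd.comp Primrec.fst
  have hj : Primrec fun p : (α × ℕ) × ℕ => p.2 := Primrec.snd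
  have hδ : Primrec fun p : (α × ℕ) × ℕ => if p.1.2 = p.2 then (1 : ℤ) else 0 :=
    Primrec.ite (Primrec.eq.comp hi hj) (Primrec.const 1) (Primrec.const 0)
  have hD : ∀ {k : (α × ℕ) × ℕ → ℕ}, Primrec k →
      Primrec fun p : (α × ℕ) × ℕ => ((p.1.1.2.1.1.getD (k p) 0 : ℕ) : ℤ) := fun hk =>
    Primrec.int_natCast.comp ((Primrec.list_getD 0).comp (hd.comp hq) hk)
  refine PrimrecPred.and ?_ (PrimrecPred.and ?_ (PrimrecPred.and ?_ (PrimrecPred.and ?_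
    (PrimrecPred.and ?_ ?_))))
  · exact PrimrecPred.not (Primrec.eq.comp hN (Primrec.const 0))
  · exact PrimrecPred.entries_eq hc hr (Primrec.listMulEntry (hb.comp hq) (hB.comp hq)
      ((hM 0).comp hq) hi hj) (Primrec.const 0)
  · exact PrimrecPred.entries_eq hb hr
      (Primrec.int_mul.comp (Primrec.listEntry ((hM 0).comp hq) hi hj) (hD hj))
      (Primrec.listMulEntry (ha.comp hq) (hA.comp hq) ((hM 2).comp hq) hi hj)
  · exact PrimrecPred.entries_eq hr hr (Primrec.listMulEntry (hb.comp hq) ((hM 1).comp hq)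
      ((hM 0).comp hq) hi hj) hδ
  · exact PrimrecPred.entries_eq hr ha (Primrec.listMulEntry (hb.comp hq) ((hM 1).comp hq)
      (hA.comp hq) hi hj)
      (Primrec.int_mul.comp (hD hi) (Primrec.listEntry ((hM 3).comp hq) hi hj))
  · exact PrimrecPred.entries_eq hb hb
      (Primrec.int_mul.comp (Primrec.int_natCast.comp (hN.comp hq)) (Primrec.int_sub.comp hδ
        (Primrec.listMulEntry (hr.comp hq) ((hM 0).comp hq) ((hM 1).comp hq) hi hj)))
      (Primrec.listMulEntry (hc.comp hq) ((hM 4).comp hq) (hB.comp hq) hi hj)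

theorem IsPresentationCertificate.isHomologyPresentation {a b c N : ℕ} {A B : List (List ℤ)}
    {d : List ℕ} {M : List (List (List ℤ))}
    (h : IsPresentationCertificate ((a, b, c), A, B) ((d, N), M)) :
    IsHomologyPresentation (listMatrix b a A) (listMatrix c b B) d.get
      (listMatrix b d.length (M.getD 0 [])) (listMatrix d.length b (M.getD 1 [])) := by
  obtain ⟨hN, h1, h2, h3, h4, h5⟩ := h
  have hd : ∀ i : Fin d.length, d.getD i 0 = d.get i := fun i => by simp
  refine IsHomologyPresentation.of_certificate (R := listMatrix a d.length (M.getD 2 []))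
    (Y := listMatrix d.length a (M.getD 3 [])) (K := listMatrix b c (M.getD 4 [])) hN ?_
    (fun i j => ?_) ?_ (fun i j => ?_) ?_
  · ext i j
    rw [listMatrix_mul]
    exact h1 i i.2 j j.2
  · rw [listMatrix_mul, ← hd]
    exact h2 i i.2 j j.2
  · ext i j
    rw [listMatrix_mul, Matrix.one_apply]
    refine (h3 i i.2 j j.2).trans ?_
    simp only [Fin.ext_iff]
  · rw [listMatrix_mul, ← hd]
    exact h4 i i.2 j j.2
  · ext i j
    rw [listMatrix_mul, Matrix.smul_apply, Matrix.sub_apply, listMatrix_mul, Matrix.one_apply,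
      smul_eq_mul]
    refine Eq.trans ?_ (h5 i i.2 j j.2)
    simp only [Fin.ext_iff]

/-- This is what guarantees that the search for a certificate halts. -/
theorem exists_isPresentationCertificate {a b c : ℕ} {A B : List (List ℤ)}
    (hBA : listMatrix c b B * listMatrix b a A = 0) :
    ∃ t, IsPresentationCertificate ((a, b, c), A, B) t := by
  obtain ⟨r, d, E, Q, R, Y, K, N, hN, h1, h2, h3, h4, h5⟩ := exists_homology_presentation _ _ hBA
  have key : ∀ {m n : ℕ} (M : Matrix (Fin m) (Fin n) ℤ),
    listMatrix m n (List.ofFn fun i => List.ofFn (M i)) = M := listMatrix_ofFn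
  refine ⟨((List.ofFn d, N), [List.ofFn fun i => List.ofFn (E i), List.ofFn fun i => List.ofFn (Q i),
    List.ofFn fun i => List.ofFn (R i), List.ofFn fun i => List.ofFn (Y i),
    List.ofFn fun i => List.ofFn (K i)]), hN, ?_, ?_, ?_, ?_, ?_⟩ <;>
    simp only [List.length_ofFn, List.getD_cons_zero, List.getD_cons_succ] <;>
    intro i hi j hj
  · rw [← listMatrix_mul B _ ⟨i, hi⟩ ⟨j, hj⟩, key, h1]
    rfl
  · rw [← listMatrix_mul A _ ⟨i, hi⟩ ⟨j, hj⟩, key, ← h2]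
    have := listEntry_ofFn E ⟨i, hi⟩ ⟨j, hj⟩
    dsimp only at this
    rw [this]
    simp [List.getD_eq_getElem?_getD, hj]
  · rw [← listMatrix_mul _ _ ⟨i, hi⟩ ⟨j, hj⟩, key, key, h3, Matrix.one_apply]
    simp
  · rw [← listMatrix_mul _ _ ⟨i, hi⟩ ⟨j, hj⟩, key, h4]
    have := listEntry_ofFn Y ⟨i, hi⟩ ⟨j, hj⟩
    dsimp only at this
    rw [this]
    simp [List.getD_eq_getElem?_getD, hi]
  · rw [← listMatrix_mul _ _ ⟨i, hi⟩ ⟨j, hj⟩, ← listMatrix_mul _ _ ⟨i, hi⟩ ⟨j, hj⟩, key, key, key,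
      ← h5, Matrix.smul_apply, Matrix.sub_apply, Matrix.one_apply]
    simp

/-- Presentations of homology can be found by a search. -/
theorem exists_partrec_homologyPresentation :
    ∃ F : (ℕ × ℕ × ℕ) × List (List ℤ) × List (List ℤ) →
        Part (List ℕ × List (List ℤ) × List (List ℤ)), Partrec F ∧
      ∀ a b c A B, listMatrix c b B * listMatrix b a A = 0 →
        ∃ d E Q, F ((a, b, c), A, B) = Part.some (d, E, Q) ∧
          IsHomologyPresentation (listMatrix b a A) (listMatrix c b B) d.get
            (listMatrix b d.length E) (listMatrix d.length b Q) := by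
  obtain ⟨F, hF, h⟩ := exists_primrec_search PrimrecRel.isPresentationCertificate
  refine ⟨fun s => (F s).map fun t => (t.1.1, t.2.getD 0 [], t.2.getD 1 []), ?_, ?_⟩
  · refine Partrec.map hF (Primrec₂.to_comp (Primrec.pair ?_ (Primrec.pair ?_ ?_)))
    · exact Primrec.fst.comp (Primrec.fst.comp Primrec.snd)
    · exact (Primrec.list_getD []).comp (Primrec.snd.comp Primrec.snd) (Primrec.const 0)
    · exact (Primrec.list_getD []).comp (Primrec.snd.comp Primrec.snd) (Primrec.const 1)
  · intro a b c A B hBA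
    obtain ⟨⟨⟨d, N⟩, M⟩, h1, h2⟩ := h _ (exists_isPresentationCertificate hBA)
    exact ⟨d, _, _, by dsimp only; rw [h1, Part.map_some], h2.isHomologyPresentation⟩

end MatrixSearch

/-! ### Inhomogeneous cocycles and invariant functions on tuples. -/

section HomogeneousCochains

open CategoryTheory groupCohomology

section Tuples

variable {H K : Type*} [Group H] [Group K]

/-- The homogeneous tuple `(1, x₁, x₁x₂, …)`. -/
def homTuple : List H → List H
  | [] => [1]
  | x :: l => 1 :: (homTuple l).map (x * ·)

/-- The quotients `xᵢ⁻¹ xᵢ₊₁` of the successive entries of a tuple. -/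
def differences : List H → List H
  | [] => []
  | x :: t => match t with
    | [] => []
    | y :: _ => x⁻¹ * y :: differences t

theorem differences_cons_cons (x y : H) (t : List H) :
    differences (x :: y :: t) = x⁻¹ * y :: differences (y :: t) := by
  rw [differences]

theorem differences_singleton (x : H) : differences [x] = [] := by
  rw [differences]

theorem homTuple_eq_cons (l : List H) : ∃ t, homTuple l = 1 :: t := by
  cases l <;> exact ⟨_, rfl⟩

theorem length_homTuple (l : List H) : (homTuple l).length = l.length + 1 := by
  induction l with
  | nil => rfl
  | cons x l ih => simp [homTuple, ih]

theorem length_differences (t : List H) : (differences t).length = t.length - 1 := by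
  induction t with
  | nil => rfl
  | cons x t ih =>
    cases t with
    | nil => rfl
    | cons y t => simpa [differences_cons_cons] using ih

theorem homTuple_map (φ : H →* K) (l : List H) : homTuple (l.map φ) = (homTuple l).map φ := by
  induction l with
  | nil => simp [homTuple]
  | cons x l ih => simp [homTuple, ih, Function.comp_def]

theorem differences_map (φ : H →* K) (t : List H) :
    differences (t.map φ) = (differences t).map φ := by
  induction t with
  | nil => rfl
  | cons x t ih =>
    cases t with
    | nil => rfl
    | cons y t =>
      rw [List.map_cons] at ih
      simp only [List.map_cons, differences_cons_cons, ih, map_mul, map_inv]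

theorem differences_smul (h : H) (t : List H) : differences (t.map (h * ·)) = differences t := by
  induction t with
  | nil => rfl
  | cons x t ih =>
    cases t with
    | nil => rfl
    | cons y t =>
      rw [List.map_cons] at ih
      simp only [List.map_cons, differences_cons_cons, ih, mul_inv_rev, mul_assoc,
        inv_mul_cancel_left]

theorem differences_homTuple (l : List H) : differences (homTuple l) = l := by
  induction l with
  | nil => rfl
  | cons x l ih =>
    obtain ⟨t, ht⟩ := homTuple_eq_cons l
    rw [homTuple, ht, List.map_cons, differences_cons_cons, ← List.map_cons (f := (x * ·)), ← ht,
      differences_smul, ih]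
    simp

theorem homTuple_differences (x : H) (t : List H) :
    (homTuple (differences (x :: t))).map (x * ·) = x :: t := by
  induction t generalizing x with
  | nil => simp [differences_singleton, homTuple]
  | cons y t ih =>
    rw [differences_cons_cons, homTuple, List.map_cons, List.map_map, mul_one]
    have : ((x * ·) ∘ (x⁻¹ * y * ·) : H → H) = (y * ·) := by
      funext z
      simp [mul_assoc]
    rw [this, ih]

theorem homTuple_ofFn {n : ℕ} (g : Fin n → H) :
    homTuple (List.ofFn g) = List.ofFn (Fin.partialProd g) := by
  induction n with
  | zero => simp [homTuple]
  | succ n ih =>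
    rw [List.ofFn_succ, homTuple, ih, List.ofFn_succ (f := Fin.partialProd g), Fin.partialProd_zero,
      List.map_ofFn]
    congr 2
    funext i
    exact (Fin.partialProd_succ' g i).symm

theorem ofFn_comp_succAbove {X : Type*} {n : ℕ} (p : Fin (n + 1) → X) (a : Fin (n + 1)) :
    List.ofFn (p ∘ a.succAbove) = (List.ofFn p).eraseIdx a := by
  apply List.ext_getElem
  · simp [List.length_eraseIdx, Nat.lt_succ_iff.1 a.2]
  · intro i h1 h2
    rw [List.length_ofFn] at h1
    rw [List.getElem_ofFn, List.getElem_eraseIdx]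
    split
    · rename_i h
      rw [List.getElem_ofFn, Function.comp_apply,
          Fin.succAbove_of_castSucc_lt _ _ (by simpa [Fin.lt_def] using h)]
      rfl
    · rename_i h
      rw [List.getElem_ofFn, Function.comp_apply,
          Fin.succAbove_of_le_castSucc _ _ (by simpa [Fin.le_def] using h)]
      rfl

theorem faces_eq_sum {X : Type*} (t : List X) :
    faces t = ∑ i ∈ Finset.range t.length, (-1 : ℤ) ^ i • Finsupp.single (t.eraseIdx i) 1 := by
  induction t with
  | nil => rfl
  | cons x t ih =>
    rw [faces, List.length_cons, Finset.sum_range_succ', ih, map_sum, sub_eq_neg_add,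
      ← Finset.sum_neg_distrib]
    congr 1
    · refine Finset.sum_congr rfl fun i _ => ?_
      rw [map_smul, chainCons_single, List.eraseIdx_cons_succ, pow_succ, mul_neg_one, neg_smul]
    · simp

end Tuples

variable {H : Type} [Group H]

/-- Multiplying neighbouring entries of an inhomogeneous tuple, or dropping the last one, omits a
vertex of its homogeneous form. Dropping the first entry also omits a vertex, but then the tuple no
longer starts at `1`; invariance is used for this face alone. -/
theorem inhomogeneousCochains_d_apply {f : List H → ℤ}
    (hf : ∀ h : H, ∀ t, f (t.map (h * ·)) = f t) {m : ℕ} (x : Fin (m + 1) → H) :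
    (inhomogeneousCochains.d (Rep.trivial ℤ H ℤ) m).hom (fun y => f (homTuple (List.ofFn y))) x =
      chainEval f (faces (homTuple (List.ofFn x))) := by
  rw [inhomogeneousCochains.d_hom_apply, faces_eq_sum, length_homTuple, List.length_ofFn,
    Finset.sum_range_succ', map_add, map_sum, add_comm, ← Fin.sum_univ_eq_sum_range
      (fun i => chainEval f ((-1 : ℤ) ^ (i + 1) • Finsupp.single
        ((homTuple (List.ofFn x)).eraseIdx (i + 1)) 1)) (m + 1)]
  congr 1
  · refine Finset.sum_congr rfl fun j _ => ?_
    rw [map_smul, chainEval_single, one_mul, homTuple_ofFn, homTuple_ofFn,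
      Fin.partialProd_contractNth, ofFn_comp_succAbove]
    rfl
  · rw [pow_zero, one_smul, chainEval_single, one_mul, List.ofFn_succ, homTuple,
      List.eraseIdx_cons_zero, hf]
    rfl

theorem cocycle_ext {m : ℕ} {z z' : cocycles (Rep.trivial ℤ H ℤ) m}
    (h : ∀ x, cocycleValue z x = cocycleValue z' x) : z = z' := by
  refine (ModuleCat.mono_iff_injective (iCocycles (Rep.trivial ℤ H ℤ) m)).1 inferInstance ?_
  funext x
  exact h x

theorem exists_cocycle_of_invariant {f : List H → ℤ}
    (hf : ∀ h : H, ∀ t, f (t.map (h * ·)) = f t) (hd : ∀ t, chainEval f (faces t) = 0) (m : ℕ) :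
    ∃ z : cocycles (Rep.trivial ℤ H ℤ) m, ∀ x, cocycleValue z x = f (homTuple (List.ofFn x)) := by
  have h : inhomogeneousCochains.d (Rep.trivial ℤ H ℤ) m
      (fun y => f (homTuple (List.ofFn y))) = 0 := by
    funext x
    exact (inhomogeneousCochains_d_apply hf x).trans (hd _)
  exact ⟨cocyclesMk _ h, fun x => congrFun (iCocycles_mk (A := Rep.trivial ℤ H ℤ) _ h) x⟩

theorem d_cocycleValue {m : ℕ} (z : cocycles (Rep.trivial ℤ H ℤ) m) :
    (inhomogeneousCochains.d (Rep.trivial ℤ H ℤ) m).hom (cocycleValue z) = 0 := by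
  have h := (inhomogeneousCochains (Rep.trivial ℤ H ℤ)).iCycles_d m (m + 1)
  rw [inhomogeneousCochains.d_def] at h
  exact LinearMap.congr_fun (congrArg ModuleCat.Hom.hom h) z

theorem cohomologyClass_eq_zero_iff_succ {m : ℕ} (z : cocycles (Rep.trivial ℤ H ℤ) (m + 1)) :
    cohomologyClass z = 0 ↔ ∃ w : (Fin m → H) → ℤ, ∀ x, cocycleValue z x =
      (inhomogeneousCochains.d (Rep.trivial ℤ H ℤ) m).hom w x := by
  let K := inhomogeneousCochains (Rep.trivial ℤ H ℤ)
  have hto : ∀ w : (Fin m → H) → ℤ, (iCocycles (Rep.trivial ℤ H ℤ) (m + 1)).hom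
      ((K.toCycles m (m + 1)).hom w) = (inhomogeneousCochains.d (Rep.trivial ℤ H ℤ) m).hom w := by
    intro w
    have h := K.toCycles_i m (m + 1)
    rw [inhomogeneousCochains.d_def] at h
    exact LinearMap.congr_fun (congrArg ModuleCat.Hom.hom h) w
  have hex := ShortComplex.exact_of_g_is_cokernel (ShortComplex.mk _ _
      (K.toCycles_comp_homologyπ m (m + 1)))
    (K.homologyIsCokernel m (m + 1) (by simp))
  rw [ShortComplex.moduleCat_exact_iff] at hex
  constructor
  · intro h
    obtain ⟨w, hw⟩ := hex z h
    refine ⟨w, fun x => ?_⟩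
    rw [← hto w]
    exact congrArg (fun z => cocycleValue z x) hw.symm
  · rintro ⟨w, hw⟩
    have : z = (K.toCycles m (m + 1)).hom w := cocycle_ext fun x => (hw x).trans
      (congrFun (hto w) x).symm
    rw [this]
    exact LinearMap.congr_fun (congrArg ModuleCat.Hom.hom (K.toCycles_comp_homologyπ m (m + 1))) w

/-- There are no coboundaries in degree zero. This is why auxiliary functions are required to vanish
at the empty tuple below: in the augmented complex, a function on the empty tuple would have a
coboundary. -/
theorem cohomologyClass_eq_zero_iff_zero (z : cocycles (Rep.trivial ℤ H ℤ) 0) :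
    cohomologyClass z = 0 ↔ ∀ x, cocycleValue z x = 0 := by
  let K := inhomogeneousCochains (Rep.trivial ℤ H ℤ)
  have hex := ShortComplex.exact_of_g_is_cokernel (ShortComplex.mk _ _
      (K.toCycles_comp_homologyπ ((ComplexShape.up ℕ).prev 0) 0))
    (K.homologyIsCokernel _ 0 rfl)
  rw [ShortComplex.moduleCat_exact_iff] at hex
  constructor
  · intro h x
    obtain ⟨w, hw⟩ := hex z h
    have h0 : K.toCycles ((ComplexShape.up ℕ).prev 0) 0 = 0 := K.toCycles_eq_zero (by simp)
    have : z = 0 := by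
      rw [← hw]
      exact LinearMap.congr_fun (congrArg ModuleCat.Hom.hom h0) w
    rw [this, cocycleValue, map_zero]
    rfl
  · intro h
    have : z = 0 := cocycle_ext fun x => by
      rw [h x, cocycleValue, map_zero]
      rfl
    rw [this]
    exact map_zero _

/-- A coboundary of an invariant function that vanishes at the empty tuple has trivial class. -/
theorem cohomologyClass_eq_zero_of_invariant {m : ℕ} {z : cocycles (Rep.trivial ℤ H ℤ) m}
    {u : List H → ℤ} (hu : ∀ h : H, ∀ t, u (t.map (h * ·)) = u t) (h0 : u [] = 0)
    (h : ∀ x, cocycleValue z x = chainEval u (faces (homTuple (List.ofFn x)))) :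
    cohomologyClass z = 0 := by
  cases m with
  | zero =>
    rw [cohomologyClass_eq_zero_iff_zero]
    intro x
    rw [h]
    simp [homTuple, faces, chainEval_single, h0]
  | succ m =>
    rw [cohomologyClass_eq_zero_iff_succ]
    exact ⟨fun y => u (homTuple (List.ofFn y)), fun x => by
      rw [h, inhomogeneousCochains_d_apply hu]⟩

theorem cohomologyClass_eq_of_invariant {m : ℕ} {z z' : cocycles (Rep.trivial ℤ H ℤ) m}
    {u : List H → ℤ} (hu : ∀ h : H, ∀ t, u (t.map (h * ·)) = u t) (h0 : u [] = 0)
    (h : ∀ x, cocycleValue z x - cocycleValue z' x =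
      chainEval u (faces (homTuple (List.ofFn x)))) :
    cohomologyClass z = cohomologyClass z' := by
  rw [← sub_eq_zero, cohomologyClass, cohomologyClass, ← map_sub]
  refine cohomologyClass_eq_zero_of_invariant hu h0 fun x => ?_
  rw [← h, cocycleValue, map_sub]
  rfl

/-- The homogeneous cochain of an inhomogeneous one, as a function on tuples of all lengths. -/
def homogenize {m : ℕ} (z : (Fin m → H) → ℤ) (t : List H) : ℤ :=
  if t.length = m + 1 then z fun i => (differences t).getD i 1 else 0

theorem homogenize_apply {m : ℕ} (z : (Fin m → H) → ℤ) {t : List H} {x : Fin m → H}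
    (h : t.length = m + 1) (hx : differences t = List.ofFn x) : homogenize z t = z x := by
  rw [homogenize, if_pos h]
  congr 1
  funext i
  simp [hx, List.getD_eq_getElem?_getD]

theorem homogenize_of_length_ne {m : ℕ} (z : (Fin m → H) → ℤ) {t : List H}
    (h : t.length ≠ m + 1) : homogenize z t = 0 := if_neg h

theorem homogenize_homTuple {m : ℕ} (z : (Fin m → H) → ℤ) (x : Fin m → H) :
    homogenize z (homTuple (List.ofFn x)) = z x :=
  homogenize_apply z (by rw [length_homTuple, List.length_ofFn]) (differences_homTuple _)

theorem homogenize_smul {m : ℕ} (z : (Fin m → H) → ℤ) (h : H) (t : List H) :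
    homogenize z (t.map (h * ·)) = homogenize z t := by
  simp only [homogenize, List.length_map, differences_smul]

/-- Translating the first entry to `1` and taking successive quotients gives `g` and `x`. Identities
between invariant functions thus need to be checked on `homTuple` only. -/
theorem exists_smul_homTuple {m : ℕ} {t : List H} (h : t.length = m + 1) :
    ∃ (g : H) (x : Fin m → H), t = (homTuple (List.ofFn x)).map (g * ·) := by
  cases t with
  | nil => simp at h
  | cons g t =>
    have hl : (differences (g :: t)).length = m := by rw [length_differences, h, Nat.add_sub_cancel]
    refine ⟨g, fun i => (differences (g :: t)).get (i.cast hl.symm), ?_⟩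
    have : List.ofFn (fun i : Fin m => (differences (g :: t)).get (i.cast hl.symm)) =
        differences (g :: t) := by
      subst hl
      exact List.ofFn_get _
    rw [this, homTuple_differences]

theorem chainEval_faces_smul {X : Type*} {f : List X → ℤ} {φ : X → X}
    (hf : ∀ t, f (t.map φ) = f t) (t : List X) :
    chainEval f (faces (t.map φ)) = chainEval f (faces t) := by
  rw [← chainMap_faces, chainEval_chainMap]
  simp only [hf]

theorem chainEval_homogenize_faces {m : ℕ} (z : (Fin m → H) → ℤ) (g : H) (x : Fin (m + 1) → H) :
    chainEval (homogenize z) (faces ((homTuple (List.ofFn x)).map (g * ·))) =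
      (inhomogeneousCochains.d (Rep.trivial ℤ H ℤ) m).hom z x := by
  rw [chainEval_faces_smul (homogenize_smul z g),
    ← inhomogeneousCochains_d_apply (homogenize_smul z) x]
  simp only [homogenize_homTuple]

theorem chainEval_faces_of_length_ne {X : Type*} {f : List X → ℤ} {n : ℕ}
    (hf : ∀ t : List X, t.length ≠ n → f t = 0) {t : List X} (ht : t.length ≠ n + 1) :
    chainEval f (faces t) = 0 := by
  rw [chainEval_congr (g := 0) (s := {u | u.Sublist t ∧ u.length + 1 = t.length})
    (fun u hu => hf u fun h => ht (by rw [← hu.2, h])) (faces_mem_supported t)]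
  simp [chainEval]

theorem chainEval_homogenize_cocycle {m : ℕ} (z : cocycles (Rep.trivial ℤ H ℤ) m) (t : List H) :
    chainEval (homogenize (cocycleValue z)) (faces t) = 0 := by
  by_cases ht : t.length = m + 1 + 1
  · obtain ⟨g, x, rfl⟩ := exists_smul_homTuple ht
    rw [chainEval_homogenize_faces, d_cocycleValue]
    rfl
  · exact chainEval_faces_of_length_ne (fun u => homogenize_of_length_ne _) ht

theorem exists_invariant_of_cohomologyClass_eq_zero {m : ℕ} {z : cocycles (Rep.trivial ℤ H ℤ) m}
    (h : cohomologyClass z = 0) :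
    ∃ u : List H → ℤ, (∀ h : H, ∀ t, u (t.map (h * ·)) = u t) ∧ (u [] = 0) ∧
      (∀ t, t.length ≠ m → u t = 0) ∧
      ∀ t, homogenize (cocycleValue z) t = chainEval u (faces t) := by
  cases m with
  | zero =>
    rw [cohomologyClass_eq_zero_iff_zero] at h
    refine ⟨0, fun _ _ => rfl, rfl, fun _ _ => rfl, fun t => ?_⟩
    have : chainEval 0 (faces t) = 0 := by simp [chainEval]
    rw [this, homogenize]
    split
    · exact h _
    · rfl
  | succ m =>
    rw [cohomologyClass_eq_zero_iff_succ] at h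
    obtain ⟨w, hw⟩ := h
    refine ⟨homogenize w, homogenize_smul w, homogenize_of_length_ne w (by simp),
      fun t => homogenize_of_length_ne w, fun t => ?_⟩
    by_cases ht : t.length = m + 1 + 1
    · obtain ⟨g, x, rfl⟩ := exists_smul_homTuple ht
      rw [chainEval_homogenize_faces, homogenize_smul, homogenize_homTuple, hw]
    · rw [homogenize_of_length_ne _ ht,
        chainEval_faces_of_length_ne (fun u => homogenize_of_length_ne w) ht]

end HomogeneousCochains

/-! ### Coset systems and the retraction onto a subgroup. -/

section CosetSystems

open Classical in
/-- The characteristic function of a subgroup of `SL₂(ℤ)`. -/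
noncomputable def memberValue (Γ : Subgroup SL(2, ℤ)) (A : SL(2, ℤ)) : ℤ := if A ∈ Γ then 1 else 0

theorem memberValue_of_mem {Γ : Subgroup SL(2, ℤ)} {A : SL(2, ℤ)} (h : A ∈ Γ) :
    memberValue Γ A = 1 := if_pos h

theorem memberValue_of_notMem {Γ : Subgroup SL(2, ℤ)} {A : SL(2, ℤ)} (h : A ∉ Γ) :
    memberValue Γ A = 0 := if_neg h

theorem memberValue_nonneg (Γ : Subgroup SL(2, ℤ)) (A : SL(2, ℤ)) : 0 ≤ memberValue Γ A := by
  unfold memberValue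
  split_ifs <;> simp

theorem memberValue_eq_one {Γ : Subgroup SL(2, ℤ)} {A : SL(2, ℤ)} :
    memberValue Γ A = 1 ↔ A ∈ Γ := by
  unfold memberValue
  split_ifs with h <;> simp [h]

theorem memberValue_mul_left {Γ : Subgroup SL(2, ℤ)} {γ : SL(2, ℤ)} (h : γ ∈ Γ) (A : SL(2, ℤ)) :
    memberValue Γ (γ * A) = memberValue Γ A := by
  by_cases hA : A ∈ Γ
  · rw [memberValue_of_mem hA, memberValue_of_mem (mul_mem h hA)]
  · rw [memberValue_of_notMem hA, memberValue_of_notMem fun h' => hA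
      ((Subgroup.mul_mem_cancel_left Γ h).1 h')]

/-- The list `L` starts with the identity and contains, counted with multiplicity, exactly one
element of every right coset of `Γ`. -/
structure IsCosetSystem (Γ : Subgroup SL(2, ℤ)) (L : List SL(2, ℤ)) : Prop where
  head : ∃ L', L = 1 :: L'
  sum : ∀ g, (L.map fun r => memberValue Γ (g * r⁻¹)).sum = 1

/-- The first element in the list `L` of the coset of `g`. -/
noncomputable def representativeIn (Γ : Subgroup SL(2, ℤ)) (L : List SL(2, ℤ)) (g : SL(2, ℤ)) :
    SL(2, ℤ) :=
  L.getD ((L.map fun r => memberValue Γ (g * r⁻¹)).idxOf 1) 1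

variable {Γ : Subgroup SL(2, ℤ)} {L : List SL(2, ℤ)}

theorem IsCosetSystem.exists_mem (hL : IsCosetSystem Γ L) (g : SL(2, ℤ)) :
    ∃ r ∈ L, g * r⁻¹ ∈ Γ := by
  by_contra! h
  have := hL.sum g
  rw [List.map_congr_left (g := fun _ => 0) fun r hr => memberValue_of_notMem (h r hr)] at this
  simp at this

theorem IsCosetSystem.mul_representativeIn_inv_mem (hL : IsCosetSystem Γ L) (g : SL(2, ℤ)) :
    g * (representativeIn Γ L g)⁻¹ ∈ Γ := by
  obtain ⟨r, hr, hg⟩ := hL.exists_mem g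
  have h1 : (1 : ℤ) ∈ L.map fun r => memberValue Γ (g * r⁻¹) :=
    List.mem_map.2 ⟨r, hr, memberValue_of_mem hg⟩
  have h2 := List.idxOf_lt_length_iff.2 h1
  have h3 := List.getElem_idxOf h2
  rw [List.getElem_map, memberValue_eq_one] at h3
  rw [List.length_map] at h2
  rw [representativeIn, List.getD_eq_getElem _ _ h2]
  exact h3

theorem representativeIn_mul {γ : SL(2, ℤ)} (h : γ ∈ Γ) (L : List SL(2, ℤ)) (g : SL(2, ℤ)) :
    representativeIn Γ L (γ * g) = representativeIn Γ L g := by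
  simp only [representativeIn, mul_assoc, memberValue_mul_left h]

theorem IsCosetSystem.representativeIn_one (hL : IsCosetSystem Γ L) :
    representativeIn Γ L 1 = 1 := by
  obtain ⟨L', rfl⟩ := hL.head
  simp [representativeIn, memberValue_of_mem Γ.one_mem]

/-- The retraction `g ↦ g r(g)⁻¹` of `SL₂(ℤ)` onto `Γ`, where `r(g)` is the representative of the
coset of `g`. -/
noncomputable def cosetRetraction (hL : IsCosetSystem Γ L) (g : SL(2, ℤ)) : Γ :=
  ⟨g * (representativeIn Γ L g)⁻¹, hL.mul_representativeIn_inv_mem g⟩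

theorem cosetRetraction_mul (hL : IsCosetSystem Γ L) (γ : Γ) (g : SL(2, ℤ)) :
    cosetRetraction hL (γ * g) = γ * cosetRetraction hL g := by
  apply Subtype.ext
  simp only [cosetRetraction, representativeIn_mul γ.2, Subgroup.coe_mul, mul_assoc]

/-- The list starts with the identity, which therefore represents `Γ` itself. Consequently a cocycle
on `Γ` that is extended by the retraction restricts to itself. -/
theorem cosetRetraction_coe (hL : IsCosetSystem Γ L) (γ : Γ) :
    cosetRetraction hL γ = γ := by
  rw [← mul_one (γ : SL(2, ℤ)), cosetRetraction_mul]
  have : cosetRetraction hL 1 = 1 := by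
    apply Subtype.ext
    simp [cosetRetraction, hL.representativeIn_one]
  rw [this, mul_one]

end CosetSystems

/-! ### Orbits of cliques and the coboundary matrices. -/

section OrbitLists

/-- The tuples of a given length with entries from a list. -/
def wordsOf {X : Type*} (S : List X) : ℕ → List (List X)
  | 0 => [[]]
  | n + 1 => S.flatMap fun x => (wordsOf S n).map (x :: ·)

theorem mem_wordsOf {X : Type*} {S : List X} {n : ℕ} {s : List X} :
    s ∈ wordsOf S n ↔ s.length = n ∧ ∀ x ∈ s, x ∈ S := by
  induction n generalizing s with
  | zero =>
    rw [wordsOf, List.mem_singleton]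
    constructor
    · rintro rfl
      simp
    · rintro ⟨h, _⟩
      exact List.length_eq_zero_iff.1 h
  | succ n ih =>
    rw [wordsOf, List.mem_flatMap]
    constructor
    · rintro ⟨x, hx, h⟩
      obtain ⟨u, hu, rfl⟩ := List.mem_map.1 h
      obtain ⟨h1, h2⟩ := ih.1 hu
      exact ⟨by simp [h1], List.forall_mem_cons.2 ⟨hx, h2⟩⟩
    · rintro ⟨h1, h2⟩
      cases s with
      | nil => simp at h1
      | cons x s =>
        rw [List.forall_mem_cons] at h2
        exact ⟨x, h2.1, List.mem_map.2 ⟨s, ih.2 ⟨by simpa using h1, h2.2⟩, rfl⟩⟩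

theorem nodup_wordsOf {X : Type*} {S : List X} (hS : S.Nodup) (n : ℕ) : (wordsOf S n).Nodup := by
  induction n with
  | zero => simp [wordsOf]
  | succ n ih =>
    rw [wordsOf, List.nodup_flatMap]
    refine ⟨fun x _ => ih.map fun u v h => by simpa using h, hS.imp ?_⟩
    intro x y hxy u hu hv
    obtain ⟨u', _, rfl⟩ := List.mem_map.1 hu
    obtain ⟨v', _, h⟩ := List.mem_map.1 hv
    simp only [List.cons.injEq] at h
    exact hxy h.1.symm

theorem nodup_ellipticList (b : Bool) : (ellipticList b).Nodup := by
  apply List.Nodup.of_map matrixEntries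
  cases b <;> decide

/-- The tuples `t` of a given length for which `1 :: t` is a clique. -/
def cliqueTails (n : ℕ) : List (List SL(2, ℤ)) :=
  wordsOf (ellipticList false) n ++
    (wordsOf (ellipticList true) n).filter fun t => ¬ ∀ x ∈ t, x ∈ ellipticList false

theorem one_cons_mem_cliques {t : List SL(2, ℤ)} :
    1 :: t ∈ cliques ellipticRel ↔ ∃ b, ∀ x ∈ t, x ∈ ellipticList b := by
  refine exists_congr fun b => ⟨fun h x hx => ?_, fun h => ?_⟩
  · have := h 1 (by simp) x (by simp [hx])
    rwa [ellipticRel, inv_one, one_mul] at this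
  · have h1 : ∀ x ∈ 1 :: t, ellipticRel b 1 x := by
      intro x hx
      rw [ellipticRel, inv_one, one_mul]
      rcases List.mem_cons.1 hx with rfl | hx
      · exact mem_ellipticList.2 ⟨0, by simp⟩
      · exact h x hx
    intro x hx y hy
    exact (ellipticRel_equivalence b).trans ((ellipticRel_equivalence b).symm (h1 x hx)) (h1 y hy)

theorem mem_cliqueTails {n : ℕ} {t : List SL(2, ℤ)} :
    t ∈ cliqueTails n ↔ t.length = n ∧ 1 :: t ∈ cliques ellipticRel := by
  rw [cliqueTails, List.mem_append, List.mem_filter, mem_wordsOf, mem_wordsOf, one_cons_mem_cliques,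
    Bool.exists_bool, decide_eq_true_eq]
  tauto

/-- Tuples with entries in the intersection of the two cyclic groups belong to both families; the
filter in `cliqueTails` keeps them in one. Each orbit is then represented once, so that orbit values
are honest coordinates. -/
theorem nodup_cliqueTails (n : ℕ) : (cliqueTails n).Nodup := by
  rw [cliqueTails]
  refine (nodup_wordsOf (nodup_ellipticList _) n).append
    ((nodup_wordsOf (nodup_ellipticList _) n).filter _) fun t h1 h2 => ?_
  have := (List.mem_filter.1 h2).2
  rw [decide_eq_true_eq] at this
  exact this (mem_wordsOf.1 h1).2

/-- Representatives of the orbits of a subgroup on the cliques of a given positive length. -/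
def orbitList (L : List SL(2, ℤ)) : ℕ → List (List SL(2, ℤ))
  | 0 => []
  | n + 1 => L.flatMap fun r => (cliqueTails n).map fun t => r :: t.map (r * ·)

/-- The translate of a tuple that starts with the identity. -/
def normalizeTuple (t : List SL(2, ℤ)) : List SL(2, ℤ) := t.map ((t.headD 1)⁻¹ * ·)

theorem normalizeTuple_cons (g : SL(2, ℤ)) (t : List SL(2, ℤ)) :
    normalizeTuple (g :: t) = 1 :: t.map (g⁻¹ * ·) := by
  simp [normalizeTuple]

/-- The characteristic function of the orbit of `u` under `Γ`, for a nonempty tuple `u`. -/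
noncomputable def orbitIndicator (Γ : Subgroup SL(2, ℤ)) (u t : List SL(2, ℤ)) : ℤ :=
  if t ≠ [] ∧ normalizeTuple t = normalizeTuple u then
    memberValue Γ (t.headD 1 * (u.headD 1)⁻¹) else 0

/-- An invariant function on the tuples of length `n`, extended by zero, and zero for `n = 0`. -/
structure IsInvariantCochain (Γ : Subgroup SL(2, ℤ)) (n : ℕ) (w : List SL(2, ℤ) → ℤ) : Prop where
  smul : ∀ γ ∈ Γ, ∀ t, w (t.map (γ * ·)) = w t
  of_length_ne : ∀ t, t.length ≠ n → w t = 0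
  nil : w [] = 0

/-- The coboundary of a cochain on tuples. -/
noncomputable def coboundary {X : Type*} (w : List X → ℤ) (t : List X) : ℤ := chainEval w (faces t)

theorem chainEval_coboundary {X : Type*} (w : List X → ℤ) (c : List X →₀ ℤ) :
    chainEval (coboundary w) c = chainEval w (chainBoundary c) := by
  have : chainEval (coboundary w) = chainEval w ∘ₗ chainBoundary := chain_hom_ext fun t => by
    rw [LinearMap.comp_apply, chainEval_single, chainBoundary_single, one_mul, one_smul, coboundary]
  rw [this, LinearMap.comp_apply]

theorem coboundary_coboundary {X : Type*} (w : List X → ℤ) (t : List X) :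
    coboundary (coboundary w) t = 0 := by
  rw [coboundary, chainEval_coboundary, chainBoundary_faces, map_zero]

variable {Γ : Subgroup SL(2, ℤ)} {L : List SL(2, ℤ)}

theorem IsInvariantCochain.coboundary {n : ℕ} {w : List SL(2, ℤ) → ℤ}
    (hw : IsInvariantCochain Γ n w) : IsInvariantCochain Γ (n + 1) (coboundary w) where
  smul γ hγ t := chainEval_faces_smul (hw.smul γ hγ) t
  of_length_ne _ ht := chainEval_faces_of_length_ne hw.of_length_ne ht
  nil := by simp [_root_.coboundary, faces]

theorem orbitIndicator_smul {γ : SL(2, ℤ)} (hγ : γ ∈ Γ) (u t : List SL(2, ℤ)) :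
    orbitIndicator Γ u (t.map (γ * ·)) = orbitIndicator Γ u t := by
  cases t with
  | nil => rfl
  | cons g t =>
    have h : normalizeTuple ((g :: t).map (γ * ·)) = normalizeTuple (g :: t) := by
      rw [List.map_cons, normalizeTuple_cons, normalizeTuple_cons, List.map_map]
      congr 1
      refine List.map_congr_left fun x _ => ?_
      simp [mul_assoc]
    simp only [orbitIndicator, h]
    simp [mul_assoc, memberValue_mul_left hγ]

theorem orbitIndicator_nil (u : List SL(2, ℤ)) : orbitIndicator Γ u [] = 0 := by
  simp [orbitIndicator]

theorem orbitIndicator_of_length_ne {u t : List SL(2, ℤ)} (h : t.length ≠ u.length) :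
    orbitIndicator Γ u t = 0 := by
  refine if_neg fun h' => h ?_
  have := congrArg List.length h'.2
  simpa [normalizeTuple] using this

theorem exists_smul_of_orbitIndicator_ne_zero {u t : List SL(2, ℤ)}
    (h : orbitIndicator Γ u t ≠ 0) : ∃ γ ∈ Γ, t = u.map (γ * ·) := by
  rw [orbitIndicator] at h
  split_ifs at h with h1
  · refine ⟨t.headD 1 * (u.headD 1)⁻¹, by_contra fun h2 => h (memberValue_of_notMem h2), ?_⟩
    have h3 := congrArg (List.map (t.headD 1 * ·)) h1.2
    simp only [normalizeTuple, List.map_map] at h3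
    have h4 : ((t.headD 1 * ·) ∘ ((t.headD 1)⁻¹ * ·) : SL(2, ℤ) → SL(2, ℤ)) = id := by
      funext x
      simp
    rw [h4, List.map_id] at h3
    refine h3.trans (List.map_congr_left fun x _ => ?_)
    simp [mul_assoc]
  · exact absurd rfl h

theorem orbitIndicator_self {u : List SL(2, ℤ)} (hu : u ≠ []) : orbitIndicator Γ u u = 1 := by
  simp [orbitIndicator, hu, memberValue_of_mem Γ.one_mem]

theorem orbitIndicator_nonneg (u t : List SL(2, ℤ)) : 0 ≤ orbitIndicator Γ u t := by
  rw [orbitIndicator]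
  split_ifs
  · exact memberValue_nonneg _ _
  · exact le_rfl

theorem orbitList_spec {n : ℕ} {u : List SL(2, ℤ)} (h : u ∈ orbitList L n) :
    u.length = n ∧ u ≠ [] ∧ u ∈ cliques ellipticRel := by
  cases n with
  | zero => simp [orbitList] at h
  | succ n =>
    obtain ⟨r, _, h⟩ := List.mem_flatMap.1 h
    obtain ⟨t, ht, rfl⟩ := List.mem_map.1 h
    obtain ⟨h1, h2⟩ := mem_cliqueTails.1 ht
    have h3 := cliques_smul r h2
    rw [List.map_cons, mul_one] at h3
    exact ⟨by simp [h1], by simp, h3⟩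

/-- Every clique lies in exactly one of the orbits. -/
theorem sum_orbitIndicator (hL : IsCosetSystem Γ L) {n : ℕ} {t : List SL(2, ℤ)}
    (ht : t ∈ cliques ellipticRel) (hn : t.length = n) (h0 : t ≠ []) :
    ((orbitList L n).map fun u => orbitIndicator Γ u t).sum = 1 := by
  cases t with
  | nil => exact absurd rfl h0
  | cons g t =>
    subst hn
    rw [List.length_cons, orbitList, List.map_flatMap, List.flatMap_def, List.sum_flatten,
      List.map_map]
    -- A tuple is determined by its first entry and its normalized tail. For each representative `r`
    -- exactly one tail contributes, which leaves the sum that counts the representatives of the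
    -- coset of `g`.
    refine Eq.trans ?_ (hL.sum g)
    congr 1
    refine List.map_congr_left fun r _ => ?_
    rw [Function.comp_apply, List.map_map]
    have h1 : t.map (g⁻¹ * ·) ∈ cliqueTails t.length := by
      refine mem_cliqueTails.2 ⟨by simp, ?_⟩
      have := cliques_smul g⁻¹ ht
      rwa [List.map_cons, inv_mul_cancel] at this
    have h2 : ∀ s : List SL(2, ℤ), orbitIndicator Γ (r :: s.map (r * ·)) (g :: t) =
        if t.map (g⁻¹ * ·) = s then memberValue Γ (g * r⁻¹) else 0 := by
      intro s
      rw [orbitIndicator, normalizeTuple_cons, normalizeTuple_cons, List.map_map]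
      have : ((r⁻¹ * ·) ∘ (r * ·) : SL(2, ℤ) → SL(2, ℤ)) = id := by
        funext x
        simp
      rw [this, List.map_id]
      simp
    simp only [Function.comp_def, h2]
    have h3 := (nodup_cliqueTails t.length)
    generalize cliqueTails t.length = C at h1 h3
    rw [← List.sum_toFinset _ h3, Finset.sum_ite_eq, if_pos (List.mem_toFinset.2 h1)]

/-- The values of a cochain at the representatives of the orbits. -/
def orbitValues (O : List (List SL(2, ℤ))) (w : List SL(2, ℤ) → ℤ) (i : Fin O.length) : ℤ :=
  w (O.get i)

/-- The cochain with given values at the representatives of the orbits. -/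
noncomputable def orbitCochain (Γ : Subgroup SL(2, ℤ)) (O : List (List SL(2, ℤ)))
    (a : Fin O.length → ℤ) (t : List SL(2, ℤ)) : ℤ :=
  ∑ i, orbitIndicator Γ (O.get i) t * a i

theorem isInvariantCochain_orbitCochain (L : List SL(2, ℤ)) (n : ℕ)
    (a : Fin (orbitList L n).length → ℤ) :
    IsInvariantCochain Γ n (orbitCochain Γ (orbitList L n) a) where
  smul γ hγ t := by simp only [orbitCochain, orbitIndicator_smul hγ]
  of_length_ne t ht := Finset.sum_eq_zero fun i _ => by
    rw [orbitIndicator_of_length_ne, zero_mul]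
    rw [(orbitList_spec (List.get_mem _ i)).1]
    exact ht
  nil := by simp only [orbitCochain, orbitIndicator_nil, zero_mul, Finset.sum_const_zero]

theorem sum_get {X : Type*} (O : List X) (f : X → ℤ) : ∑ i, f (O.get i) = (O.map f).sum :=
  Fin.sum_univ_fun_getElem O f

/-- Exactly one listed orbit contains the clique `t`, and `w` is constant on it. When `t` is empty
or of another length, both sides vanish by the normalization of invariant cochains. -/
theorem orbitCochain_orbitValues (hL : IsCosetSystem Γ L) {n : ℕ} {w : List SL(2, ℤ) → ℤ}
    (hw : IsInvariantCochain Γ n w) {t : List SL(2, ℤ)} (ht : t ∈ cliques ellipticRel) :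
    orbitCochain Γ (orbitList L n) (orbitValues (orbitList L n) w) t = w t := by
  by_cases h : t.length = n ∧ t ≠ []
  · have h1 : ∀ u, orbitIndicator Γ u t * w u = orbitIndicator Γ u t * w t := by
      intro u
      by_cases h2 : orbitIndicator Γ u t = 0
      · rw [h2, zero_mul, zero_mul]
      · obtain ⟨γ, hγ, rfl⟩ := exists_smul_of_orbitIndicator_ne_zero h2
        rw [hw.smul γ hγ]
    simp only [orbitCochain, orbitValues, h1]
    rw [← Finset.sum_mul, sum_get _ fun u => orbitIndicator Γ u t,
      sum_orbitIndicator hL ht h.1 h.2, one_mul]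
  · have h1 : ∀ {w'}, IsInvariantCochain Γ n w' → w' t = 0 := by
      intro w' hw'
      by_cases h2 : t = []
      · rw [h2, hw'.nil]
      · exact hw'.of_length_ne t fun h3 => h ⟨h3, h2⟩
    rw [h1 hw, h1 (isInvariantCochain_orbitCochain L n _)]

/-- At a representative the nonnegative indicators add up to `1`, and its own indicator is `1`
already; so all others vanish there. -/
theorem orbitValues_orbitCochain (hL : IsCosetSystem Γ L) {n : ℕ}
    (a : Fin (orbitList L n).length → ℤ) :
    orbitValues (orbitList L n) (orbitCochain Γ (orbitList L n) a) = a := by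
  funext i
  obtain ⟨h1, h2, h3⟩ := orbitList_spec (List.get_mem (orbitList L n) i)
  have h4 := sum_orbitIndicator hL h3 h1 h2
  rw [← sum_get, ← Finset.add_sum_erase _ _ (Finset.mem_univ i), orbitIndicator_self h2,
    add_eq_left, Finset.sum_eq_zero_iff_of_nonneg fun j _ => orbitIndicator_nonneg _ _] at h4
  rw [orbitValues, orbitCochain, ← Finset.add_sum_erase _ _ (Finset.mem_univ i),
    orbitIndicator_self h2, one_mul, Finset.sum_eq_zero, add_zero]
  intro j hj
  rw [h4 j hj, zero_mul]

/-- The matrix of the coboundary of invariant cochains on cliques. -/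
noncomputable def coboundaryMatrix (Γ : Subgroup SL(2, ℤ)) (L : List SL(2, ℤ)) (n : ℕ) :
    Matrix (Fin (orbitList L (n + 1)).length) (Fin (orbitList L n).length) ℤ :=
  Matrix.of fun i j => coboundary (orbitIndicator Γ ((orbitList L n).get j))
    ((orbitList L (n + 1)).get i)

theorem chainEval_orbitCochain (O : List (List SL(2, ℤ))) (a : Fin O.length → ℤ)
    (c : List SL(2, ℤ) →₀ ℤ) : chainEval (orbitCochain Γ O a) c =
      ∑ j, chainEval (orbitIndicator Γ (O.get j)) c * a j := by
  simp only [chainEval, Finsupp.linearCombination_apply, Finsupp.sum, Finset.sum_mul]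
  rw [Finset.sum_comm]
  refine Finset.sum_congr rfl fun t _ => ?_
  simp only [orbitCochain, smul_eq_mul, Finset.mul_sum, mul_assoc]

theorem coboundaryMatrix_mulVec (n : ℕ) (a : Fin (orbitList L n).length → ℤ) :
    (coboundaryMatrix Γ L n).mulVec a =
      orbitValues (orbitList L (n + 1)) (coboundary (orbitCochain Γ (orbitList L n) a)) :=
  funext fun _ => (chainEval_orbitCochain _ a _).symm

theorem coboundary_orbitCochain (hL : IsCosetSystem Γ L) {n : ℕ}
    (a : Fin (orbitList L n).length → ℤ) {t : List SL(2, ℤ)} (ht : t ∈ cliques ellipticRel) :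
    coboundary (orbitCochain Γ (orbitList L n) a) t =
      orbitCochain Γ (orbitList L (n + 1)) ((coboundaryMatrix Γ L n).mulVec a) t := by
  rw [coboundaryMatrix_mulVec, orbitCochain_orbitValues hL
    (isInvariantCochain_orbitCochain L n a).coboundary ht]

theorem coboundary_congr {w w' : List SL(2, ℤ) → ℤ}
    (h : ∀ t ∈ cliques ellipticRel, w t = w' t) {t : List SL(2, ℤ)}
    (ht : t ∈ cliques ellipticRel) : coboundary w t = coboundary w' t :=
  chainEval_congr (fun u hu => h u (mem_cliques_of_sublist ht hu.1)) (faces_mem_supported t)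

theorem mulVec_eq_zero_iff (hL : IsCosetSystem Γ L) {n : ℕ}
    (a : Fin (orbitList L n).length → ℤ) : (coboundaryMatrix Γ L n).mulVec a = 0 ↔
      ∀ t ∈ cliques ellipticRel, coboundary (orbitCochain Γ (orbitList L n) a) t = 0 := by
  constructor
  · intro h t ht
    rw [coboundary_orbitCochain hL a ht, h]
    simp [orbitCochain]
  · intro h
    rw [coboundaryMatrix_mulVec]
    funext i
    exact h _ (orbitList_spec (List.get_mem _ i)).2.2

/-- Orbit values describe cochains on cliques only. As faces of cliques are cliques, this suffices
to transport the vanishing of the double coboundary to the matrices. -/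
theorem coboundaryMatrix_mul (hL : IsCosetSystem Γ L) (n : ℕ) :
    coboundaryMatrix Γ L (n + 1) * coboundaryMatrix Γ L n = 0 := by
  refine Matrix.ext_of_mulVec_single fun j => ?_
  rw [← Matrix.mulVec_mulVec, Matrix.zero_mulVec, mulVec_eq_zero_iff hL]
  intro t ht
  rw [← coboundary_congr (fun u hu => coboundary_orbitCochain hL _ hu) ht, coboundary_coboundary]

end OrbitLists

/-! ### Homotopies evaluated on cocycles. -/

section HomotopyInvariance

variable {X X' : Type*}

/-- Pairing the homotopy formula with a cocycle kills the term that is a boundary; the other term is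
the coboundary of the cochain given by the homotopy. -/
theorem chainEval_sub_eq_coboundary {ψ : (List X →₀ ℤ) →ₗ[ℤ] (List X' →₀ ℤ)} (ρ : X → X')
    (hψ : ∀ c, chainBoundary (ψ c) = ψ (chainBoundary c))
    (h0 : ψ (Finsupp.single [] 1) = Finsupp.single [] 1) {f : List X' → ℤ}
    (hf : ∀ t, coboundary f t = 0) (t : List X) :
    chainEval f (ψ (Finsupp.single t 1)) - f (t.map ρ) =
      coboundary (fun s => chainEval f (tupleHomotopy ψ ρ s)) t := by
  have h1 : ∀ c, chainEval f (chainBoundary c) = 0 := fun c => by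
    rw [← chainEval_coboundary]
    simp [chainEval, Finsupp.linearCombination_apply, hf]
  have h2 : chainEval (fun s => chainEval f (tupleHomotopy ψ ρ s)) =
      chainEval f ∘ₗ chainHomotopy ψ ρ := chain_hom_ext fun t => by
    rw [LinearMap.comp_apply, chainEval_single, chainHomotopy_single, one_mul]
  have h3 := congrArg (chainEval f) (chainHomotopy_spec ρ hψ h0 (Finsupp.single t 1))
  rw [map_sub, map_add, h1, zero_add, chainMap_single, chainEval_single, one_mul,
    chainBoundary_single, one_smul] at h3
  rw [h3, coboundary, h2, LinearMap.comp_apply]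

theorem chainEval_tupleHomotopy_map {ψ : (List X →₀ ℤ) →ₗ[ℤ] (List X' →₀ ℤ)} {ρ : X → X'}
    {α : X → X} {α' : X' → X'} (hψ : ∀ c, ψ (chainMap α c) = chainMap α' (ψ c))
    (hρ : ∀ x, ρ (α x) = α' (ρ x)) {f : List X' → ℤ} (hf : ∀ t, f (t.map α') = f t)
    (t : List X) :
    chainEval f (tupleHomotopy ψ ρ (t.map α)) = chainEval f (tupleHomotopy ψ ρ t) := by
  have h := chainHomotopy_equivariant hψ hρ (Finsupp.single t 1)
  rw [chainMap_single, chainHomotopy_single, chainHomotopy_single] at h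
  rw [h, chainEval_chainMap]
  simp only [hf]

theorem chainEval_faces_map (f : List X' → ℤ) (ρ : X → X') (t : List X) :
    coboundary (fun s => f (s.map ρ)) t = coboundary f (t.map ρ) := by
  rw [coboundary, coboundary, ← chainMap_faces, chainEval_chainMap]

theorem coboundary_add (f g : List X → ℤ) (t : List X) :
    coboundary (fun s => f s + g s) t = coboundary f t + coboundary g t := by
  have : chainEval (fun s => f s + g s) = chainEval f + chainEval g := chain_hom_ext fun s => by
    simp [chainEval_single]
  rw [coboundary, this]
  rfl

theorem coboundary_congr_length {f g : List X → ℤ} {t : List X} {n : ℕ} (ht : t.length = n + 1)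
    (h : ∀ s : List X, s.length = n → f s = g s) : coboundary f t = coboundary g t :=
  chainEval_congr (fun u hu => h u (by have := hu.2; omega)) (faces_mem_supported t)

end HomotopyInvariance

/-! ### Group cohomology computed by invariant cochains on cliques. -/

section CliqueCohomology

open groupCohomology

/-- The cochain on all tuples that is induced by a cochain on cliques. -/
noncomputable def extendCochain (y : List SL(2, ℤ) → List (ℤ × List SL(2, ℤ)))
    (w : List SL(2, ℤ) → ℤ) (t : List SL(2, ℤ)) : ℤ := chainEval w (tupleExtension y t)

variable {Γ : Subgroup SL(2, ℤ)} {L : List SL(2, ℤ)}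
  {y : List SL(2, ℤ) → List (ℤ × List SL(2, ℤ))}

theorem chainEval_extendCochain (w : List SL(2, ℤ) → ℤ) (c : List SL(2, ℤ) →₀ ℤ) :
    chainEval (extendCochain y w) c = chainEval w (chainExtension y c) := by
  have : chainEval (extendCochain y w) = chainEval w ∘ₗ chainExtension y :=
    chain_hom_ext fun t => by
      rw [LinearMap.comp_apply, chainEval_single, one_mul, chainExtension_single, extendCochain]
  rw [this, LinearMap.comp_apply]

theorem extendCochain_smul {w : List SL(2, ℤ) → ℤ} {γ : SL(2, ℤ)}
    (hw : ∀ t, w (t.map (γ * ·)) = w t) (t : List SL(2, ℤ)) :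
    extendCochain y w (t.map (γ * ·)) = extendCochain y w t := by
  have h := chainExtension_equivariant (y := y) γ (Finsupp.single t 1)
  rw [chainMap_single, chainExtension_single, chainExtension_single] at h
  rw [extendCochain, h, chainEval_chainMap]
  simp only [hw, extendCochain]

theorem extendCochain_nil (w : List SL(2, ℤ) → ℤ) : extendCochain y w [] = w [] := by
  rw [extendCochain, tupleExtension, chainEval_single, one_mul]

theorem coboundary_extendCochain (h : ∀ t, IsProjectionAt y t) (w : List SL(2, ℤ) → ℤ)
    (t : List SL(2, ℤ)) :
    coboundary (extendCochain y w) t = extendCochain y (coboundary w) t := by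
  rw [coboundary, chainEval_extendCochain, extendCochain, chainEval_coboundary,
    ← chainExtension_single, chainExtension_chainBoundary h, chainBoundary_single, one_smul]

theorem extendCochain_congr (h : ∀ t, IsProjectionAt y t) {w w' : List SL(2, ℤ) → ℤ}
    (hw : ∀ t ∈ cliques ellipticRel, w t = w' t) (t : List SL(2, ℤ)) :
    extendCochain y w t = extendCochain y w' t := by
  rw [extendCochain, extendCochain, ← chainExtension_single]
  exact chainEval_congr hw (chainExtension_mem h _)

theorem extendCochain_zero (t : List SL(2, ℤ)) : extendCochain y (fun _ => 0) t = 0 := by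
  simp [extendCochain, chainEval, Finsupp.linearCombination_apply]

theorem extendCochain_of_mem (h : ∀ t, IsProjectionAt y t) (w : List SL(2, ℤ) → ℤ)
    {t : List SL(2, ℤ)} (ht : t ∈ cliques ellipticRel) : extendCochain y w t = w t := by
  rw [extendCochain, ← chainExtension_single, chainExtension_of_mem h
    (Finsupp.single_mem_supported ℤ _ ht), chainEval_single, one_mul]

theorem extendCochain_orbitCochain_add (O : List (List SL(2, ℤ))) (a b : Fin O.length → ℤ)
    (t : List SL(2, ℤ)) : extendCochain y (orbitCochain Γ O (a + b)) t =
      extendCochain y (orbitCochain Γ O a) t + extendCochain y (orbitCochain Γ O b) t := by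
  have : chainEval (orbitCochain Γ O (a + b)) =
      chainEval (orbitCochain Γ O a) + chainEval (orbitCochain Γ O b) := chain_hom_ext fun s => by
    simp [chainEval_single, orbitCochain, mul_add, Finset.sum_add_distrib]
  rw [extendCochain, this]
  rfl

theorem map_coe_smul (γ : Γ) (t : List Γ) :
    (t.map (γ * ·)).map ((↑) : Γ → SL(2, ℤ)) = (t.map (↑)).map ((γ : SL(2, ℤ)) * ·) := by
  simp [Function.comp_def]

/-- The inhomogeneous cocycle of an invariant cocycle on cliques. -/
theorem exists_cocycle_of_cliques (h : ∀ t, IsProjectionAt y t) {w : List SL(2, ℤ) → ℤ}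
    (hw : ∀ γ ∈ Γ, ∀ t, w (t.map (γ * ·)) = w t)
    (hd : ∀ t ∈ cliques ellipticRel, coboundary w t = 0) (m : ℕ) :
    ∃ z : cocycles (Rep.trivial ℤ Γ ℤ) m, ∀ x, cocycleValue z x =
      extendCochain y w ((homTuple (List.ofFn x)).map (↑)) := by
  refine exists_cocycle_of_invariant (f := fun t => extendCochain y w (t.map Subtype.val))
    (fun γ t => ?_) (fun t => ?_) m
  · rw [map_coe_smul, extendCochain_smul (hw γ γ.2)]
  · exact (chainEval_faces_map _ _ t).trans ((coboundary_extendCochain h w _).trans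
      ((extendCochain_congr h hd _).trans (extendCochain_zero _)))

/-- The homogeneous cochain on `SL₂(ℤ)` of an inhomogeneous cochain on `Γ`. -/
noncomputable def retractCochain (hL : IsCosetSystem Γ L) {m : ℕ} (z : (Fin m → Γ) → ℤ)
    (t : List SL(2, ℤ)) : ℤ := homogenize z (t.map (cosetRetraction hL))

theorem map_cosetRetraction_smul (hL : IsCosetSystem Γ L) (γ : Γ) (t : List SL(2, ℤ)) :
    (t.map ((γ : SL(2, ℤ)) * ·)).map (cosetRetraction hL) =
      (t.map (cosetRetraction hL)).map (γ * ·) := by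
  simp [Function.comp_def, cosetRetraction_mul]

theorem isInvariantCochain_retractCochain (hL : IsCosetSystem Γ L) {m : ℕ}
    (z : (Fin m → Γ) → ℤ) : IsInvariantCochain Γ (m + 1) (retractCochain hL z) where
  smul γ hγ t := by
    rw [retractCochain, map_cosetRetraction_smul hL ⟨γ, hγ⟩, homogenize_smul, retractCochain]
  of_length_ne t ht := homogenize_of_length_ne z (by rwa [List.length_map])
  nil := homogenize_of_length_ne z (by simp)

theorem coboundary_retractCochain (hL : IsCosetSystem Γ L) {m : ℕ}
    (z : cocycles (Rep.trivial ℤ Γ ℤ) m) (t : List SL(2, ℤ)) :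
    coboundary (retractCochain hL (cocycleValue z)) t = 0 :=
  (chainEval_faces_map _ _ t).trans (chainEval_homogenize_cocycle z _)

theorem map_cosetRetraction_coe (hL : IsCosetSystem Γ L) (t : List Γ) :
    (t.map ((↑) : Γ → SL(2, ℤ))).map (cosetRetraction hL) = t := by
  rw [List.map_map]
  conv_rhs => rw [← List.map_id t]
  exact List.map_congr_left fun γ _ => cosetRetraction_coe hL γ

theorem retractCochain_coe (hL : IsCosetSystem Γ L) {m : ℕ} (z : (Fin m → Γ) → ℤ)
    (x : Fin m → Γ) : retractCochain hL z ((homTuple (List.ofFn x)).map (↑)) = z x := by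
  rw [retractCochain, map_cosetRetraction_coe, homogenize_homTuple]

/-- The composite of the retraction onto `Γ` with the inclusion into `SL₂(ℤ)` is homotopic to the
projection onto cliques. -/
theorem extendCochain_sub_eq_coboundary (hL : IsCosetSystem Γ L) (h : ∀ t, IsProjectionAt y t)
    {f : List SL(2, ℤ) → ℤ} (hf : ∀ t, coboundary f t = 0)
    (hinv : ∀ γ ∈ Γ, ∀ t, f (t.map (γ * ·)) = f t) :
    ∃ u : List SL(2, ℤ) → ℤ, (∀ γ ∈ Γ, ∀ t, u (t.map (γ * ·)) = u t) ∧ u [] = 0 ∧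
      ∀ t, extendCochain y f t - f (t.map fun g => (cosetRetraction hL g : SL(2, ℤ))) =
        coboundary u t := by
  refine ⟨fun s => chainEval f (tupleHomotopy (chainExtension y)
    (fun g => (cosetRetraction hL g : SL(2, ℤ))) s), fun γ hγ t => ?_, ?_, fun t => ?_⟩
  · refine chainEval_tupleHomotopy_map (α := (γ * ·)) (α' := (γ * ·))
      (chainExtension_equivariant γ) (fun x => ?_) (hinv γ hγ) t
    exact congrArg Subtype.val (cosetRetraction_mul hL ⟨γ, hγ⟩ x)
  · dsimp only
    rw [tupleHomotopy, map_zero]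
  · rw [← chainEval_sub_eq_coboundary _ (chainExtension_chainBoundary h) (by
      rw [chainExtension_single, tupleExtension]) hf, chainExtension_single, extendCochain]

/-- The projection onto cliques is equivariantly homotopic to the retraction onto `Γ`, and the
retraction gives `z` back on tuples in `Γ`. This yields both the surjectivity of the presentation
and the correctness of the coordinates. -/
theorem cohomologyClass_eq_of_cliques (hL : IsCosetSystem Γ L) (h : ∀ t, IsProjectionAt y t)
    {m : ℕ} {z z' : cocycles (Rep.trivial ℤ Γ ℤ) m} {w : List SL(2, ℤ) → ℤ}
    (hw : ∀ t ∈ cliques ellipticRel, w t = retractCochain hL (cocycleValue z) t)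
    (hz' : ∀ x, cocycleValue z' x = extendCochain y w ((homTuple (List.ofFn x)).map (↑))) :
    cohomologyClass z' = cohomologyClass z := by
  obtain ⟨u, hu, hu0, hu1⟩ := extendCochain_sub_eq_coboundary hL h
    (coboundary_retractCochain hL z) (isInvariantCochain_retractCochain hL _).smul
  refine cohomologyClass_eq_of_invariant (u := fun t => u (t.map Subtype.val)) (fun γ t => ?_) hu0
    fun x => ?_
  · rw [map_coe_smul, hu γ γ.2]
  · refine Eq.trans ?_ (chainEval_faces_map u Subtype.val _).symm
    rw [← hu1, hz', extendCochain_congr h hw, ← retractCochain_coe hL (cocycleValue z) x]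
    congr 2
    have := congrArg (List.map Subtype.val) (map_cosetRetraction_coe hL (homTuple (List.ofFn x)))
    rw [← this, List.map_map]
    simp [Function.comp_def, cosetRetraction_coe]

/-- The injectivity on cohomology. On cliques `w` agrees with its extension, which differs from its
pullback along the retraction by the coboundary of a homotopy term. That pullback is the coboundary
of a primitive on `Γ`, pulled back in the same way; the primitive for `w` is the sum of the two. -/
theorem exists_invariantCochain_of_cohomologyClass_eq_zero (hL : IsCosetSystem Γ L)
    (h : ∀ t, IsProjectionAt y t) {m : ℕ} {z : cocycles (Rep.trivial ℤ Γ ℤ) m}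
    {w : List SL(2, ℤ) → ℤ} (hw : ∀ γ ∈ Γ, ∀ t, w (t.map (γ * ·)) = w t)
    (hd : ∀ t ∈ cliques ellipticRel, coboundary w t = 0)
    (hz : ∀ x, cocycleValue z x = extendCochain y w ((homTuple (List.ofFn x)).map (↑)))
    (h0 : cohomologyClass z = 0) :
    ∃ u, IsInvariantCochain Γ m u ∧
      ∀ t ∈ cliques ellipticRel, t.length = m + 1 → w t = coboundary u t := by
  have hinv : ∀ γ ∈ Γ, ∀ t, extendCochain y w (t.map (γ * ·)) = extendCochain y w t :=
    fun γ hγ => extendCochain_smul (hw γ hγ)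
  obtain ⟨u, hu, hu0, hu1⟩ := extendCochain_sub_eq_coboundary hL h (f := extendCochain y w)
    (fun t => (coboundary_extendCochain h w _).trans ((extendCochain_congr h hd _).trans
      (extendCochain_zero _))) hinv
  obtain ⟨u', hu', hu0', -, hu1'⟩ := exists_invariant_of_cohomologyClass_eq_zero h0
  let v : List SL(2, ℤ) → ℤ := fun t => u t + u' (t.map (cosetRetraction hL))
  have hv : ∀ γ ∈ Γ, ∀ t, v (t.map (γ * ·)) = v t := fun γ hγ t => by
    dsimp only [v]
    rw [hu γ hγ, map_cosetRetraction_smul hL ⟨γ, hγ⟩, hu']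
  -- Cutting off at length `m` does not affect the coboundary at tuples of length `m + 1`. For `m =
  -- 0` it matters that both summands vanish at the empty tuple.
  refine ⟨fun t => if t.length = m then v t else 0, ⟨fun γ hγ t => ?_, fun t ht => if_neg ht, ?_⟩,
    fun t ht hm => ?_⟩
  · simp only [List.length_map, hv γ hγ]
  · simp [v, hu0, hu0']
  · rw [coboundary_congr_length (g := v) hm fun s hs => if_pos hs]
    have h1 : coboundary v t = coboundary u t +
        coboundary (fun s => u' (s.map (cosetRetraction hL))) t := coboundary_add _ _ t
    have h2 := hu1 t
    rw [extendCochain_congr h (fun s hs => extendCochain_of_mem h w hs),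
      extendCochain_of_mem h w ht] at h2
    rw [h1, chainEval_faces_map u' (cosetRetraction hL), ← h2, coboundary, ← hu1']
    have h3 : (t.map (cosetRetraction hL)).length = m + 1 := by rwa [List.length_map]
    have h4 : t.map (fun g => (cosetRetraction hL g : SL(2, ℤ))) =
        (t.map (cosetRetraction hL)).map (↑) := by simp [Function.comp_def]
    rw [h4]
    obtain ⟨g, x, hx⟩ := exists_smul_homTuple h3
    rw [hx, homogenize_smul, homogenize_homTuple, hz, map_coe_smul, hinv g g.2, sub_add_cancel]

/-- Cohomology in degree `m` belongs to cliques of length `m + 1`. The map `e` extends the clique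
cocycle `E v` to all tuples and restricts it to `Γ`; conversely the coordinates of `z` are read off
from its retracted cochain at orbit representatives. The two preceding comparison results turn the
presentation of clique cohomology into one of group cohomology. -/
theorem exists_cohomology_presentation (hL : IsCosetSystem Γ L) (h : ∀ t, IsProjectionAt y t)
    {m r : ℕ} {d : Fin r → ℕ} {E : Matrix (Fin (orbitList L (m + 1)).length) (Fin r) ℤ}
    {Q : Matrix (Fin r) (Fin (orbitList L (m + 1)).length) ℤ}
    (hp : IsHomologyPresentation (coboundaryMatrix Γ L m) (coboundaryMatrix Γ L (m + 1)) d E Q) :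
    ∃ e : (Fin r → ℤ) →+ integralCohomology Γ m,
      Function.Surjective e ∧
      (∀ v, e v = 0 ↔ ∀ i, (d i : ℤ) ∣ v i) ∧
      (∀ v, ∃ z : cocycles (Rep.trivial ℤ Γ ℤ) m, cohomologyClass z = e v ∧
        ∀ x : Fin m → Γ, cocycleValue z x =
          extendCochain y (orbitCochain Γ (orbitList L (m + 1)) (E.mulVec v))
            (homTuple (List.ofFn fun i => (x i : SL(2, ℤ))))) ∧
      ∀ z : cocycles (Rep.trivial ℤ Γ ℤ) m, e (Q.mulVec
        (orbitValues (orbitList L (m + 1)) (retractCochain hL (cocycleValue z)))) =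
          cohomologyClass z := by
  have hE : ∀ v, ∀ t ∈ cliques ellipticRel,
      coboundary (orbitCochain Γ (orbitList L (m + 1)) (E.mulVec v)) t = 0 := fun v =>
    (mulVec_eq_zero_iff hL _).1 (hp.cycle v)
  have hinv := fun v => (isInvariantCochain_orbitCochain (Γ := Γ) L (m + 1) (E.mulVec v)).smul
  choose Z hZ using fun v => exists_cocycle_of_cliques h (hinv v) (hE v) m
  have hadd : ∀ v v', Z (v + v') = Z v + Z v' := fun v v' => cocycle_ext fun x => by
    have : cocycleValue (Z v + Z v') x = cocycleValue (Z v) x + cocycleValue (Z v') x := by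
      rw [cocycleValue, map_add]
      rfl
    rw [this, hZ, hZ, hZ, Matrix.mulVec_add, extendCochain_orbitCochain_add]
  let e : (Fin r → ℤ) →+ integralCohomology Γ m :=
    AddMonoidHom.mk' (fun v => cohomologyClass (Z v)) fun v v' => by
      rw [hadd, cohomologyClass, map_add]
  have he : ∀ z : cocycles (Rep.trivial ℤ Γ ℤ) m, e (Q.mulVec
      (orbitValues (orbitList L (m + 1)) (retractCochain hL (cocycleValue z)))) =
        cohomologyClass z := by
    intro z
    refine cohomologyClass_eq_of_cliques hL h (fun t ht => ?_) (hZ _)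
    have h1 := fun (t : List SL(2, ℤ)) (ht : t ∈ cliques ellipticRel) =>
      orbitCochain_orbitValues hL (isInvariantCochain_retractCochain hL (cocycleValue z)) ht
    rw [hp.coordinates, h1 t ht]
    rw [mulVec_eq_zero_iff hL]
    intro s hs
    rw [coboundary_congr h1 hs, coboundary_retractCochain]
  refine ⟨e, fun c => ?_, fun v => ?_, fun v => ⟨Z v, rfl, fun x => ?_⟩, he⟩
  · induction c using groupCohomology_induction_on with
    | h z => exact ⟨_, he z⟩
  · rw [← hp.boundary_iff]
    constructor
    · intro h0
      obtain ⟨u, hu, hu1⟩ := exists_invariantCochain_of_cohomologyClass_eq_zero hL h (hinv v) (hE v)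
        (hZ v) h0
      refine ⟨orbitValues (orbitList L m) u, ?_⟩
      rw [coboundaryMatrix_mulVec, ← orbitValues_orbitCochain hL (E.mulVec v)]
      funext i
      obtain ⟨h1, _, h3⟩ := orbitList_spec (List.get_mem (orbitList L (m + 1)) i)
      refine (hu1 _ h3 h1).trans (coboundary_congr (fun s hs => ?_) h3)
      rw [orbitCochain_orbitValues hL hu hs]
    · rintro ⟨a, ha⟩
      have hc := isInvariantCochain_orbitCochain (Γ := Γ) L m a
      refine cohomologyClass_eq_zero_of_invariant
        (u := fun t => extendCochain y (orbitCochain Γ (orbitList L m) a) (t.map (↑)))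
        (fun γ t => ?_) ?_ fun x => ?_
      · rw [map_coe_smul, extendCochain_smul (hc.smul γ γ.2)]
      · exact (extendCochain_nil _).trans hc.nil
      · refine Eq.trans ?_ (chainEval_faces_map _ _ _).symm
        rw [hZ, coboundary_extendCochain h]
        refine extendCochain_congr h (fun s hs => ?_) _
        rw [coboundary_orbitCochain hL a hs, ha]
  · rw [hZ]
    congr 1
    have := homTuple_map Γ.subtype (List.ofFn x)
    rw [List.map_ofFn] at this
    exact this.symm

end CliqueCohomology

/-! ### The transfer computed with an arbitrary equivariant map. -/

section TransferOnCocycles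

open CategoryTheory groupCohomology

theorem differences_ofFn {H : Type*} [Group H] {n : ℕ} (p : Fin (n + 1) → H) :
    differences (List.ofFn p) = List.ofFn fun i : Fin n => (p i.castSucc)⁻¹ * p i.succ := by
  induction n with
  | zero => simp [differences_singleton]
  | succ n ih =>
    have h := ih (Fin.tail p)
    rw [List.ofFn_succ] at h
    rw [List.ofFn_succ, List.ofFn_succ, differences_cons_cons, List.ofFn_succ]
    congr 1

theorem coboundary_sum {X ι : Type*} (s : Finset ι) (f : ι → List X → ℤ) (t : List X) :
    coboundary (fun u => ∑ i ∈ s, f i u) t = ∑ i ∈ s, coboundary (f i) t := by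
  have : chainEval (fun u => ∑ i ∈ s, f i u) = ∑ i ∈ s, chainEval (f i) := chain_hom_ext fun u => by
    simp [chainEval_single, LinearMap.sum_apply]
  rw [coboundary, this, LinearMap.sum_apply]
  rfl

variable {G : Type} [Group G]

/-- The equivariant map `x ↦ x r(x)⁻¹` given by the chosen representatives of right cosets. -/
noncomputable def cosetMap (S : Subgroup G) (x : G) : S :=
  ⟨x * (cosetRep S x)⁻¹, cosetRep_mul_inv_mem S x⟩

theorem cosetMap_mul (S : Subgroup G) (s : S) (x : G) : cosetMap S (s * x) = s * cosetMap S x := by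
  have : cosetRep S (s * x) = cosetRep S x := (cosetRep_congr S (by simp)).symm
  apply Subtype.ext
  simp only [cosetMap, this, Subgroup.coe_mul, mul_assoc]

/-- This identifies the tuple in the definition of the transfer as the inhomogeneous form of a
translated tuple that is retracted by `cosetMap`, so that `cosetMap` can then be exchanged for
another equivariant map. -/
theorem differences_cosetMap (S : Subgroup G) (x : G) {m : ℕ} (g : Fin m → G) :
    differences (((homTuple (List.ofFn g)).map (x * ·)).map (cosetMap S)) =
      List.ofFn (cosetTuple S x g) := by
  rw [homTuple_ofFn, List.map_ofFn, List.map_ofFn, differences_ofFn]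
  congr 1
  funext i
  apply Subtype.ext
  simp [cosetMap, cosetTuple, Fin.partialProd_succ, mul_assoc]

theorem sum_rightCosets_mul (S : Subgroup G) [S.FiniteIndex] {φ : G → ℤ}
    (hφ : ∀ (s : S) (x : G), φ (s * x) = φ x) (y : G) :
    ∑ q : Quotient (QuotientGroup.rightRel S), φ (q.out * y) =
      ∑ q : Quotient (QuotientGroup.rightRel S), φ q.out := by
  refine Fintype.sum_equiv (rightCosetsTranslate S y) _ _ fun q => ?_
  change _ = φ (cosetRep S (q.out * y))
  have h := hφ (cosetMap S (q.out * y)) (cosetRep S (q.out * y))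
  rwa [cosetMap, inv_mul_cancel_right] at h

/-- Only the coset of `x` contributes to the sum. Written in this way, a value of `φ` can be summed
over another system of representatives by exchanging sums. -/
theorem eq_sum_rightCosets (S : Subgroup G) [S.FiniteIndex] {φ c : G → ℤ}
    (hφ : ∀ (s : S) (x : G), φ (s * x) = φ x) (h1 : ∀ x ∈ S, c x = 1) (h0 : ∀ x ∉ S, c x = 0)
    (x : G) :
    φ x = ∑ q : Quotient (QuotientGroup.rightRel S), c (q.out * x⁻¹) * φ q.out := by
  have hr : x * (cosetRep S x)⁻¹ ∈ S := cosetRep_mul_inv_mem S x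
  rw [Finset.sum_eq_single (Quotient.mk _ x)]
  · change φ x = c (cosetRep S x * x⁻¹) * φ (cosetRep S x)
    have h := hφ ⟨_, hr⟩ (cosetRep S x)
    rw [inv_mul_cancel_right] at h
    rw [h1 _ (by simpa using inv_mem hr), one_mul, h]
  · intro q _ hq
    rw [h0 _ fun h => hq ?_, zero_mul]
    rw [← Quotient.out_eq q]
    exact (Quotient.sound (s := QuotientGroup.rightRel S) (QuotientGroup.rightRel_apply.2 h)).symm
  · simp

theorem map_smul_smul {H : Type*} [Group H] (x y : H) (t : List H) :
    (t.map (y * ·)).map (x * ·) = t.map (x * y * ·) := by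
  simp [Function.comp_def, mul_assoc]

theorem map_smul_equivariant {S : Subgroup G} {ρ : G → S}
    (hρ : ∀ (s : S) (x : G), ρ (s * x) = s * ρ x) (s : S) (t : List G) :
    (t.map ((s : G) * ·)).map ρ = (t.map ρ).map (s * ·) := by
  simp [Function.comp_def, hρ]

theorem sum_rightCosets_smul (S : Subgroup G) [S.FiniteIndex] {f : List G → ℤ}
    (hf : ∀ (s : S) t, f (t.map ((s : G) * ·)) = f t) (y : G) (t : List G) :
    ∑ q : Quotient (QuotientGroup.rightRel S), f ((t.map (y * ·)).map (q.out * ·)) =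
      ∑ q : Quotient (QuotientGroup.rightRel S), f (t.map (q.out * ·)) := by
  simp only [map_smul_smul]
  refine sum_rightCosets_mul S (φ := fun x => f (t.map (x * ·))) (fun s x => ?_) y
  rw [← hf s (t.map (x * ·)), map_smul_smul]

/-- The transfer can be computed with any equivariant map from the group to the subgroup. -/
theorem exists_transfer_cocycle (S : Subgroup G) [S.FiniteIndex] {ρ : G → S}
    (hρ : ∀ (s : S) (x : G), ρ (s * x) = s * ρ x) {m : ℕ} (z : cocycles (Rep.trivial ℤ S ℤ) m) :
    ∃ z' : cocycles (Rep.trivial ℤ G ℤ) m,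
      cohomologyClass z' = (transfer S m).hom (cohomologyClass z) ∧
      ∀ x, cocycleValue z' x = ∑ q : Quotient (QuotientGroup.rightRel S),
        homogenize (cocycleValue z) (((homTuple (List.ofFn x)).map (q.out * ·)).map ρ) := by
  have hinv : ∀ {ρ' : G → S} (_ : ∀ (s : S) (x : G), ρ' (s * x) = s * ρ' x) (s : S) (t : List G),
      homogenize (cocycleValue z) ((t.map ((s : G) * ·)).map ρ') =
        homogenize (cocycleValue z) (t.map ρ') := fun hρ' s t => by
    rw [map_smul_equivariant hρ', homogenize_smul]
  obtain ⟨z', hz'⟩ := exists_cocycle_of_invariant (H := G)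
    (f := fun t => ∑ q : Quotient (QuotientGroup.rightRel S),
      homogenize (cocycleValue z) ((t.map (q.out * ·)).map ρ))
    (fun y t => sum_rightCosets_smul S
      (f := fun t => homogenize (cocycleValue z) (t.map ρ)) (hinv hρ) y t)
    (fun t => by
      refine (coboundary_sum _ _ t).trans (Finset.sum_eq_zero fun q _ => ?_)
      simp only [List.map_map]
      exact (chainEval_faces_map _ _ t).trans (chainEval_homogenize_cocycle z _)) m
  refine ⟨z', ?_, hz'⟩
  let zσ : cocycles (Rep.trivial ℤ G ℤ) m :=
    (HomologicalComplex.cyclesMap (transferCochainMap S) m).hom z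
  have h1 : cohomologyClass zσ = (transfer S m).hom (cohomologyClass z) :=
    (LinearMap.congr_fun (congrArg ModuleCat.Hom.hom
      (HomologicalComplex.homologyπ_naturality (transferCochainMap S) m)) z).symm
  have h2 : ∀ x, cocycleValue zσ x = ∑ q : Quotient (QuotientGroup.rightRel S),
      homogenize (cocycleValue z)
        (((homTuple (List.ofFn x)).map (q.out * ·)).map (cosetMap S)) := by
    intro x
    have h3 := congrFun (LinearMap.congr_fun (congrArg ModuleCat.Hom.hom
      (HomologicalComplex.cyclesMap_i (transferCochainMap S) m)) z) x
    refine h3.trans (Finset.sum_congr rfl fun q _ => ?_)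
    refine Eq.trans ?_ (homogenize_apply _ (by simp [length_homTuple])
      (differences_cosetMap S q.out x)).symm
    rfl
  rw [← h1]
  symm
  -- The value of `z` on the homotopy between the chain maps induced by `cosetMap S` and `ρ`. Summed
  -- over the right cosets, it gives a `G`-invariant cochain whose coboundary is the difference of
  -- the two cocycles.
  let κ : List G → ℤ := fun s => chainEval (homogenize (cocycleValue z))
    (tupleHomotopy (chainMap (cosetMap S)) ρ s)
  have hκ : ∀ (s : S) t, κ (t.map ((s : G) * ·)) = κ t := fun s t =>
    chainEval_tupleHomotopy_map (α := ((s : G) * ·)) (α' := (s * ·)) (fun c => by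
      rw [chainMap_chainMap, chainMap_chainMap]
      congr 1
      simp only [Function.comp_def, cosetMap_mul]) (hρ s) (homogenize_smul _ s) t
  refine cohomologyClass_eq_of_invariant
    (u := fun t => ∑ q : Quotient (QuotientGroup.rightRel S), κ (t.map (q.out * ·)))
    (fun y t => sum_rightCosets_smul S hκ y t) ?_ fun x => ?_
  · simp [κ, tupleHomotopy]
  · rw [h2, hz', ← Finset.sum_sub_distrib]
    refine Eq.trans (Finset.sum_congr rfl fun q _ => ?_) (coboundary_sum _ _ _).symm
    rw [chainEval_faces_map κ (q.out * ·), ← chainEval_sub_eq_coboundary ρ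
      (fun c => (chainMap_chainBoundary _ c).symm) (by rw [chainMap_single, List.map_nil])
      (fun t => chainEval_homogenize_cocycle z t), chainMap_single, chainEval_single, one_mul]

end TransferOnCocycles

/-! ### An explicit cocycle for the image under a Hecke operator. -/

section HeckeOnCocycles

open CategoryTheory groupCohomology Matrix.SpecialLinearGroup

/-- The matrix with rows `(a, b / n)` and `(n c, d)`, for a matrix with rows `(a, b)` and `(c, d)`.
-/
def heckeScale (n : ℕ) (A : SL(2, ℤ)) : SL(2, ℤ) :=
  ofEntries (A 0 0, intDivNat (A 0 1) n, n * A 1 0, A 1 1)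

attribute [irreducible] heckeScale

theorem coe_heckeMatrix (n : ℕ+) :
    (heckeMatrix n : Matrix (Fin 2) (Fin 2) ℚ) = !![1, 0; 0, 1 / (n : ℚ)] := rfl

/-- Moving the inverse to the other side gives an equation without it; comparing entries and
clearing the denominator `n` leaves conditions over the integers. -/
theorem mapGL_eq_conj_iff (n : ℕ+) (A B : SL(2, ℤ)) :
    mapGL ℚ B = (heckeMatrix n)⁻¹ * mapGL ℚ A * heckeMatrix n ↔
      A 0 0 = B 0 0 ∧ A 0 1 = n * B 0 1 ∧ n * A 1 0 = B 1 0 ∧ A 1 1 = B 1 1 := by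
  have hn : (n : ℚ) ≠ 0 := by exact_mod_cast n.ne_zero
  have h1 : mapGL ℚ B = (heckeMatrix n)⁻¹ * mapGL ℚ A * heckeMatrix n ↔
      heckeMatrix n * mapGL ℚ B = mapGL ℚ A * heckeMatrix n := by
    rw [mul_assoc, eq_inv_mul_iff_mul_eq]
  have h2 : ∀ C : SL(2, ℤ), ((mapGL ℚ C : GL (Fin 2) ℚ) : Matrix (Fin 2) (Fin 2) ℚ) =
      !![(C 0 0 : ℚ), C 0 1; C 1 0, C 1 1] := by
    intro C
    ext i j
    fin_cases i <;> fin_cases j <;> simp [mapGL]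
  rw [h1, ← Units.val_inj, Units.val_mul, Units.val_mul, h2, h2, coe_heckeMatrix,
    ← Matrix.ext_iff]
  simp only [Fin.forall_fin_two, Matrix.mul_apply, Fin.sum_univ_two]
  simp only [Matrix.of_apply, Matrix.cons_val', Matrix.cons_val_zero, Matrix.cons_val_one,
    one_mul, zero_mul, mul_zero, add_zero, zero_add, mul_one, Matrix.cons_val_fin_one]
  constructor
  · rintro ⟨⟨h3, h4⟩, h5, h6⟩
    refine ⟨by exact_mod_cast h3.symm, ?_, ?_, ?_⟩
    · field_simp at h4
      exact_mod_cast (by linarith : ((A 0 1 : ℤ) : ℚ) = n * (B 0 1 : ℤ))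
    · field_simp at h5
      exact_mod_cast (by linarith : (n : ℚ) * ((A 1 0 : ℤ) : ℚ) = (B 1 0 : ℤ))
    · field_simp at h6
      exact_mod_cast h6.symm
  · rintro ⟨h3, h4, h5, h6⟩
    rw [h3, h4, ← h5, h6]
    push_cast
    refine ⟨⟨rfl, ?_⟩, ?_, ?_⟩ <;> field_simp

theorem eq_heckeScale {n : ℕ+} {A B : SL(2, ℤ)}
    (h : A 0 0 = B 0 0 ∧ A 0 1 = n * B 0 1 ∧ n * A 1 0 = B 1 0 ∧ A 1 1 = B 1 1) :
    B = heckeScale n A := by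
  obtain ⟨h1, h2, h3, h4⟩ := h
  have : (A 0 0, intDivNat (A 0 1) n, ((n : ℕ) : ℤ) * A 1 0, A 1 1) = matrixEntries B := by
    rw [matrixEntries, h1, h2, h4, intDivNat_mul _ n.pos]
    exact congrArg₂ _ rfl (congrArg₂ _ rfl (congrArg₂ _ h3 rfl))
  rw [heckeScale, this, ofEntries_matrixEntries]

/-- Exact divisibility makes the scaled entries have determinant one, so `ofEntries` does not fall
back on the identity. -/
theorem heckeScale_apply {n : ℕ} {A : SL(2, ℤ)} (h : (n : ℤ) * intDivNat (A 0 1) n = A 0 1) :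
    heckeScale n A 0 0 = A 0 0 ∧ heckeScale n A 0 1 = intDivNat (A 0 1) n ∧
      heckeScale n A 1 0 = n * A 1 0 ∧ heckeScale n A 1 1 = A 1 1 := by
  have hdet : A 0 0 * A 1 1 - intDivNat (A 0 1) n * ((n : ℤ) * A 1 0) = 1 := by
    have := det_entries A
    linear_combination this - A 1 0 * h
  have h3 : matrixEntries (heckeScale n A) =
      (A 0 0, intDivNat (A 0 1) n, (n : ℤ) * A 1 0, A 1 1) := by
    rw [heckeScale, matrixEntries_ofEntries]
    exact hdet
  simp only [matrixEntries, Prod.mk.injEq] at h3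
  exact h3

theorem heckeConj_eq (Γ : Subgroup SL(2, ℤ)) (n : ℕ+) (γ : heckeSubgroup Γ (heckeMatrix n)) :
    (heckeConj Γ (heckeMatrix n) γ : SL(2, ℤ)) = heckeScale n ((γ : Γ) : SL(2, ℤ)) :=
  eq_heckeScale ((mapGL_eq_conj_iff n _ _).1 (mapGL_heckeConj Γ (heckeMatrix n) γ))

/-- The subgroup `Γ ∩ g Γ g⁻¹` for `g = diag(1, 1/n)`, as a subgroup of `SL₂(ℤ)`. -/
noncomputable def heckeIntersection (Γ : Subgroup SL(2, ℤ)) (n : ℕ+) : Subgroup SL(2, ℤ) :=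
  (heckeSubgroup Γ (heckeMatrix n)).map Γ.subtype

/-- The conjugate of `A` is integral exactly if `n` divides the upper right entry, and then it is
`heckeScale n A`. The criterion can be decided by a membership test for `Γ`. -/
theorem mem_heckeIntersection {Γ : Subgroup SL(2, ℤ)} {n : ℕ+} {A : SL(2, ℤ)} :
    A ∈ heckeIntersection Γ n ↔
      A ∈ Γ ∧ (n : ℤ) * intDivNat (A 0 1) n = A 0 1 ∧ heckeScale n A ∈ Γ := by
  have key : ∀ γ : Γ, γ ∈ heckeSubgroup Γ (heckeMatrix n) ↔ ∃ B ∈ Γ,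
      (γ : SL(2, ℤ)) 0 0 = B 0 0 ∧ (γ : SL(2, ℤ)) 0 1 = n * B 0 1 ∧
        n * (γ : SL(2, ℤ)) 1 0 = B 1 0 ∧ (γ : SL(2, ℤ)) 1 1 = B 1 1 := by
    intro γ
    rw [heckeSubgroup, Subgroup.mem_comap, Subgroup.mem_map]
    refine exists_congr fun B => and_congr_right fun _ => ?_
    rw [← mapGL_eq_conj_iff]
    have : conjToGL Γ (heckeMatrix n) γ =
        (heckeMatrix n)⁻¹ * mapGL ℚ (γ : SL(2, ℤ)) * heckeMatrix n := by
      change (heckeMatrix n)⁻¹ * mapGL ℚ (γ : SL(2, ℤ)) * (heckeMatrix n)⁻¹⁻¹ = _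
      rw [inv_inv]
    rw [this]
  rw [heckeIntersection, Subgroup.mem_map]
  constructor
  · rintro ⟨γ, hγ, rfl⟩
    obtain ⟨B, hB, h⟩ := (key γ).1 hγ
    refine ⟨γ.2, ?_, ?_⟩
    · change (n : ℤ) * intDivNat ((γ : SL(2, ℤ)) 0 1) n = (γ : SL(2, ℤ)) 0 1
      rw [h.2.1, intDivNat_mul _ n.pos]
    · change heckeScale n (γ : SL(2, ℤ)) ∈ Γ
      rwa [← eq_heckeScale h]
  · rintro ⟨hA, h1, h2⟩
    refine ⟨⟨A, hA⟩, (key _).2 ⟨_, h2, ?_⟩, rfl⟩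
    obtain ⟨h3, h4, h5, h6⟩ := heckeScale_apply h1
    exact ⟨h3.symm, by rw [h4, h1], h5.symm, h6.symm⟩

/-- The tuple in `Γ ∩ g Γ g⁻¹` that is obtained from the translate by `p` of the homogeneous form of
a tuple `l`, conjugated into `Γ`. -/
noncomputable def heckeTuple (Γ : Subgroup SL(2, ℤ)) (n : ℕ+) (P : List SL(2, ℤ))
    (l : List SL(2, ℤ)) (p : SL(2, ℤ)) : List SL(2, ℤ) :=
  (differences ((homTuple l).map fun g =>
    p * g * (representativeIn (heckeIntersection Γ n) P (p * g))⁻¹)).map (heckeScale n)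

variable {Γ : Subgroup SL(2, ℤ)} {n : ℕ+} {P : List SL(2, ℤ)}

/-- The equivariant map from `Γ` to `Γ ∩ g Γ g⁻¹` given by a system of representatives. -/
noncomputable def heckeRetraction (hP : IsCosetSystem (heckeIntersection Γ n) P) (γ : Γ) :
    heckeSubgroup Γ (heckeMatrix n) :=
  ⟨⟨γ * (representativeIn (heckeIntersection Γ n) P γ)⁻¹,
    (mem_heckeIntersection.1 (hP.mul_representativeIn_inv_mem (γ : SL(2, ℤ)))).1⟩, by
    obtain ⟨γ', h, h'⟩ := Subgroup.mem_map.1 (hP.mul_representativeIn_inv_mem (γ : SL(2, ℤ)))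
    have : γ' = ⟨_, (mem_heckeIntersection.1 (hP.mul_representativeIn_inv_mem (γ : SL(2, ℤ)))).1⟩ :=
      Subtype.ext h'
    rwa [← this]⟩

theorem heckeRetraction_mul (hP : IsCosetSystem (heckeIntersection Γ n) P)
    (s : heckeSubgroup Γ (heckeMatrix n)) (γ : Γ) :
    heckeRetraction hP (s * γ) = s * heckeRetraction hP γ := by
  apply Subtype.ext
  apply Subtype.ext
  have hs : ((s : Γ) : SL(2, ℤ)) ∈ heckeIntersection Γ n := Subgroup.mem_map.2 ⟨s, s.2, rfl⟩
  simp only [heckeRetraction, Subgroup.coe_mul, representativeIn_mul hs, mul_assoc]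

/-- The list `P` represents the cosets of the intersection in all of `SL₂(ℤ)`. The factor
`memberValue Γ p` keeps those that lie in `Γ`, so no separate search inside `Γ` is needed. -/
theorem sum_rightCosets_eq (hP : IsCosetSystem (heckeIntersection Γ n) P) [Γ.FiniteIndex]
    {φ : Γ → ℤ} (hφ : ∀ (s : heckeSubgroup Γ (heckeMatrix n)) (x : Γ), φ (s * x) = φ x)
    {φ' : SL(2, ℤ) → ℤ} (h : ∀ γ : Γ, φ' γ = φ γ) :
    ∑ q : Quotient (QuotientGroup.rightRel (heckeSubgroup Γ (heckeMatrix n))), φ q.out =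
      (P.map fun p => memberValue Γ p * φ' p).sum := by
  let χ := memberValue (heckeIntersection Γ n)
  have hmem : ∀ γ : Γ, (γ : SL(2, ℤ)) ∈ heckeIntersection Γ n ↔
      γ ∈ heckeSubgroup Γ (heckeMatrix n) := fun γ => by
    rw [heckeIntersection, Subgroup.mem_map]
    exact ⟨fun ⟨γ', h1, h2⟩ => by rwa [← Subtype.ext h2 (a1 := γ')], fun h => ⟨γ, h, rfl⟩⟩
  have h1 : ∀ p : SL(2, ℤ), memberValue Γ p * φ' p =
      ∑ q : Quotient (QuotientGroup.rightRel (heckeSubgroup Γ (heckeMatrix n))),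
        χ ((q.out : SL(2, ℤ)) * p⁻¹) * φ q.out := by
    intro p
    by_cases hp : p ∈ Γ
    · rw [memberValue_of_mem hp, one_mul, h ⟨p, hp⟩]
      exact eq_sum_rightCosets (G := Γ) _ hφ (c := fun γ => χ γ)
        (fun γ hγ => memberValue_of_mem ((hmem γ).2 hγ))
        (fun γ hγ => memberValue_of_notMem fun h => hγ ((hmem γ).1 h)) ⟨p, hp⟩
    · rw [memberValue_of_notMem hp, zero_mul]
      refine (Finset.sum_eq_zero fun q _ => ?_).symm
      rw [mul_eq_zero]
      refine Or.inl (memberValue_of_notMem fun h2 => hp ?_)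
      have h3 := (mem_heckeIntersection.1 h2).1
      rw [Subgroup.mul_mem_cancel_left Γ q.out.2] at h3
      exact inv_mem_iff.1 h3
  simp only [h1]
  rw [← sum_get]
  rw [Finset.sum_comm]
  refine Finset.sum_congr rfl fun q _ => ?_
  rw [← Finset.sum_mul, sum_get P fun p => χ ((q.out : SL(2, ℤ)) * p⁻¹), hP.sum, one_mul]

/-- Pull `z` back along the conjugation and take the transfer with the equivariant map given by `P`.
The sum over abstract cosets becomes a sum over `P`, and conjugation becomes `heckeScale`, so every
ingredient is computable. The function `R` stands for an extension of `z` to lists of matrices,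
whose values at tuples outside `Γ` are multiplied by zero or never used. -/
theorem exists_hecke_cocycle [Γ.FiniteIndex] (hP : IsCosetSystem (heckeIntersection Γ n) P) {m : ℕ}
    (z : cocycles (Rep.trivial ℤ Γ ℤ) m) {R : List SL(2, ℤ) → ℤ}
    (hR : ∀ x : Fin m → Γ, R (List.ofFn fun i => (x i : SL(2, ℤ))) = cocycleValue z x) :
    ∃ z' : cocycles (Rep.trivial ℤ Γ ℤ) m,
      cohomologyClass z' = (heckeOperator Γ (heckeMatrix n) m).hom (cohomologyClass z) ∧
      ∀ x : Fin m → Γ, cocycleValue z' x = (P.map fun p => memberValue Γ p *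
        R (heckeTuple Γ n P (List.ofFn fun i => (x i : SL(2, ℤ))) p)).sum := by
  let S := heckeSubgroup Γ (heckeMatrix n)
  let zS : cocycles (Rep.trivial ℤ S ℤ) m := (cocyclesMap (A := Rep.trivial ℤ Γ ℤ)
    (B := Rep.trivial ℤ S ℤ) (heckeConj Γ (heckeMatrix n)) (𝟙 _) m).hom z
  have h1 : cohomologyClass zS = (groupCohomology.map (A := Rep.trivial ℤ Γ ℤ)
      (B := Rep.trivial ℤ S ℤ) (heckeConj Γ (heckeMatrix n)) (𝟙 _) m).hom (cohomologyClass z) :=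
    (LinearMap.congr_fun (congrArg ModuleCat.Hom.hom
      (π_map (A := Rep.trivial ℤ Γ ℤ) (B := Rep.trivial ℤ S ℤ) (heckeConj Γ (heckeMatrix n))
        (𝟙 _) m)) z).symm
  have h2 : ∀ x : Fin m → S, cocycleValue zS x =
      cocycleValue z fun i => heckeConj Γ (heckeMatrix n) (x i) := fun x =>
    congrFun (LinearMap.congr_fun (congrArg ModuleCat.Hom.hom
      (HomologicalComplex.cyclesMap_i (cochainsMap (A := Rep.trivial ℤ Γ ℤ)
        (B := Rep.trivial ℤ S ℤ) (heckeConj Γ (heckeMatrix n)) (𝟙 _)) m)) z) x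
  obtain ⟨z', hz', hz''⟩ := exists_transfer_cocycle S (heckeRetraction_mul hP) zS
  refine ⟨z', ?_, fun x => ?_⟩
  · rw [hz', h1]
    rfl
  · rw [hz'']
    refine sum_rightCosets_eq hP (φ := fun γ => homogenize (cocycleValue zS)
      (((homTuple (List.ofFn x)).map (γ * ·)).map (heckeRetraction hP)))
      (φ' := fun p => R (heckeTuple Γ n P (List.ofFn fun i => (x i : SL(2, ℤ))) p))
      (fun s γ => ?_) fun γ => ?_
    · rw [← map_smul_smul, map_smul_equivariant (heckeRetraction_mul hP), homogenize_smul]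
    · let t := ((homTuple (List.ofFn x)).map (γ * ·)).map (heckeRetraction hP)
      have ht : t.length = m + 1 := by
        rw [List.length_map, List.length_map, length_homTuple, List.length_ofFn]
      obtain ⟨g, w, hw⟩ := exists_smul_homTuple ht
      have hd : differences t = List.ofFn w := by rw [hw, differences_smul, differences_homTuple]
      change _ = homogenize (cocycleValue zS) t
      rw [homogenize_apply _ ht hd, h2, ← hR]
      refine congrArg R ?_
      have h3 : (homTuple (List.ofFn fun i => (x i : SL(2, ℤ)))).map (fun g =>
          γ * g * (representativeIn (heckeIntersection Γ n) P (γ * g))⁻¹) =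
            t.map (Γ.subtype.comp S.subtype) := by
        have h4 := homTuple_map Γ.subtype (List.ofFn x)
        rw [List.map_ofFn] at h4
        refine (congrArg _ h4).trans ?_
        simp only [t, List.map_map]
        rfl
      rw [heckeTuple, h3, differences_map, hd, List.map_ofFn, List.map_ofFn]
      refine congrArg List.ofFn (funext fun i => ?_)
      exact (heckeConj_eq Γ n (w i)).symm

end HeckeOnCocycles

/-! ### Algorithms based on membership tests; search for coset systems. -/

section MembershipAlgorithms

open Nat.Partrec (Code)

/-- Programs for the values of a partial recursive function of two arguments, uniformly in the first
argument. -/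
theorem exists_uniform_code {α β σ : Type*} [Primcodable α] [Primcodable β] [Primcodable σ]
    {f : α → β → Part σ} (hf : Partrec₂ f) :
    ∃ K : α → Code, Computable K ∧
      ∀ a b, (K a).eval (Encodable.encode b) = (f a b).map Encodable.encode := by
  obtain ⟨k, hk⟩ := Code.exists_code.1 hf
  refine ⟨fun a => Code.curry k (Encodable.encode a), ?_, fun a b => ?_⟩
  · exact (Code.primrec₂_curry.comp (Primrec.const k) Primrec.encode).to_comp
  · rw [Code.eval_curry, hk, ← Encodable.encode_prod_val a b]
    dsimp only
    rw [Encodable.encodek]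
    exact Part.bind_some _ _

/-- The result, as an integer, of a membership test. -/
def runMember (c : Code) (A : SL(2, ℤ)) : Part ℤ :=
  (c.eval (Encodable.encode A)).map fun n : ℕ => (n : ℤ)

theorem runMember_eq {c : Code} {Γ : Subgroup SL(2, ℤ)} (h : IsMembershipTest c Γ)
    (A : SL(2, ℤ)) : runMember c A = Part.some (memberValue Γ A) := by
  by_cases hA : A ∈ Γ
  · rw [runMember, ← encode_matrixEntries, (h A).1 hA, memberValue_of_mem hA, Part.map_some]
    rfl
  · rw [runMember, ← encode_matrixEntries, (h A).2 hA, memberValue_of_notMem hA, Part.map_some]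
    rfl

theorem Partrec.runMember : Partrec₂ _root_.runMember :=
  Partrec.map (Code.eval_part.comp Computable.fst (Computable.encode.comp Computable.snd))
    (Primrec.int_natCast.comp Primrec.snd).to_comp.to₂

theorem Primrec.list_headD {α : Type*} [Primcodable α] (d : α) :
    Primrec fun l : List α => l.headD d :=
  (Primrec.option_getD.comp Primrec.list_head? (Primrec.const d)).of_eq fun l => by
    cases l <;> rfl

theorem Primrec.sl_mul_inv : Primrec₂ fun A B : SL(2, ℤ) => A * B⁻¹ :=
  Primrec.sl_mul.comp Primrec.fst (Primrec.sl_inv.comp Primrec.snd)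

/-- The matrices on which a list has to be tested in order to be a coset system. -/
def cosetTests (L : List SL(2, ℤ)) : List SL(2, ℤ) :=
  L.flatMap fun r => [1, ModularGroup.S, ModularGroup.S⁻¹, ModularGroup.T, ModularGroup.T⁻¹].map
    (r * ·)

theorem Primrec.cosetTests : Primrec cosetTests :=
  Primrec.list_flatMap Primrec.id (Primrec.list_map (Primrec.const _)
    (Primrec.sl_mul.comp (Primrec.snd.comp Primrec.fst) Primrec.snd))

/-- The tests at `r * s` for generators `s` and their inverses show that the union of the listed
cosets is stable under right multiplication by `SL₂(ℤ)`, hence is everything. The count at `A`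
depends only on the coset of `A`, so the tests at the representatives themselves settle uniqueness.
-/
theorem IsCosetSystem.of_tests {Γ : Subgroup SL(2, ℤ)} {L' : List SL(2, ℤ)}
    (h : ∀ A ∈ cosetTests (1 :: L'), ((1 :: L').map fun r => memberValue Γ (A * r⁻¹)).sum = 1) :
    IsCosetSystem Γ (1 :: L') := by
  have hmem : ∀ A, ((1 :: L').map fun r => memberValue Γ (A * r⁻¹)).sum = 1 →
      ∃ r ∈ 1 :: L', A * r⁻¹ ∈ Γ := fun A hA => by
    by_contra! h
    rw [List.map_congr_left (g := fun _ => 0) fun r hr => memberValue_of_notMem (h r hr)] at hA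
    simp at hA
  have hstep : ∀ s ∈ [1, ModularGroup.S, ModularGroup.S⁻¹, ModularGroup.T, ModularGroup.T⁻¹],
      ∀ A, (∃ r ∈ 1 :: L', A * r⁻¹ ∈ Γ) → ∃ r ∈ 1 :: L', A * s * r⁻¹ ∈ Γ := by
    rintro s hs A ⟨r, hr, hA⟩
    obtain ⟨r', hr', h'⟩ := hmem (r * s) (h _ (List.mem_flatMap.2 ⟨r, hr, List.mem_map.2
      ⟨s, hs, rfl⟩⟩))
    refine ⟨r', hr', ?_⟩
    have := mul_mem hA h'
    simpa [mul_assoc] using this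
  have hall : ∀ A : SL(2, ℤ), ∃ r ∈ 1 :: L', A * r⁻¹ ∈ Γ := by
    intro A
    have hA : A ∈ Subgroup.closure {ModularGroup.S, ModularGroup.T} := by
      rw [SpecialLinearGroup.SL2Z_generators]
      trivial
    induction hA using Subgroup.closure_induction_right with
    | one => exact ⟨1, by simp, by simp⟩
    | mul_right A _ s hs ih =>
      refine hstep s ?_ A ih
      rcases hs with rfl | rfl <;> simp
    | mul_inv_cancel A _ s hs ih =>
      refine hstep s⁻¹ ?_ A ih
      rcases hs with rfl | rfl <;> simp
  refine ⟨⟨L', rfl⟩, fun A => ?_⟩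
  obtain ⟨r, hr, hA⟩ := hall A
  rw [← h r (List.mem_flatMap.2 ⟨r, hr, List.mem_map.2 ⟨1, by simp, mul_one r⟩⟩)]
  congr 1
  refine List.map_congr_left fun r' _ => ?_
  rw [← memberValue_mul_left hA (r * r'⁻¹)]
  simp [mul_assoc]

/-- Finite index ensures that the search for a coset system halts. -/
theorem exists_isCosetSystem (Γ : Subgroup SL(2, ℤ)) [Γ.FiniteIndex] :
    ∃ L', IsCosetSystem Γ (1 :: L') := by
  classical
  let one : Quotient (QuotientGroup.rightRel Γ) := Quotient.mk _ 1
  refine ⟨((Finset.univ.erase one).toList).map Quotient.out, ⟨_, rfl⟩, fun g => ?_⟩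
  have h1 : ∀ x : SL(2, ℤ), memberValue Γ (g * x⁻¹) =
      if Quotient.mk (QuotientGroup.rightRel Γ) g = Quotient.mk _ x then 1 else 0 := by
    intro x
    rw [memberValue]
    congr 1
    rw [Quotient.eq (r := QuotientGroup.rightRel Γ), QuotientGroup.rightRel_apply,
      ← inv_mem_iff, mul_inv_rev, inv_inv]
  rw [List.map_cons, List.sum_cons, List.map_map, Finset.sum_map_toList]
  simp only [Function.comp_apply, h1, Quotient.out_eq]
  change (if Quotient.mk (QuotientGroup.rightRel Γ) g = one then (1 : ℤ) else 0) + _ = 1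
  rw [Finset.add_sum_erase _ (fun q => if Quotient.mk (QuotientGroup.rightRel Γ) g = q then (1 : ℤ)
    else 0) (Finset.mem_univ one)]
  simp

/-- Coset systems can be found by a search. -/
theorem exists_partrec_cosetSystem :
    ∃ F : Code → Part (List SL(2, ℤ)), Partrec F ∧
      ∀ (c : Code) (Γ : Subgroup SL(2, ℤ)), IsMembershipTest c Γ → Γ.FiniteIndex →
        ∃ L, F c = Part.some L ∧ IsCosetSystem Γ L := by
  let count : Code × List SL(2, ℤ) → SL(2, ℤ) → Part ℤ := fun q A =>
    (partMap (fun r => runMember q.1 (A * r⁻¹)) q.2).map List.sum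
  let test : Code → List SL(2, ℤ) → Part Bool := fun c L' =>
    (partMap (count (c, 1 :: L')) (cosetTests (1 :: L'))).map fun bs => decide (∀ b ∈ bs, b = 1)
  have hcount : Partrec₂ count := by
    refine Partrec.map (Partrec.partMap (f := fun (s : (Code × List SL(2, ℤ)) × SL(2, ℤ)) r =>
      runMember s.1.1 (s.2 * r⁻¹)) ?_ (Computable.snd.comp Computable.fst))
      (Primrec.list_sum_int.comp Primrec.snd).to_comp.to₂
    exact Partrec.runMember.comp (Computable.fst.comp (Computable.fst.comp Computable.fst))
      (Primrec.sl_mul_inv.comp (Primrec.snd.comp Primrec.fst) Primrec.snd).to_comp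
  have hcons : Primrec fun q : Code × List SL(2, ℤ) => (1 : SL(2, ℤ)) :: q.2 :=
    Primrec.list_cons.comp (Primrec.const 1) Primrec.snd
  have htest : Partrec₂ test := by
    refine Partrec.map (Partrec.partMap (f := fun q : Code × List SL(2, ℤ) => count (q.1, 1 :: q.2))
      (hcount.comp (Primrec.pair (Primrec.fst.comp Primrec.fst) (hcons.comp Primrec.fst)).to_comp
        Computable.snd) (Primrec.cosetTests.comp hcons).to_comp) ?_
    have hall : PrimrecPred fun bs : List ℤ => ∀ b ∈ bs, b = 1 :=
      PrimrecPred.forall_mem (p := fun _ b => b = 1) Primrec.id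
        (Primrec.eq.comp Primrec.snd (Primrec.const 1))
    exact (hall.decide.comp Primrec.snd).to_comp.to₂
  obtain ⟨F, hF, hspec⟩ := exists_partrec_search htest
  refine ⟨fun c => (F c).map fun L' => 1 :: L', ?_, fun c Γ hc hΓ => ?_⟩
  · exact Partrec.map hF (Primrec.list_cons.comp (Primrec.const 1) Primrec.snd).to_comp.to₂
  · let q : List SL(2, ℤ) → Bool := fun L' => decide (∀ A ∈ cosetTests (1 :: L'),
      ((1 :: L').map fun r => memberValue Γ (A * r⁻¹)).sum = 1)
    have hq : ∀ L', test c L' = Part.some (q L') := by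
      intro L'
      have h1 : ∀ A, count (c, 1 :: L') A =
          Part.some ((1 :: L').map fun r => memberValue Γ (A * r⁻¹)).sum := fun A => by
        dsimp only [count]
        rw [partMap_eq fun r _ => runMember_eq hc _, Part.map_some]
      dsimp only [test]
      rw [partMap_eq fun A _ => h1 A, Part.map_some]
      simp [q]
    obtain ⟨L', hL'⟩ := exists_isCosetSystem Γ
    obtain ⟨L', h1, h2⟩ := hspec c q hq ⟨L', by simpa [q] using fun A _ => hL'.sum A⟩
    refine ⟨1 :: L', by dsimp only; rw [h1, Part.map_some], IsCosetSystem.of_tests ?_⟩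
    simpa only [q, decide_eq_true_eq] using h2

/-- The representative of a coset, computed by membership tests. -/
def runRepresentative (c : Code) (L : List SL(2, ℤ)) (g : SL(2, ℤ)) : Part SL(2, ℤ) :=
  (partMap (fun r => runMember c (g * r⁻¹)) L).map fun bs => L.getD (bs.idxOf 1) 1

theorem runRepresentative_eq {c : Code} {Γ : Subgroup SL(2, ℤ)} (h : IsMembershipTest c Γ)
    (L : List SL(2, ℤ)) (g : SL(2, ℤ)) :
    runRepresentative c L g = Part.some (representativeIn Γ L g) := by
  rw [runRepresentative, partMap_eq fun r _ => runMember_eq h _, Part.map_some, representativeIn]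

theorem Partrec.runRepresentative {α : Type*} [Primcodable α] {c : α → Code}
    {L : α → List SL(2, ℤ)} {g : α → SL(2, ℤ)} (hc : Computable c) (hL : Computable L)
    (hg : Computable g) : Partrec fun a => runRepresentative (c a) (L a) (g a) := by
  refine Partrec.map (Partrec.partMap (f := fun a r => _root_.runMember (c a) (g a * r⁻¹)) ?_ hL) ?_
  · exact Partrec.runMember.comp (hc.comp Computable.fst)
      (Primrec.sl_mul_inv.to_comp.comp (hg.comp Computable.fst) Computable.snd)
  · exact (Primrec.list_getD 1).to_comp.comp (hL.comp Computable.fst)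
      (Primrec.list_idxOf.comp (Primrec.const 1) Primrec.snd).to_comp

theorem Primrec.sl_apply (i j : Fin 2) : Primrec fun A : SL(2, ℤ) => A i j := by
  have h := primrec_matrixEntries
  fin_cases i <;> fin_cases j
  · exact Primrec.fst.comp h
  · exact Primrec.fst.comp (Primrec.snd.comp h)
  · exact Primrec.fst.comp (Primrec.snd.comp (Primrec.snd.comp h))
  · exact Primrec.snd.comp (Primrec.snd.comp (Primrec.snd.comp h))

theorem Primrec.heckeScale : Primrec₂ heckeScale := by
  have h : ∀ i j, Primrec fun q : ℕ × SL(2, ℤ) => q.2 i j := fun i j =>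
    (Primrec.sl_apply i j).comp Primrec.snd
  refine (primrec_ofEntries.comp (Primrec.pair (h 0 0) (Primrec.pair
    (Primrec.intDivNat.comp (h 0 1) Primrec.fst) (Primrec.pair (Primrec.int_mul.comp
      (Primrec.int_natCast.comp Primrec.fst) (h 1 0)) (h 1 1))))).of_eq fun q => ?_
  rw [_root_.heckeScale]

/-- A test for the subgroup `Γ ∩ g Γ g⁻¹`, given a test for `Γ`. -/
theorem exists_hecke_membershipTest :
    ∃ K : Code × ℕ → Code, Computable K ∧ ∀ (c : Code) (Γ : Subgroup SL(2, ℤ)) (n : ℕ+),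
      IsMembershipTest c Γ → IsMembershipTest (K (c, n)) (heckeIntersection Γ n) := by
  classical
  let f : Code × ℕ → SL(2, ℤ) → Part ℕ := fun q A =>
    (partMap (runMember q.1) [A, heckeScale q.2 A]).map fun bs =>
      -- Divisibility has to be tested separately: without it `heckeScale` may be the identity by
      -- default, which would pass the membership test.
      if (q.2 : ℤ) * intDivNat (A 0 1) q.2 = A 0 1 ∧ bs = [1, 1] then 1 else 0
  have hf : Partrec₂ f := by
    refine Partrec.map (Partrec.partMap (f := fun (s : (Code × ℕ) × SL(2, ℤ)) => runMember s.1.1)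
      (Partrec.runMember.comp (Computable.fst.comp (Computable.fst.comp Computable.fst))
        Computable.snd) ?_) ?_
    · exact (Primrec.list_cons.comp Primrec.snd (Primrec.list_cons.comp (Primrec.heckeScale.comp
        (Primrec.snd.comp Primrec.fst) Primrec.snd) (Primrec.const []))).to_comp
    · have hn : Primrec fun s : ((Code × ℕ) × SL(2, ℤ)) × List ℤ => s.1.1.2 :=
        Primrec.snd.comp (Primrec.fst.comp Primrec.fst)
      have hA : Primrec fun s : ((Code × ℕ) × SL(2, ℤ)) × List ℤ => s.1.2 0 1 :=
        (Primrec.sl_apply 0 1).comp (Primrec.snd.comp Primrec.fst)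
      exact (Primrec.ite (PrimrecPred.and (Primrec.eq.comp (Primrec.int_mul.comp
        (Primrec.int_natCast.comp hn) (Primrec.intDivNat.comp hA hn)) hA)
        (Primrec.eq.comp Primrec.snd (Primrec.const [1, 1]))) (Primrec.const 1)
        (Primrec.const 0)).to_comp.to₂
  obtain ⟨K, hK, hspec⟩ := exists_uniform_code hf
  refine ⟨K, hK, fun c Γ n hc => ?_⟩
  have h : ∀ A, (K (c, n)).eval (Encodable.encode (matrixEntries A)) =
      Part.some (if A ∈ heckeIntersection Γ n then 1 else 0) := by
    intro A
    rw [encode_matrixEntries, hspec]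
    dsimp only [f]
    rw [partMap_eq fun B _ => runMember_eq hc B, Part.map_some, Part.map_some, Encodable.encode_nat]
    congr 2
    simp [mem_heckeIntersection, memberValue_eq_one, and_left_comm]
  exact fun A => ⟨fun hA => by rw [h, if_pos hA], fun hA => by rw [h, if_neg hA]⟩

end MembershipAlgorithms

/-! ### Computation of orbit lists, coboundary matrices and presentations. -/

section OrbitAlgorithms

open Nat.Partrec (Code)

variable {α : Type*} [Primcodable α]

theorem Primrec.wordsOf {X : Type*} [Primcodable X] (S : List X) : Primrec (wordsOf S) := by
  refine (Primrec.nat_rec₁ (f := fun n ih => S.flatMap fun x => ih.map (x :: ·)) [[]] ?_).of_eq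
    fun n => ?_
  · refine Primrec.list_flatMap (Primrec.const S) (Primrec.list_map (Primrec.snd.comp Primrec.fst) ?_)
    exact Primrec.list_cons.comp (Primrec.snd.comp Primrec.fst) Primrec.snd
  · induction n with
    | zero => rfl
    | succ n ih => simp only [_root_.wordsOf, ← ih]

theorem Primrec.cliqueTails : Primrec cliqueTails := by
  refine Primrec.list_append.comp (Primrec.wordsOf _) (Primrec.comp (f := List.filter _)
    (Primrec.listFilter (p := fun t : List SL(2, ℤ) => ¬ ∀ x ∈ t, x ∈ ellipticList false) ?_)
    (Primrec.wordsOf _))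
  exact (PrimrecPred.forall_mem (p := fun _ x => x ∈ ellipticList false) Primrec.id
    ((PrimrecPred.mem_const _).comp Primrec.snd)).not

theorem Primrec.orbitList : Primrec₂ orbitList := by
  refine (Primrec.nat_casesOn (f := fun q : List SL(2, ℤ) × ℕ => q.2) (g := fun _ => [])
    (h := fun q n => q.1.flatMap fun r => (_root_.cliqueTails n).map fun t => r :: t.map (r * ·))
    Primrec.snd (Primrec.const []) ?_).of_eq fun q => by
      obtain ⟨L, n⟩ := q
      cases n <;> rfl
  refine Primrec.list_flatMap (Primrec.fst.comp Primrec.fst) (Primrec.list_map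
    (Primrec.cliqueTails.comp (Primrec.snd.comp Primrec.fst)) ?_)
  have hr : Primrec fun q : (((List SL(2, ℤ) × ℕ) × ℕ) × SL(2, ℤ)) × List SL(2, ℤ) => q.1.2 :=
    Primrec.snd.comp Primrec.fst
  exact Primrec.list_cons.comp hr (Primrec.list_map Primrec.snd
    (Primrec.sl_mul.comp (hr.comp Primrec.fst) Primrec.snd))

theorem Primrec.normalizeTuple : Primrec normalizeTuple :=
  Primrec.list_map Primrec.id (Primrec.sl_mul.comp (Primrec.sl_inv.comp
    ((Primrec.list_headD 1).comp Primrec.fst)) Primrec.snd)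

theorem Primrec.homTuple : Primrec (homTuple : List SL(2, ℤ) → List SL(2, ℤ)) := by
  refine (Primrec.list_rec (f := fun t : List SL(2, ℤ) => t) (g := fun _ => [1])
    (h := fun _ q => 1 :: q.2.2.map (q.1 * ·)) Primrec.id (Primrec.const [1]) ?_).of_eq fun t => ?_
  · refine Primrec.list_cons.comp (Primrec.const 1) (Primrec.list_map
      (Primrec.snd.comp (Primrec.snd.comp Primrec.snd)) ?_)
    exact Primrec.sl_mul.comp (Primrec.fst.comp (Primrec.snd.comp Primrec.fst)) Primrec.snd
  · induction t with
    | nil => rfl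
    | cons x t ih => rw [_root_.homTuple, ← ih]

theorem Primrec.differences : Primrec (differences : List SL(2, ℤ) → List SL(2, ℤ)) := by
  refine (Primrec.list_rec (f := fun t : List SL(2, ℤ) => t) (g := fun _ => [])
    (h := fun _ q => if q.2.1 = [] then [] else (q.1⁻¹ * q.2.1.headD 1) :: q.2.2)
    Primrec.id (Primrec.const []) ?_).of_eq fun t => ?_
  · have ht : Primrec fun q : List SL(2, ℤ) × SL(2, ℤ) × List SL(2, ℤ) × List SL(2, ℤ) => q.2.2.1 :=
      Primrec.fst.comp (Primrec.snd.comp Primrec.snd)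
    refine Primrec.ite (Primrec.eq.comp ht (Primrec.const [])) (Primrec.const [])
      (Primrec.list_cons.comp ?_ (Primrec.snd.comp (Primrec.snd.comp Primrec.snd)))
    exact Primrec.sl_mul.comp (Primrec.sl_inv.comp (Primrec.fst.comp Primrec.snd))
      ((Primrec.list_headD 1).comp ht)
  · induction t with
    | nil => rfl
    | cons x t ih =>
      cases t with
      | nil => rfl
      | cons y t =>
        rw [differences_cons_cons, ← ih]
        rfl

/-- The characteristic function of an orbit, computed by membership tests. -/
def runOrbitIndicator (c : Code) (u t : List SL(2, ℤ)) : Part ℤ :=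
  (runMember c (t.headD 1 * (u.headD 1)⁻¹)).map fun b =>
    if t ≠ [] ∧ normalizeTuple t = normalizeTuple u then b else 0

theorem runOrbitIndicator_eq {c : Code} {Γ : Subgroup SL(2, ℤ)} (h : IsMembershipTest c Γ)
    (u t : List SL(2, ℤ)) : runOrbitIndicator c u t = Part.some (orbitIndicator Γ u t) := by
  rw [runOrbitIndicator, runMember_eq h, Part.map_some, orbitIndicator]

theorem Partrec.runOrbitIndicator {c : α → Code} {u t : α → List SL(2, ℤ)} (hc : Computable c)
    (hu : Computable u) (ht : Computable t) :
    Partrec fun a => runOrbitIndicator (c a) (u a) (t a) := by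
  refine Partrec.map (Partrec.runMember.comp hc (Primrec.sl_mul_inv.to_comp.comp
    ((Primrec.list_headD 1).to_comp.comp ht) ((Primrec.list_headD 1).to_comp.comp hu))) ?_
  have h : Primrec fun q : (List SL(2, ℤ) × List SL(2, ℤ)) × ℤ =>
      if q.1.2 ≠ [] ∧ normalizeTuple q.1.2 = normalizeTuple q.1.1 then q.2 else 0 := by
    refine Primrec.ite (PrimrecPred.and (PrimrecPred.not (Primrec.eq.comp
      (Primrec.snd.comp Primrec.fst) (Primrec.const []))) (Primrec.eq.comp
        (Primrec.normalizeTuple.comp (Primrec.snd.comp Primrec.fst))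
        (Primrec.normalizeTuple.comp (Primrec.fst.comp Primrec.fst)))) Primrec.snd (Primrec.const 0)
  exact h.to_comp.comp (Computable.pair ((Computable.pair hu ht).comp Computable.fst) Computable.snd)

/-- The value of the characteristic function of an orbit on the chain that is given by the
terms `z`. -/
def runPairing (c : Code) (u : List SL(2, ℤ)) (z : List (ℤ × List SL(2, ℤ))) : Part ℤ :=
  (partMap (fun p => (runOrbitIndicator c u p.2).map fun b => p.1 * b) z).map fun l => l.sum

theorem runPairing_eq {c : Code} {Γ : Subgroup SL(2, ℤ)} (h : IsMembershipTest c Γ)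
    (u : List SL(2, ℤ)) (z : List (ℤ × List SL(2, ℤ))) :
    runPairing c u z = Part.some (chainEval (orbitIndicator Γ u) (toChain z)) := by
  have h1 : ∀ p ∈ z, (runOrbitIndicator c u p.2).map (fun b => p.1 * b) =
      Part.some (p.1 * orbitIndicator Γ u p.2) := fun p _ => by
    rw [runOrbitIndicator_eq h, Part.map_some]
  rw [runPairing, partMap_eq h1, Part.map_some, chainEval_toChain]

theorem Partrec.runPairing {c : α → Code} {u : α → List SL(2, ℤ)}
    {z : α → List (ℤ × List SL(2, ℤ))} (hc : Computable c) (hu : Computable u)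
    (hz : Computable z) : Partrec fun a => runPairing (c a) (u a) (z a) := by
  have h1 : Partrec₂ fun (a : α) (p : ℤ × List SL(2, ℤ)) =>
      (_root_.runOrbitIndicator (c a) (u a) p.2).map fun b => p.1 * b := by
    refine Partrec.map (Partrec.runOrbitIndicator (hc.comp Computable.fst)
      (hu.comp Computable.fst) (Computable.snd.comp Computable.snd)) ?_
    have h : Computable fun s : (α × (ℤ × List SL(2, ℤ))) × ℤ => s.1.2.1 * s.2 :=
      Primrec.int_mul.to_comp.comp (Computable.fst.comp (Computable.snd.comp Computable.fst))
        Computable.snd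
    exact h
  have h2 : Computable fun s : α × List ℤ => s.2.sum :=
    Primrec.list_sum_int.to_comp.comp Computable.snd
  exact Partrec.map (Partrec.partMap h1 hz) h2

/-- The values of the characteristic functions of the orbits of the tuples in `O` on the chain that
is given by the terms `z`. -/
def runCoefficients (c : Code) (z : List (ℤ × List SL(2, ℤ))) (O : List (List SL(2, ℤ))) :
    Part (List ℤ) :=
  partMap (fun u => runPairing c u z) O

theorem runCoefficients_eq {c : Code} {Γ : Subgroup SL(2, ℤ)} (h : IsMembershipTest c Γ)
    (z : List (ℤ × List SL(2, ℤ))) (O : List (List SL(2, ℤ))) :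
    runCoefficients c z O =
      Part.some (O.map fun u => chainEval (orbitIndicator Γ u) (toChain z)) :=
  partMap_eq fun u _ => runPairing_eq h u z

theorem Partrec.runCoefficients {c : α → Code} {z : α → List (ℤ × List SL(2, ℤ))}
    {O : α → List (List SL(2, ℤ))} (hc : Computable c) (hz : Computable z) (hO : Computable O) :
    Partrec fun a => runCoefficients (c a) (z a) (O a) :=
  Partrec.partMap (f := fun a u => _root_.runPairing (c a) u (z a))
    (Partrec.runPairing (hc.comp Computable.fst) Computable.snd (hz.comp Computable.fst)) hO

/-- The matrix of the coboundary between functions on the tuples in `O` and `O'`. -/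
def runCoboundaryMatrix (c : Code) (O O' : List (List SL(2, ℤ))) : Part (List (List ℤ)) :=
  partMap (fun t => runCoefficients c (faceTerms t) O) O'

theorem runCoboundaryMatrix_eq {c : Code} {Γ : Subgroup SL(2, ℤ)} (h : IsMembershipTest c Γ)
    (O O' : List (List SL(2, ℤ))) : runCoboundaryMatrix c O O' =
      Part.some (O'.map fun t => O.map fun u => coboundary (orbitIndicator Γ u) t) := by
  refine partMap_eq fun t _ => ?_
  rw [runCoefficients_eq h, toChain_faceTerms]
  rfl

theorem Partrec.runCoboundaryMatrix {c : α → Code} {O O' : α → List (List SL(2, ℤ))}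
    (hc : Computable c) (hO : Computable O) (hO' : Computable O') :
    Partrec fun a => runCoboundaryMatrix (c a) (O a) (O' a) := by
  refine Partrec.partMap (f := fun a t => _root_.runCoefficients (c a) (_root_.faceTerms t) (O a))
    ?_ hO'
  exact Partrec.runCoefficients (hc.comp Computable.fst)
    ((Primrec.faceTerms (X := SL(2, ℤ))).to_comp.comp Computable.snd) (hO.comp Computable.fst)

theorem listMatrix_map_map {X Y : Type*} (O : List X) (O' : List Y) (f : Y → X → ℤ) :
    listMatrix O'.length O.length (O'.map fun t => O.map fun u => f t u) =
      Matrix.of fun i j => f (O'.get i) (O.get j) := by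
  ext i j
  simp [listMatrix, listEntry, List.getD_eq_getElem?_getD]

/-- Presentations of the cohomology of cliques can be computed. -/
theorem exists_partrec_presentation :
    ∃ F : Code × ℕ → Part (List SL(2, ℤ) × List ℕ × List (List ℤ) × List (List ℤ)), Partrec F ∧
      ∀ (c : Code) (Γ : Subgroup SL(2, ℤ)) (m : ℕ), IsMembershipTest c Γ → Γ.FiniteIndex →
        ∃ L d E Q, F (c, m) = Part.some (L, d, E, Q) ∧ IsCosetSystem Γ L ∧
          IsHomologyPresentation (coboundaryMatrix Γ L m) (coboundaryMatrix Γ L (m + 1)) d.get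
            (listMatrix (orbitList L (m + 1)).length d.length E)
            (listMatrix d.length (orbitList L (m + 1)).length Q) := by
  obtain ⟨Fc, hFc, hc⟩ := exists_partrec_cosetSystem
  obtain ⟨Fp, hFp, hp⟩ := exists_partrec_homologyPresentation
  let D : Code × ℕ → List SL(2, ℤ) → Part (List (List ℤ)) := fun q L =>
    runCoboundaryMatrix q.1 (orbitList L q.2) (orbitList L (q.2 + 1))
  have hD : Partrec₂ D := by
    have hL : Primrec fun q : (Code × ℕ) × List SL(2, ℤ) => q.2 := Primrec.snd
    have hm : Primrec fun q : (Code × ℕ) × List SL(2, ℤ) => q.1.2 := Primrec.snd.comp Primrec.fst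
    exact Partrec.runCoboundaryMatrix (Computable.fst.comp Computable.fst)
      (Primrec.orbitList.comp hL hm).to_comp
      (Primrec.orbitList.comp hL (Primrec.succ.comp hm)).to_comp
  -- Degree `m` corresponds to cliques of length `m + 1`, so the complex consists of the cochains in
  -- lengths `m`, `m + 1` and `m + 2`.
  let dims : ℕ → List SL(2, ℤ) → ℕ × ℕ × ℕ := fun m L =>
    ((orbitList L m).length, (orbitList L (m + 1)).length, (orbitList L (m + 2)).length)
  have hdims : Primrec₂ dims := by
    have h : ∀ k, Primrec fun q : ℕ × List SL(2, ℤ) => (orbitList q.2 (q.1 + k)).length := fun k =>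
      Primrec.list_length.comp (Primrec.orbitList.comp Primrec.snd
        (Primrec.nat_add.comp Primrec.fst (Primrec.const k)))
    exact Primrec.pair (h 0) (Primrec.pair (h 1) (h 2))
  refine ⟨fun q => (Fc q.1).bind fun L => (D q L).bind fun A => (D (q.1, q.2 + 1) L).bind fun B =>
    (Fp (dims q.2 L, A, B)).map fun t => (L, t), ?_, fun c Γ m hΓ hfin => ?_⟩
  · refine Partrec.bind (hFc.comp Computable.fst) (Partrec.bind hD (Partrec.bind
      (f := fun s : ((Code × ℕ) × List SL(2, ℤ)) × List (List ℤ) => D (s.1.1.1, s.1.1.2 + 1) s.1.2)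
      (g := fun s B => (Fp (dims s.1.1.2 s.1.2, s.2, B)).map fun t => (s.1.2, t)) ?_ ?_))
    · have hq : Primrec fun s : ((Code × ℕ) × List SL(2, ℤ)) × List (List ℤ) => s.1.1 :=
        Primrec.fst.comp Primrec.fst
      exact hD.comp (Primrec.pair (Primrec.fst.comp hq)
        (Primrec.succ.comp (Primrec.snd.comp hq))).to_comp (Computable.snd.comp Computable.fst)
    · have hL : Primrec fun s : (((Code × ℕ) × List SL(2, ℤ)) × List (List ℤ)) × List (List ℤ) =>
        s.1.1.2 := Primrec.snd.comp (Primrec.fst.comp Primrec.fst)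
      refine Partrec.map (hFp.comp (Primrec.to_comp (Primrec.pair (hdims.comp ?_ hL)
        (Primrec.pair (Primrec.snd.comp Primrec.fst) Primrec.snd)))) ?_
      · exact Primrec.snd.comp (Primrec.fst.comp (Primrec.fst.comp Primrec.fst))
      · exact (Primrec.pair (hL.comp Primrec.fst) Primrec.snd).to_comp.to₂
  · obtain ⟨L, hL, hL'⟩ := hc c Γ hΓ hfin
    have hmat : ∀ n, ∃ A, D (c, n) L = Part.some A ∧
        listMatrix (orbitList L (n + 1)).length (orbitList L n).length A =
          coboundaryMatrix Γ L n := fun n =>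
      ⟨_, runCoboundaryMatrix_eq hΓ _ _, listMatrix_map_map _ _ _⟩
    obtain ⟨A, hA, hA'⟩ := hmat m
    obtain ⟨B, hB, hB'⟩ := hmat (m + 1)
    obtain ⟨d, E, Q, h1, h2⟩ := hp (orbitList L m).length (orbitList L (m + 1)).length
      (orbitList L (m + 1 + 1)).length A B (by rw [hA', hB', coboundaryMatrix_mul hL'])
    rw [hA', hB'] at h2
    refine ⟨L, d, E, Q, ?_, hL', h2⟩
    dsimp only
    rw [hL, Part.bind_some, hA, Part.bind_some, hB, Part.bind_some, h1, Part.map_some]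

end OrbitAlgorithms

/-! ### Computation of representatives, coordinates and Hecke images. -/

section HeckeAlgorithms

open Nat.Partrec (Code)

variable {α : Type*} [Primcodable α]

/-- The dot product of the first `n` entries of two lists. -/
def listDot (n : ℕ) (a b : List ℤ) : ℤ := ∑ i ∈ Finset.range n, a.getD i 0 * b.getD i 0

theorem listDot_ofFn {n : ℕ} (a b : Fin n → ℤ) :
    listDot n (List.ofFn a) (List.ofFn b) = ∑ i, a i * b i := by
  rw [listDot, Finset.sum_range]
  simp [List.getD_eq_getElem?_getD]

theorem Primrec.listDot {n : α → ℕ} {a b : α → List ℤ} (hn : Primrec n) (ha : Primrec a)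
    (hb : Primrec b) : Primrec fun q => listDot (n q) (a q) (b q) :=
  Primrec.sum_range (f := fun q i => (a q).getD i 0 * (b q).getD i 0) hn
    (Primrec.int_mul.comp ((Primrec.list_getD 0).comp (ha.comp Primrec.fst) Primrec.snd)
      ((Primrec.list_getD 0).comp (hb.comp Primrec.fst) Primrec.snd))

/-- The product of an `m × n` matrix, given as a list of rows, and a vector. -/
def listMulVec (m n : ℕ) (M : List (List ℤ)) (v : List ℤ) : List ℤ :=
  (List.range m).map fun i => listDot n (M.getD i []) v

theorem listMulVec_ofFn {m n : ℕ} (M : List (List ℤ)) (v : Fin n → ℤ) :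
    listMulVec m n M (List.ofFn v) = List.ofFn ((listMatrix m n M).mulVec v) := by
  refine List.ext_getElem (by simp [listMulVec]) fun i h1 h2 => ?_
  simp only [listMulVec, List.getElem_map, List.getElem_range, List.getElem_ofFn]
  rw [listDot, Finset.sum_range]
  simp [Matrix.mulVec, dotProduct, listMatrix_apply, listEntry, List.getD_eq_getElem?_getD]

theorem Primrec.listMulVec {m n : α → ℕ} {M : α → List (List ℤ)} {v : α → List ℤ}
    (hm : Primrec m) (hn : Primrec n) (hM : Primrec M) (hv : Primrec v) :
    Primrec fun q => listMulVec (m q) (n q) (M q) (v q) :=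
  Primrec.list_map (f := fun q => List.range (m q))
    (g := fun q i => _root_.listDot (n q) ((M q).getD i []) (v q)) (Primrec.list_range.comp hm)
    (Primrec.listDot (hn.comp Primrec.fst)
      ((Primrec.list_getD []).comp (hM.comp Primrec.fst) Primrec.snd) (hv.comp Primrec.fst))

/-- The transpose of an `n × n` matrix that is given as a list of rows. -/
def listTranspose (n : ℕ) (M : List (List ℤ)) : List (List ℤ) :=
  (List.range n).map fun i => (List.range n).map fun j => listEntry M j i

theorem listTranspose_eq_ofFn (n : ℕ) (M : List (List ℤ)) :
    listTranspose n M = List.ofFn fun i => List.ofFn ((listMatrix n n M).transpose i) := by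
  refine List.ext_getElem (by simp [listTranspose]) fun i h1 h2 => ?_
  refine List.ext_getElem (by simp [listTranspose]) fun j h3 h4 => ?_
  simp [listTranspose, listMatrix_apply]

theorem Primrec.listTranspose : Primrec₂ listTranspose := by
  have h : Primrec₂ fun (q : ℕ × List (List ℤ)) (i : ℕ) =>
      (List.range q.1).map fun j => _root_.listEntry q.2 j i :=
    Primrec.list_map (f := fun q : (ℕ × List (List ℤ)) × ℕ => List.range q.1.1)
      (g := fun q j => _root_.listEntry q.1.2 j q.2)
      (Primrec.list_range.comp (Primrec.fst.comp Primrec.fst))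
      (Primrec.listEntry (Primrec.snd.comp (Primrec.fst.comp Primrec.fst)) Primrec.snd
        (Primrec.snd.comp Primrec.fst))
  exact Primrec.list_map (Primrec.list_range.comp Primrec.fst) h

/-- A unit vector of length `n`. -/
def listSingle (n j : ℕ) : List ℤ := (List.range n).map fun i => if i = j then 1 else 0

theorem listSingle_eq_ofFn {n : ℕ} (j : Fin n) :
    listSingle n j = List.ofFn (Pi.single j (1 : ℤ)) := by
  refine List.ext_getElem (by simp [listSingle]) fun i h1 h2 => ?_
  simp [listSingle, Pi.single_apply, Fin.ext_iff]

theorem Primrec.listSingle : Primrec₂ listSingle :=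
  Primrec.list_map (f := fun q : ℕ × ℕ => List.range q.1) (g := fun q i => if i = q.2 then 1 else 0)
    (Primrec.list_range.comp Primrec.fst)
    (Primrec.ite (Primrec.eq.comp Primrec.snd (Primrec.snd.comp Primrec.fst)) (Primrec.const 1)
      (Primrec.const 0))

/-- The elements `p g r⁻¹` of a group for `g` in `t`, where `r` is the representative of the coset
of `p g`, computed by membership tests. -/
def runRetraction (c : Code) (L : List SL(2, ℤ)) (p : SL(2, ℤ)) (t : List SL(2, ℤ)) :
    Part (List SL(2, ℤ)) :=
  partMap (fun g => (runRepresentative c L (p * g)).map fun r => p * g * r⁻¹) t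

theorem runRetraction_eq {c : Code} {Γ : Subgroup SL(2, ℤ)} (h : IsMembershipTest c Γ)
    (L : List SL(2, ℤ)) (p : SL(2, ℤ)) (t : List SL(2, ℤ)) : runRetraction c L p t =
      Part.some (t.map fun g => p * g * (representativeIn Γ L (p * g))⁻¹) :=
  partMap_eq fun g _ => by rw [runRepresentative_eq h, Part.map_some]

theorem Partrec.runRetraction {c : α → Code} {L : α → List SL(2, ℤ)} {p : α → SL(2, ℤ)}
    {t : α → List SL(2, ℤ)} (hc : Computable c) (hL : Computable L) (hp : Computable p)
    (ht : Computable t) : Partrec fun a => runRetraction (c a) (L a) (p a) (t a) := by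
  have h1 : Computable fun q : α × SL(2, ℤ) => p q.1 * q.2 :=
    Primrec.sl_mul.to_comp.comp (hp.comp Computable.fst) Computable.snd
  have h2 : Computable fun q : (α × SL(2, ℤ)) × SL(2, ℤ) => p q.1.1 * q.1.2 * q.2⁻¹ :=
    Primrec.sl_mul_inv.to_comp.comp (h1.comp Computable.fst) Computable.snd
  have h3 : Partrec₂ fun (a : α) (g : SL(2, ℤ)) =>
      (_root_.runRepresentative (c a) (L a) (p a * g)).map fun r => p a * g * r⁻¹ :=
    Partrec.map (Partrec.runRepresentative (hc.comp Computable.fst) (hL.comp Computable.fst) h1) h2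
  exact Partrec.partMap h3 ht

/-- The value at `u` of the extension of the cocycle that is computed by `f`. -/
def runRetractCochain (c : Code) (L : List SL(2, ℤ)) (f : Code) (u : List SL(2, ℤ)) : Part ℤ :=
  (runRetraction c L 1 u).bind fun t => (f.eval (Encodable.encode (differences t))).map fun n =>
    (Encodable.decode (α := ℤ) n).getD 0

/-- The quotients of successive entries of a retracted tuple lie in `Γ`, so `f` is run only on
inputs where it is known to halt. -/
theorem runRetractCochain_eq {c : Code} {Γ : Subgroup SL(2, ℤ)} (h : IsMembershipTest c Γ)
    {L : List SL(2, ℤ)} (hL : IsCosetSystem Γ L) {m : ℕ} {z : (Fin m → Γ) → ℤ} {f : Code}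
    (hf : ∀ x : Fin m → Γ, f.eval (Encodable.encode (List.ofFn fun i => (x i : SL(2, ℤ)))) =
      Part.some (Encodable.encode (z x))) {u : List SL(2, ℤ)} (hu : u.length = m + 1) :
    runRetractCochain c L f u = Part.some (retractCochain hL z u) := by
  have ht : (u.map (cosetRetraction hL)).length = m + 1 := by rw [List.length_map, hu]
  obtain ⟨g, x, hx⟩ := exists_smul_homTuple ht
  have hd : differences (u.map (cosetRetraction hL)) = List.ofFn x := by
    rw [hx, differences_smul, differences_homTuple]
  have h1 : (u.map fun g => 1 * g * (representativeIn Γ L (1 * g))⁻¹) =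
      (u.map (cosetRetraction hL)).map Γ.subtype := by
    rw [List.map_map]
    refine List.map_congr_left fun g _ => ?_
    rw [one_mul]
    rfl
  rw [runRetractCochain, runRetraction_eq h, Part.bind_some, h1, differences_map, hd, List.map_ofFn]
  have h2 := hf x
  rw [show (Γ.subtype ∘ x) = fun i => (x i : SL(2, ℤ)) from rfl, h2, Part.map_some,
    Encodable.encodek, retractCochain, homogenize_apply z ht hd]
  rfl

theorem Partrec.runRetractCochain {c : α → Code} {L : α → List SL(2, ℤ)} {f : α → Code}
    {u : α → List SL(2, ℤ)} (hc : Computable c) (hL : Computable L) (hf : Computable f)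
    (hu : Computable u) : Partrec fun a => runRetractCochain (c a) (L a) (f a) (u a) := by
  have h1 : Partrec₂ fun (a : α) (t : List SL(2, ℤ)) =>
      (f a).eval (Encodable.encode (differences t)) :=
    Code.eval_part.comp (hf.comp Computable.fst)
      (Computable.encode.comp (Primrec.differences.to_comp.comp Computable.snd))
  have h2 : Primrec fun q : (α × List SL(2, ℤ)) × ℕ =>
      (Encodable.decode (α := ℤ) q.2).getD 0 :=
    Primrec.option_getD.comp (Primrec.decode.comp Primrec.snd) (Primrec.const 0)
  exact Partrec.bind (Partrec.runRetraction hc hL (Computable.const 1) hu)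
    (Partrec.map h1 h2.to_comp)

theorem List.map_eq_ofFn {X Y : Type*} (l : List X) (g : X → Y) :
    l.map g = List.ofFn fun i => g (l.get i) :=
  List.ext_getElem (by simp) (by simp)

/-- Presentations of the cohomology of a group with a membership test can be computed, together
with cocycles that represent given classes and with the classes of given cocycles. -/
theorem exists_partrec_cohomology :
    ∃ (I : Code × ℕ → Part (List ℕ)) (R : (Code × ℕ) × List ℤ × List SL(2, ℤ) → Part ℤ)
      (C : (Code × ℕ) × Code → Part (List ℤ)), Partrec I ∧ Partrec R ∧ Partrec C ∧
      ∀ (c : Code) (Γ : Subgroup SL(2, ℤ)) (m : ℕ), IsMembershipTest c Γ → Γ.FiniteIndex →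
        ∃ d, I (c, m) = Part.some d ∧ ∃ e : (Fin d.length → ℤ) →+ integralCohomology Γ m,
          Function.Surjective e ∧ (∀ v, e v = 0 ↔ ∀ i, (d.get i : ℤ) ∣ v i) ∧
          (∀ v, ∃ w : List SL(2, ℤ) → ℤ,
            (∀ l, R ((c, m), List.ofFn v, l) = Part.some (w l)) ∧
            ∃ z : groupCohomology.cocycles (Rep.trivial ℤ Γ ℤ) m, cohomologyClass z = e v ∧
              ∀ x : Fin m → Γ, cocycleValue z x = w (List.ofFn fun i => (x i : SL(2, ℤ)))) ∧
          ∀ (z : groupCohomology.cocycles (Rep.trivial ℤ Γ ℤ) m) (f : Code),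
            (∀ x : Fin m → Γ, f.eval (Encodable.encode (List.ofFn fun i => (x i : SL(2, ℤ)))) =
              Part.some (Encodable.encode (cocycleValue z x))) →
            ∃ v, C ((c, m), f) = Part.some (List.ofFn v) ∧ e v = cohomologyClass z := by
  obtain ⟨F, hF, hFspec⟩ := exists_partrec_presentation
  obtain ⟨y, hy, hyspec⟩ := exists_computable_projection
  let Data := List SL(2, ℤ) × List ℕ × List (List ℤ) × List (List ℤ)
  let O : Code × ℕ → Data → List (List SL(2, ℤ)) := fun q D => orbitList D.1 (q.2 + 1)
  have hO : Primrec₂ O := Primrec.orbitList.comp (Primrec.fst.comp Primrec.snd)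
    (Primrec.succ.comp (Primrec.snd.comp Primrec.fst))
  refine ⟨fun q => (F q).map fun D => D.2.1,
    fun q => (F q.1).bind fun D => (runCoefficients q.1.1 (y (homTuple q.2.2).tail) (O q.1 D)).map
      fun a => listDot (O q.1 D).length a
        (listMulVec (O q.1 D).length D.2.1.length D.2.2.1 q.2.1),
    fun q => (F q.1).bind fun D => (partMap (runRetractCochain q.1.1 D.1 q.2) (O q.1 D)).map
      fun a => listMulVec D.2.1.length (O q.1 D).length D.2.2.2 a, ?_, ?_, ?_, ?_⟩
  · have h : Computable fun s : (Code × ℕ) × Data => s.2.2.1 :=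
      Computable.fst.comp (Computable.snd.comp Computable.snd)
    exact Partrec.map hF h
  · refine Partrec.bind (hF.comp Computable.fst) ?_
    have h1 : Primrec fun s : ((Code × ℕ) × List ℤ × List SL(2, ℤ)) × Data => O s.1.1 s.2 :=
      hO.comp (Primrec.fst.comp Primrec.fst) Primrec.snd
    have h2 : Computable fun s : ((Code × ℕ) × List ℤ × List SL(2, ℤ)) × Data =>
        y (homTuple s.1.2.2).tail :=
      hy.comp (Primrec.list_tail.comp (Primrec.homTuple.comp
        (Primrec.snd.comp (Primrec.snd.comp Primrec.fst)))).to_comp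
    have h3 : Primrec fun s : (((Code × ℕ) × List ℤ × List SL(2, ℤ)) × Data) × List ℤ =>
        (O s.1.1.1 s.1.2).length := Primrec.list_length.comp (h1.comp Primrec.fst)
    have h4 : Primrec fun s : (((Code × ℕ) × List ℤ × List SL(2, ℤ)) × Data) × List ℤ =>
        listDot (O s.1.1.1 s.1.2).length s.2 (listMulVec (O s.1.1.1 s.1.2).length s.1.2.2.1.length
          s.1.2.2.2.1 s.1.1.2.1) := by
      have hD := Primrec.snd.comp (Primrec.snd.comp (Primrec.fst (α :=
        ((Code × ℕ) × List ℤ × List SL(2, ℤ)) × Data) (β := List ℤ)))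
      refine Primrec.listDot h3 Primrec.snd (Primrec.listMulVec h3 (Primrec.list_length.comp
        (Primrec.fst.comp hD)) (Primrec.fst.comp (Primrec.snd.comp hD)) ?_)
      exact Primrec.fst.comp (Primrec.snd.comp (Primrec.fst.comp Primrec.fst))
    exact Partrec.map (Partrec.runCoefficients
      (Computable.fst.comp (Computable.fst.comp Computable.fst)) h2 h1.to_comp) h4.to_comp
  · refine Partrec.bind (hF.comp Computable.fst) ?_
    have h1 : Primrec fun s : ((Code × ℕ) × Code) × Data => O s.1.1 s.2 :=
      hO.comp (Primrec.fst.comp Primrec.fst) Primrec.snd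
    have h2 : Partrec₂ fun (s : ((Code × ℕ) × Code) × Data) (u : List SL(2, ℤ)) =>
        runRetractCochain s.1.1.1 s.2.1 s.1.2 u :=
      Partrec.runRetractCochain
        (Computable.fst.comp (Computable.fst.comp (Computable.fst.comp Computable.fst)))
        (Computable.fst.comp (Computable.snd.comp Computable.fst))
        (Computable.snd.comp (Computable.fst.comp Computable.fst)) Computable.snd
    have h3 : Primrec fun s : (((Code × ℕ) × Code) × Data) × List ℤ =>
        listMulVec s.1.2.2.1.length (O s.1.1.1 s.1.2).length s.1.2.2.2.2 s.2 := by
      have hD := Primrec.snd.comp (Primrec.snd.comp (Primrec.fst (α :=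
        ((Code × ℕ) × Code) × Data) (β := List ℤ)))
      exact Primrec.listMulVec (Primrec.list_length.comp (Primrec.fst.comp hD))
        (Primrec.list_length.comp (h1.comp Primrec.fst))
        (Primrec.snd.comp (Primrec.snd.comp hD)) Primrec.snd
    exact Partrec.map (Partrec.partMap h2 h1.to_comp) h3.to_comp
  · intro c Γ m hc hfin
    obtain ⟨L, d, E, Q, hFeq, hL, hp⟩ := hFspec c Γ m hc hfin
    obtain ⟨e, he1, he2, he3, he4⟩ := exists_cohomology_presentation hL hyspec hp
    dsimp only [O]
    rw [hFeq]
    refine ⟨d, Part.map_some _ _, e, he1, he2, fun v => ?_, fun z f hf => ?_⟩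
    · refine ⟨fun l => extendCochain y (orbitCochain Γ (orbitList L (m + 1))
        ((listMatrix (orbitList L (m + 1)).length d.length E).mulVec v)) (homTuple l), fun l => ?_,
        he3 v⟩
      -- The homogeneous tuple starts with `1`, so the projection at it is the value of `y` at its
      -- tail, without a translation.
      obtain ⟨t, ht⟩ := homTuple_eq_cons l
      beta_reduce
      rw [Part.bind_some, runCoefficients_eq hc, Part.map_some, listMulVec_ofFn, extendCochain,
        ht, tupleExtension_one_cons, chainEval_orbitCochain, List.tail_cons, List.map_eq_ofFn,
        listDot_ofFn]
    · refine ⟨_, ?_, he4 z⟩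
      rw [Part.bind_some, partMap_eq (g := retractCochain hL (cocycleValue z)) fun u hu =>
        runRetractCochain_eq hc hL hf (orbitList_spec hu).1, Part.map_some, List.map_eq_ofFn,
        listMulVec_ofFn]
      rfl

/-- The entries of the tuple at which a cocycle is evaluated in the Hecke operator, computed by
membership tests. -/
def runHeckeTuple (c' : Code) (n : ℕ) (P l : List SL(2, ℤ)) (p : SL(2, ℤ)) :
    Part (List SL(2, ℤ)) :=
  (runRetraction c' P p (homTuple l)).map fun t => (differences t).map (heckeScale n)

theorem runHeckeTuple_eq {c' : Code} {Γ : Subgroup SL(2, ℤ)} {n : ℕ+}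
    (h : IsMembershipTest c' (heckeIntersection Γ n)) (P l : List SL(2, ℤ)) (p : SL(2, ℤ)) :
    runHeckeTuple c' n P l p = Part.some (heckeTuple Γ n P l p) := by
  rw [runHeckeTuple, runRetraction_eq h, Part.map_some, heckeTuple]

theorem Partrec.runHeckeTuple {c' : α → Code} {n : α → ℕ} {P l : α → List SL(2, ℤ)}
    {p : α → SL(2, ℤ)} (hc : Computable c') (hn : Computable n) (hP : Computable P)
    (hl : Computable l) (hp : Computable p) :
    Partrec fun a => runHeckeTuple (c' a) (n a) (P a) (l a) (p a) := by
  have h1 : Primrec₂ fun (n : ℕ) (t : List SL(2, ℤ)) => (differences t).map (heckeScale n) :=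
    Primrec.list_map (f := fun q : ℕ × List SL(2, ℤ) => differences q.2)
      (g := fun q A => _root_.heckeScale q.1 A) (Primrec.differences.comp Primrec.snd)
      (Primrec.heckeScale.comp (Primrec.fst.comp Primrec.fst) Primrec.snd)
  have h2 : Computable fun q : α × List SL(2, ℤ) => (differences q.2).map (heckeScale (n q.1)) :=
    h1.to_comp.comp (hn.comp Computable.fst) Computable.snd
  exact Partrec.map (Partrec.runRetraction hc hP hp (Primrec.homTuple.to_comp.comp hl)) h2

/-- The Hecke operator on cocycles, computed by membership tests for the group and for its
intersection with a conjugate. -/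
def runHeckeCocycle (c c' : Code) (n : ℕ) (P : List SL(2, ℤ)) (R : List SL(2, ℤ) → Part ℤ)
    (l : List SL(2, ℤ)) : Part ℤ :=
  (partMap (fun p => (runMember c p).bind fun b => (runHeckeTuple c' n P l p).bind fun t =>
    (R t).map fun a => b * a) P).map fun l => l.sum

theorem runHeckeCocycle_eq {c c' : Code} {Γ : Subgroup SL(2, ℤ)} {n : ℕ+}
    (h : IsMembershipTest c Γ) (h' : IsMembershipTest c' (heckeIntersection Γ n))
    (P : List SL(2, ℤ)) {R : List SL(2, ℤ) → Part ℤ} {w : List SL(2, ℤ) → ℤ}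
    (hR : ∀ l, R l = Part.some (w l)) (l : List SL(2, ℤ)) : runHeckeCocycle c c' n P R l =
      Part.some (P.map fun p => memberValue Γ p * w (heckeTuple Γ n P l p)).sum := by
  rw [runHeckeCocycle, partMap_eq (g := fun p => memberValue Γ p * w (heckeTuple Γ n P l p))
    fun p _ => by rw [runMember_eq h, Part.bind_some, runHeckeTuple_eq h', Part.bind_some, hR,
      Part.map_some], Part.map_some]

theorem Partrec.runHeckeCocycle {c c' : α → Code} {n : α → ℕ} {P : α → List SL(2, ℤ)}
    {R : α → List SL(2, ℤ) → Part ℤ} {l : α → List SL(2, ℤ)} (hc : Computable c)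
    (hc' : Computable c') (hn : Computable n) (hP : Computable P) (hR : Partrec₂ R)
    (hl : Computable l) :
    Partrec fun a => runHeckeCocycle (c a) (c' a) (n a) (P a) (R a) (l a) := by
  have h1 : Partrec₂ fun (q : (α × SL(2, ℤ)) × ℤ) (t : List SL(2, ℤ)) =>
      (R q.1.1 t).map fun a => q.2 * a := by
    have h : Computable fun s : (((α × SL(2, ℤ)) × ℤ) × List SL(2, ℤ)) × ℤ => s.1.1.2 * s.2 :=
      Primrec.int_mul.to_comp.comp (Computable.snd.comp (Computable.fst.comp Computable.fst))
        Computable.snd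
    exact Partrec.map (hR.comp (Computable.fst.comp (Computable.fst.comp Computable.fst))
      Computable.snd) h
  have ha : Computable fun q : (α × SL(2, ℤ)) × ℤ => q.1.1 := Computable.fst.comp Computable.fst
  have h2 : Partrec₂ fun (q : α × SL(2, ℤ)) (b : ℤ) =>
      (_root_.runHeckeTuple (c' q.1) (n q.1) (P q.1) (l q.1) q.2).bind fun t =>
        (R q.1 t).map fun a => b * a :=
    Partrec.bind (Partrec.runHeckeTuple (hc'.comp ha) (hn.comp ha) (hP.comp ha) (hl.comp ha)
      (Computable.snd.comp Computable.fst)) h1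
  have h3 : Partrec₂ fun (a : α) (p : SL(2, ℤ)) => (_root_.runMember (c a) p).bind fun b =>
      (_root_.runHeckeTuple (c' a) (n a) (P a) (l a) p).bind fun t => (R a t).map fun a => b * a :=
    Partrec.bind (Partrec.runMember.comp (hc.comp Computable.fst) Computable.snd) h2
  have h4 : Computable fun s : α × List ℤ => s.2.sum :=
    Primrec.list_sum_int.to_comp.comp Computable.snd
  exact Partrec.map (Partrec.partMap h3 hP) h4

/-- The index is the product of the one in `Γ` and that of `Γ`. The search for a coset system of the
intersection halts for this reason. -/
instance finiteIndex_heckeIntersection (Γ : Subgroup SL(2, ℤ)) [Γ.FiniteIndex] (n : ℕ+) :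
    (heckeIntersection Γ n).FiniteIndex := by
  refine ⟨?_⟩
  rw [heckeIntersection, Subgroup.index_map_subtype]
  exact mul_ne_zero Subgroup.FiniteIndex.index_ne_zero Subgroup.FiniteIndex.index_ne_zero

/-- The images of cocycles under the Hecke operators are computed by programs that depend
computably on the data. -/
theorem exists_hecke_code {R : (Code × ℕ) × List ℤ × List SL(2, ℤ) → Part ℤ} (hR : Partrec R) :
    ∃ K : ((Code × ℕ) × ℕ) × List ℤ → Code, Computable K ∧
      ∀ (c : Code) (Γ : Subgroup SL(2, ℤ)) [Γ.FiniteIndex] (m : ℕ) (n : ℕ+) (v : List ℤ)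
        (w : List SL(2, ℤ) → ℤ) (z : groupCohomology.cocycles (Rep.trivial ℤ Γ ℤ) m),
        IsMembershipTest c Γ → (∀ l, R ((c, m), v, l) = Part.some (w l)) →
        (∀ x : Fin m → Γ, cocycleValue z x = w (List.ofFn fun i => (x i : SL(2, ℤ)))) →
        ∃ z' : groupCohomology.cocycles (Rep.trivial ℤ Γ ℤ) m,
          cohomologyClass z' = (heckeOperator Γ (heckeMatrix n) m).hom (cohomologyClass z) ∧
          ∀ x : Fin m → Γ, (K (((c, m), n), v)).eval
            (Encodable.encode (List.ofFn fun i => (x i : SL(2, ℤ)))) =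
              Part.some (Encodable.encode (cocycleValue z' x)) := by
  obtain ⟨Km, hKm, hmem⟩ := exists_hecke_membershipTest
  obtain ⟨Fc, hFc, hcos⟩ := exists_partrec_cosetSystem
  let f : ((Code × ℕ) × ℕ) × List ℤ → List SL(2, ℤ) → Part ℤ := fun q l =>
    (Fc (Km (q.1.1.1, q.1.2))).bind fun P => runHeckeCocycle q.1.1.1 (Km (q.1.1.1, q.1.2)) q.1.2 P
      (fun t => R (q.1.1, q.2, t)) l
  have hf : Partrec₂ f := by
    have hc : Computable fun s : (((Code × ℕ) × ℕ) × List ℤ) × List SL(2, ℤ) => s.1.1.1.1 :=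
      (Primrec.fst.comp (Primrec.fst.comp (Primrec.fst.comp Primrec.fst))).to_comp
    have hn : Computable fun s : (((Code × ℕ) × ℕ) × List ℤ) × List SL(2, ℤ) => s.1.1.2 :=
      (Primrec.snd.comp (Primrec.fst.comp Primrec.fst)).to_comp
    have hK := hKm.comp (hc.pair hn)
    have hR' : Partrec₂ fun (s : ((((Code × ℕ) × ℕ) × List ℤ) × List SL(2, ℤ)) × List SL(2, ℤ))
        (t : List SL(2, ℤ)) => R (s.1.1.1.1, s.1.1.2, t) := by
      have h : Computable fun s : (((((Code × ℕ) × ℕ) × List ℤ) × List SL(2, ℤ)) ×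
          List SL(2, ℤ)) × List SL(2, ℤ) => (s.1.1.1.1.1, s.1.1.1.2, s.2) := by
        have h1 := Primrec.fst.comp (Primrec.fst.comp (Primrec.fst (α := ((((Code × ℕ) × ℕ) ×
          List ℤ) × List SL(2, ℤ)) × List SL(2, ℤ)) (β := List SL(2, ℤ))))
        exact (Primrec.pair (Primrec.fst.comp (Primrec.fst.comp h1))
          (Primrec.pair (Primrec.snd.comp h1) Primrec.snd)).to_comp
      exact hR.comp h
    exact Partrec.bind (hFc.comp hK) (Partrec.runHeckeCocycle (hc.comp Computable.fst)
      (hK.comp Computable.fst) (hn.comp Computable.fst) Computable.snd hR'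
      (Computable.snd.comp Computable.fst))
  obtain ⟨K, hK, hKspec⟩ := exists_uniform_code hf
  refine ⟨K, hK, fun c Γ hfin m n v w z hc hw hz => ?_⟩
  have hc' := hmem c Γ n hc
  obtain ⟨P, hP, hP'⟩ := hcos _ _ hc' (finiteIndex_heckeIntersection Γ n)
  obtain ⟨z', h1, h2⟩ := exists_hecke_cocycle hP' z (R := w) fun x => (hz x).symm
  refine ⟨z', h1, fun x => ?_⟩
  rw [hKspec, h2]
  dsimp only [f]
  rw [hP, Part.bind_some, runHeckeCocycle_eq hc hc' P hw, Part.map_some]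

/-- Codes of lists are built entry by entry, and a matrix has the same code as its quadruple of
entries. A program for a cocycle can therefore be run on lists of matrices. -/
theorem encode_tupleEntries {Γ : Subgroup SL(2, ℤ)} {m : ℕ} (x : Fin m → Γ) :
    Encodable.encode (tupleEntries x) =
      Encodable.encode (List.ofFn fun i => (x i : SL(2, ℤ))) := by
  have h : tupleEntries x = (List.ofFn fun i => (x i : SL(2, ℤ))).map matrixEntries := by
    rw [List.map_ofFn]
    rfl
  rw [h]
  generalize (List.ofFn fun i => (x i : SL(2, ℤ))) = l
  induction l with
  | nil => rfl
  | cons A l ih => rw [List.map_cons, Encodable.encode_list_cons, Encodable.encode_list_cons, ih,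
      encode_matrixEntries]

theorem map_ofEntries_tupleEntries {Γ : Subgroup SL(2, ℤ)} {m : ℕ} (x : Fin m → Γ) :
    (tupleEntries x).map ofEntries = List.ofFn fun i => (x i : SL(2, ℤ)) := by
  have h : ofEntries ∘ (fun i => matrixEntries (x i)) = fun i => (x i : SL(2, ℤ)) :=
    funext fun i => by rw [Function.comp_apply, ofEntries_matrixEntries]
  rw [tupleEntries, List.map_ofFn, h]

theorem AddMonoidHom.ext_single {r : ℕ} {H : Type*} [AddCommGroup H] {φ ψ : (Fin r → ℤ) →+ H}
    (h : ∀ j, φ (Pi.single j 1) = ψ (Pi.single j 1)) (v : Fin r → ℤ) : φ v = ψ v := by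
  have h1 : φ = ψ := AddMonoidHom.functions_ext' _ _ _ fun j => AddMonoidHom.ext_int (h j)
  rw [h1]

end HeckeAlgorithms

/-! ### Assembly of the four algorithms. -/

theorem mainTheorem3 :
    ∃ (invariants : Nat.Partrec.Code × ℕ →. List ℕ)
      (representative :
        (Nat.Partrec.Code × ℕ) × List ℤ × List (ℤ × ℤ × ℤ × ℤ) →. ℤ)
      (coordinates : (Nat.Partrec.Code × ℕ) × Nat.Partrec.Code →. List ℤ)
      (hecke : (Nat.Partrec.Code × ℕ) × ℕ →. List (List ℤ)),
      Partrec invariants ∧ Partrec representative ∧ Partrec coordinates ∧ Partrec hecke ∧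
      ∀ (Γ : Subgroup SL(2, ℤ)) (hΓ : CongruenceSubgroup.IsCongruenceSubgroup Γ),
      ∀ c : Nat.Partrec.Code, IsMembershipTest c Γ →
      ∀ m : ℕ,
        ∃ d : List ℕ, invariants (c, m) = Part.some d ∧
        ∃ e : (Fin d.length → ℤ) →+ integralCohomology Γ m,
          Function.Surjective e ∧
          (∀ v, e v = 0 ↔ ∀ i, (d.get i : ℤ) ∣ v i) ∧
          (∀ v, ∃ z : groupCohomology.cocycles (Rep.trivial ℤ Γ ℤ) m,
            cohomologyClass z = e v ∧
            ∀ x : Fin m → Γ,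
              representative ((c, m), List.ofFn v, tupleEntries x) =
                Part.some (cocycleValue z x)) ∧
          (∀ (z : groupCohomology.cocycles (Rep.trivial ℤ Γ ℤ) m) (f : Nat.Partrec.Code),
            ComputesCocycle f z →
            ∃ v, coordinates ((c, m), f) = Part.some (List.ofFn v) ∧
              e v = cohomologyClass z) ∧
          (∀ n : ℕ+, ∃ M : Matrix (Fin d.length) (Fin d.length) ℤ,
            hecke ((c, m), (n : ℕ)) = Part.some (List.ofFn fun i => List.ofFn (M i)) ∧
            ∀ v, (heckeT Γ hΓ n m).hom (e v) = e (M.mulVec v)) := by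
  obtain ⟨I, R, C, hI, hR, hC, h⟩ := exists_partrec_cohomology
  obtain ⟨K, hK, hKspec⟩ := exists_hecke_code hR
  refine ⟨I, fun q => R (q.1, q.2.1, q.2.2.map ofEntries), C, fun q => (I q.1).bind fun d =>
    -- The coordinates of the images of the generators are the columns of the matrix; they are
    -- collected as a list of rows and have to be transposed.
    (partMap (fun j => C (q.1, K (q, listSingle d.length j))) (List.range d.length)).map fun M =>
      listTranspose d.length M, hI, ?_, hC, ?_, fun Γ hΓ c hc m => ?_⟩
  · have h1 : Primrec fun q : (Nat.Partrec.Code × ℕ) × List ℤ × List (ℤ × ℤ × ℤ × ℤ) =>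
        (q.1, q.2.1, q.2.2.map ofEntries) :=
      Primrec.pair Primrec.fst (Primrec.pair (Primrec.fst.comp Primrec.snd) (Primrec.list_map
        (Primrec.snd.comp Primrec.snd) (primrec_ofEntries.comp Primrec.snd)))
    exact hR.comp h1.to_comp
  · have h1 : Primrec fun s : (((Nat.Partrec.Code × ℕ) × ℕ) × List ℕ) × ℕ =>
        (s.1.1, listSingle s.1.2.length s.2) :=
      Primrec.pair (Primrec.fst.comp Primrec.fst) (Primrec.listSingle.comp
        (Primrec.list_length.comp (Primrec.snd.comp Primrec.fst)) Primrec.snd)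
    have h2 : Partrec₂ fun (s : ((Nat.Partrec.Code × ℕ) × ℕ) × List ℕ) (j : ℕ) =>
        C (s.1.1, K (s.1, listSingle s.2.length j)) :=
      hC.comp (Computable.pair
        (Computable.fst.comp (Computable.fst.comp Computable.fst)) (hK.comp h1.to_comp))
    have h3 : Primrec fun s : ((Nat.Partrec.Code × ℕ) × ℕ) × List ℕ => List.range s.2.length :=
      Primrec.list_range.comp (Primrec.list_length.comp Primrec.snd)
    have h4 : Primrec fun s : (((Nat.Partrec.Code × ℕ) × ℕ) × List ℕ) × List (List ℤ) =>
        listTranspose s.1.2.length s.2 :=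
      Primrec.listTranspose.comp (Primrec.list_length.comp (Primrec.snd.comp Primrec.fst))
        Primrec.snd
    exact Partrec.bind (hI.comp Computable.fst)
      (Partrec.map (Partrec.partMap h2 h3.to_comp) h4.to_comp)
  -- Finite index is all that the algorithms use of the congruence condition.
  · have hfin : Γ.FiniteIndex := hΓ.finiteIndex
    obtain ⟨d, hd, e, he1, he2, he3, he4⟩ := h c Γ m hc hfin
    refine ⟨d, hd, e, he1, he2, fun v => ?_, fun z f hf => ?_, fun n => ?_⟩
    · obtain ⟨w, hw, z, hz, hzw⟩ := he3 v
      refine ⟨z, hz, fun x => ?_⟩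
      dsimp only
      rw [map_ofEntries_tupleEntries, hw, hzw]
    · exact he4 z f fun x => by rw [← encode_tupleEntries, hf x]
    -- A column of the matrix: a representing cocycle of the `j`-th generator is turned into a
    -- program for its Hecke image, whose coordinates are then computed by the third algorithm. That
    -- `e` is well defined only modulo the `d.get i` is harmless, since any choice of coordinates
    -- serves.
    · have hcol : ∀ j, ∃ v, C ((c, m), K (((c, m), n), List.ofFn (Pi.single j 1))) =
          Part.some (List.ofFn v) ∧ e v = (heckeT Γ hΓ n m).hom (e (Pi.single j 1)) := by
        intro j
        obtain ⟨w, hw, z, hz, hzw⟩ := he3 (Pi.single j 1)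
        obtain ⟨z', hz', hz'K⟩ := hKspec c Γ m n _ w z hc hw hzw
        obtain ⟨v, hv, hev⟩ := he4 z' _ hz'K
        exact ⟨v, hv, by rw [hev, hz', hz]; rfl⟩
      choose col hcol1 hcol2 using hcol
      let M : Matrix (Fin d.length) (Fin d.length) ℤ := Matrix.of col
      refine ⟨M.transpose, ?_, AddMonoidHom.ext_single
        (φ := (heckeT Γ hΓ n m).hom.toAddMonoidHom.comp e)
        (ψ := e.comp M.transpose.mulVecLin.toAddMonoidHom) fun j => ?_⟩
      · have hM : ∀ j ∈ List.range d.length, C ((c, m), K (((c, m), n), listSingle d.length j)) =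
            Part.some ((List.ofFn fun i => List.ofFn (M i)).getD j []) := by
          intro j hj
          have hj' := List.mem_range.1 hj
          rw [show listSingle d.length j = _ from listSingle_eq_ofFn ⟨j, hj'⟩, hcol1]
          simp only [List.getD_eq_getElem?_getD, List.getElem?_ofFn, hj', dite_true,
            Option.getD_some]
          rfl
        have hM' : (List.range d.length).map (fun j => (List.ofFn fun i => List.ofFn (M i)).getD j [])
            = List.ofFn fun i => List.ofFn (M i) :=
          List.ext_getElem (by simp) fun j h1 h2 => by
            rw [List.getElem_map, List.getElem_range, List.getD_eq_getElem _ _ h2]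
        dsimp only
        rw [hd, Part.bind_some, partMap_eq hM, Part.map_some, hM', listTranspose_eq_ofFn,
          listMatrix_ofFn]
      · change (heckeT Γ hΓ n m).hom (e (Pi.single j 1)) =
          e (M.transpose.mulVec (Pi.single j 1))
        rw [← hcol2, Matrix.mulVec_single_one]
        rfl
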